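/- For a finite simple graph $F$ let $\Delta(F)$ denote its maximum degree, $\mathbf{cc}(F)$ its number of connected components, and $\mathbf{fvs}(F)$ its feedback vertex set number, i.e. the minimum size of a set of vertices whose deletion leaves a forest. In the \textsc{Subgraph Isomorphism} problem one is given two finite simple graphs $H$ and $G$ and asks whether there is an injective map $\eta\colon V(H)\to V(G)$ such that $\eta(u)\eta(v)\in E(G)$ whenever $uv\in E(H)$. There are an algorithm $\mathbb{A}$ (a program of a unit-cost random access machine with addition and subtraction), a computable function $f\colon\mathbb{N}^3\to\mathbb{N}$ and a constant $c\in\mathbb{N}$ such that for all finite simple graphs $H$ and $G$ with $\Delta(H)\le 2$ (that is, $H$ is a disjoint union of paths and cycles), $\mathbb{A}$ on input $(H,G)$ halts after at most $$f\bigl(\Delta(G),\mathbf{fvs}(G),\mathbf{cc}(H)\bigr)\cdot n^{c}$$ steps and correctly decides whether $(H,G)$ is a yes-instance of \textsc{Subgraph Isomorphism}. Here the graphs are given by their numbers of vertices and their adjacency matrices, and $n=2+|V(H)|^2+|V(G)|^2$ is the total size of the input in machine words. -/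

import Mathlib

/-! ### The machine model

A random access machine with unbounded registers `X₀, X₁, X₂, …` holding natural numbers, a
read-only input (a finite list of natural numbers, accessed by position) and unit-cost instructions.
The only arithmetic is addition and truncated subtraction (no multiplication), so time on this
machine is polynomially related to time on Turing machines. Programs are built from instructions by
sequencing, branching and looping. -/

namespace RAM

/-- The contents of all registers. -/
abbrev Memory := ℕ → ℕ

/-- The instructions. Each of them takes one step. -/
inductive Instr where
  /-- `X_i := c` -/
  | const (i c : ℕ)
  /-- `X_i := X_j + X_k` -/
  | add (i j k : ℕ)
  /-- `X_i := X_j - X_k` (and `0` if `X_j < X_k`) -/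
  | sub (i j k : ℕ)
  /-- `X_i := X_(X_j)` -/
  | load (i j : ℕ)
  /-- `X_(X_i) := X_j` -/
  | store (i j : ℕ)
  /-- `X_i :=` the input word at position `X_j` (and `0` beyond the end of the input) -/
  | read (i j : ℕ)

/-- The effect of one instruction on the memory. -/
def Instr.exec (input : List ℕ) (m : Memory) : Instr → Memory
  | .const i c => Function.update m i c
  | .add i j k => Function.update m i (m j + m k)
  | .sub i j k => Function.update m i (m j - m k)
  | .load i j => Function.update m i (m (m j))
  | .store i j => Function.update m (m i) (m j)
  | .read i j => Function.update m i (input.getD (m j) 0)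

/-- Programs. -/
inductive Program where
  | instr (a : Instr)
  | seq (p q : Program)
  /-- if `X_i ≠ 0` then `p` else `q` -/
  | ite (i : ℕ) (p q : Program)
  /-- while `X_i ≠ 0` do `p` -/
  | loop (i : ℕ) (p : Program)

/-- `Runs input p m t m'`: on the given input, the program `p` started with memory `m` halts after
exactly `t` steps with memory `m'`. Each instruction and each test of a register is one step. -/
inductive Runs (input : List ℕ) : Program → Memory → ℕ → Memory → Prop
  | instr (a : Instr) (m : Memory) : Runs input (.instr a) m 1 (a.exec input m)
  | seq {p q : Program} {m m' m'' : Memory} {t t' : ℕ} :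
      Runs input p m t m' → Runs input q m' t' m'' → Runs input (.seq p q) m (t + t') m''
  | ite_true {i : ℕ} {p q : Program} {m m' : Memory} {t : ℕ} :
      m i ≠ 0 → Runs input p m t m' → Runs input (.ite i p q) m (1 + t) m'
  | ite_false {i : ℕ} {p q : Program} {m m' : Memory} {t : ℕ} :
      m i = 0 → Runs input q m t m' → Runs input (.ite i p q) m (1 + t) m'
  | loop_true {i : ℕ} {p : Program} {m m' m'' : Memory} {t t' : ℕ} :
      m i ≠ 0 → Runs input p m t m' → Runs input (.loop i p) m' t' m'' →
        Runs input (.loop i p) m (1 + t + t') m''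
  | loop_false {i : ℕ} {p : Program} {m : Memory} :
      m i = 0 → Runs input (.loop i p) m 1 m

/-- The machine is deterministic: running time and final memory are determined by the program, the
input and the initial memory. -/
theorem Runs.deterministic {input : List ℕ} {p : Program} {m m₁ : Memory} {t₁ : ℕ}
    (h₁ : Runs input p m t₁ m₁) :
    ∀ {t₂ : ℕ} {m₂ : Memory}, Runs input p m t₂ m₂ → t₁ = t₂ ∧ m₁ = m₂ := by
  induction h₁ with
  | instr a m => intro t₂ m₂ h₂; cases h₂; exact ⟨rfl, rfl⟩
  | seq _ _ ih ih' =>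
    intro t₂ m₂ h₂
    cases h₂ with
    | seq h h' =>
      obtain ⟨rfl, rfl⟩ := ih h
      obtain ⟨rfl, rfl⟩ := ih' h'
      exact ⟨rfl, rfl⟩
  | ite_true hi _ ih =>
    intro t₂ m₂ h₂
    cases h₂ with
    | ite_true _ h => obtain ⟨rfl, rfl⟩ := ih h; exact ⟨rfl, rfl⟩
    | ite_false hi' _ => exact absurd hi' hi
  | ite_false hi _ ih =>
    intro t₂ m₂ h₂
    cases h₂ with
    | ite_true hi' _ => exact absurd hi hi'
    | ite_false _ h => obtain ⟨rfl, rfl⟩ := ih h; exact ⟨rfl, rfl⟩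
  | loop_true hi _ _ ih ih' =>
    intro t₂ m₂ h₂
    cases h₂ with
    | loop_true _ h h' =>
      obtain ⟨rfl, rfl⟩ := ih h
      obtain ⟨rfl, rfl⟩ := ih' h'
      exact ⟨rfl, rfl⟩
    | loop_false hi' => exact absurd hi' hi
  | loop_false hi =>
    intro t₂ m₂ h₂
    cases h₂ with
    | loop_true hi' _ _ => exact absurd hi hi'
    | loop_false _ => exact ⟨rfl, rfl⟩

/-- Started with all registers `0`, the program halts on the input after exactly `t` steps with
the answer `b` in `X₀` (`1` for yes, `0` for no). -/
def Answers (p : Program) (input : List ℕ) (t : ℕ) (b : Prop) : Prop :=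
  ∃ m : Memory, Runs input p (fun _ => 0) t m ∧ (b → m 0 = 1) ∧ (¬ b → m 0 = 0)

end RAM

/-! ### Instances of Subgraph Isomorphism and their parameters -/

namespace SubgraphIso

open Classical in
/-- The rows of the adjacency matrix, one after the other, as a list of zeros and ones. -/
noncomputable def adjList {n : ℕ} (G : SimpleGraph (Fin n)) : List ℕ :=
  (List.finRange n).flatMap fun i => (List.finRange n).map fun j => if G.Adj i j then 1 else 0

/-- The input `(H, G)` as given to the machine: the two numbers of vertices, then the two
adjacency matrices. -/
noncomputable def encode {h g : ℕ} (H : SimpleGraph (Fin h)) (G : SimpleGraph (Fin g)) : List ℕ :=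
  h :: g :: (adjList H ++ adjList G)

open Classical in
/-- The maximum degree `Δ(G)`. -/
noncomputable def maxDeg {V : Type*} [Fintype V] (G : SimpleGraph V) : ℕ := G.maxDegree

/-- The feedback vertex set number: the least size of a set of vertices whose deletion leaves a
forest. -/
noncomputable def fvs {V : Type*} [Fintype V] (G : SimpleGraph V) : ℕ :=
  sInf {k | ∃ S : Finset V, S.card = k ∧ (G.induce {v | v ∉ S}).IsAcyclic}

/-- The number of connected components. -/
noncomputable def cc {V : Type*} [Fintype V] (G : SimpleGraph V) : ℕ := Nat.card G.ConnectedComponent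

end SubgraphIso

/-!
Deleting the edges outside the image of an embedding does not destroy the embedding. Call an edge
of the `2`-core of `G` with an end of degree at least three in the core a branch edge; there are at
most `6 · Δ(G) · fvs(G)` of them, so the set of those avoided by the embedding can be guessed.
After deleting these edges, every subgraph of minimum degree two of the host is a disjoint union of
cycles, because the image of `H` has maximum degree two.

Such a host is eliminated vertex by vertex, always taking a vertex with at most one neighbour left
or else cutting a cycle, and the block of the eliminated vertex is merged into that of a neighbour.
At any time all edges leaving a block start at its root, or at one more vertex if a cycle is being
processed. So a partial embedding into a block need only record the vertices of `H` mapped to these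
two vertices and its domain. The domain is a union of components of `H` without the edges at these
two vertices of `H`, which leaves at most `2 ^ (cc(H) + 6)` possibilities.

All intermediate results are bits of a table whose addresses are digits in a base `B`, and each bit
is given by a formula in which quantifiers, minima and cardinalities range below `B`. Formulas of
this kind reduce to bounded sums, which a program evaluates in time polynomial in `B`. A base that
is linear in the size of the graphs suffices to compute the number of branch edges and components,
and multiplying it by the resulting power of two makes room for the numbers of their subsets.
-/

namespace RAM

open Polynomial

infixr:60 " ;; " => Program.seq

/-- Started with memory `m`, the program halts within `T` steps with a memory satisfying `Q`. -/
def HaltsWithin (input : List ℕ) (p : Program) (m : Memory) (T : ℕ) (Q : Memory → Prop) : Prop :=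
  ∃ τ m', Runs input p m τ m' ∧ τ ≤ T ∧ Q m'

namespace HaltsWithin

variable {input : List ℕ} {p q : Program} {m : Memory} {S T : ℕ} {Q R : Memory → Prop}

theorem mono (h : HaltsWithin input p m S Q) (hT : S ≤ T) (hQ : ∀ m', Q m' → R m') :
    HaltsWithin input p m T R := by
  obtain ⟨τ, m', hrun, hτ, hm'⟩ := h
  exact ⟨τ, m', hrun, hτ.trans hT, hQ m' hm'⟩

theorem instr {a : Instr} (h : Q (a.exec input m)) : HaltsWithin input (.instr a) m 1 Q :=
  ⟨1, _, .instr a m, le_rfl, h⟩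

theorem seq (h : HaltsWithin input p m S fun m' => HaltsWithin input q m' T Q) :
    HaltsWithin input (p ;; q) m (S + T) Q := by
  obtain ⟨τ, m', hrun, hτ, τ', m'', hrun', hτ', hQ⟩ := h
  exact ⟨τ + τ', m'', .seq hrun hrun', add_le_add hτ hτ', hQ⟩

theorem instr_seq {a : Instr} (h : HaltsWithin input q (a.exec input m) T Q) :
    HaltsWithin input (.instr a ;; q) m (1 + T) Q :=
  seq (instr h)

/-- The invariant `I k` holds whenever `k` iterations remain to be done. -/
theorem countdown {i : ℕ} {I : ℕ → Memory → Prop} (hI : ∀ k m, I k m → m i = k)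
    (hstep : ∀ k m, I (k + 1) m → HaltsWithin input p m T (I k)) :
    ∀ n m, I n m → HaltsWithin input (.loop i p) m (1 + n * (1 + T)) (I 0)
  | 0, m, h => ⟨1, m, .loop_false (hI 0 m h), by simp, h⟩
  | n + 1, m, h => by
    obtain ⟨τ, m', hrun, hτ, hm'⟩ := hstep n m h
    obtain ⟨τ', m'', hrun', hτ', hm''⟩ := countdown hI hstep n m' hm'
    refine ⟨1 + τ + τ', m'', .loop_true (by rw [hI _ m h]; omega) hrun hrun', ?_, hm''⟩
    rw [Nat.succ_mul]
    omega

end HaltsWithin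

/-- The bound variable with value `x` in front of the variables with values `ρ`. -/
def push (x : ℕ) (ρ : ℕ → ℕ) : ℕ → ℕ
  | 0 => x
  | i + 1 => ρ i

/-- The data an evaluation refers to: the input, a table, and the bound `B` for sums. -/
structure Ctx where
  inp : List ℕ
  tab : ℕ → ℕ
  B : ℕ

/-- The context seen in a memory: the bound is in register `1`, the table starts at address `β`. -/
def ctxOf (input : List ℕ) (β : ℕ) (m : Memory) : Ctx := ⟨input, fun a => m (β + a), m 1⟩

/-- The memories differ at most in the working registers, those from `d` up to `β`. -/
def EqOff (d β : ℕ) (m m' : Memory) : Prop := ∀ r, r < d ∨ β ≤ r → m' r = m r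

theorem EqOff.trans {d e β : ℕ} {m m' m'' : Memory} (h : EqOff d β m m') (h' : EqOff e β m' m'')
    (hde : d ≤ e) : EqOff d β m m'' := fun r hr => (h' r (by omega)).trans (h r hr)

theorem EqOff.ctxOf_eq {d β : ℕ} {m m' : Memory} (h : EqOff d β m m') (hd : 2 ≤ d)
    (input : List ℕ) : ctxOf input β m' = ctxOf input β m := by
  simp only [ctxOf, Ctx.mk.injEq, true_and]
  exact ⟨funext fun a => h _ (.inr (by omega)), h _ (.inl (by omega))⟩

theorem EqOff.comp_eq {d β : ℕ} {m m' : Memory} (h : EqOff d β m m') {vs : ℕ → ℕ}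
    (hvs : ∀ i, vs i < d) : m' ∘ vs = m ∘ vs :=
  funext fun i => h _ (.inl (hvs i))

/-- `p` puts the value of `F` into register `d`, in time `T` of the bound. The variables of `F` are
found in the registers `vs`; from the working registers on, only those below `β` are changed. -/
def Evaluates (p : Program) (F : Ctx → (ℕ → ℕ) → ℕ) (vs : ℕ → ℕ) (d β : ℕ) (T : ℕ[X]) : Prop :=
  ∀ input m, HaltsWithin input p m (T.eval (m 1)) fun m' =>
    m' d = F (ctxOf input β m) (m ∘ vs) ∧ EqOff d β m m'

/-- `F`, a function of a context and of the values of its variables, is evaluated by programs whose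
running time is polynomial in the bound. The number `σ` of working registers and the time `T` are
uniform in the location `vs` of the variables, the first working register `d`, and the address `β`
of the table. -/
def Definable (F : Ctx → (ℕ → ℕ) → ℕ) : Prop :=
  ∃ (σ : ℕ) (T : ℕ[X]), ∀ (vs : ℕ → ℕ) (d β : ℕ), 2 ≤ d → (∀ i, vs i < d) → d + σ ≤ β →
    ∃ p, Evaluates p F vs d β T

namespace Definable

variable {F G : Ctx → (ℕ → ℕ) → ℕ}

theorem const (k : ℕ) : Definable fun _ _ => k := by
  refine ⟨1, 1, fun vs d β _ _ hβ => ⟨.instr (.const d k), fun input m => ?_⟩⟩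
  rw [eval_one]
  refine .instr ⟨by simp [Instr.exec], fun r hr => ?_⟩
  simp [Instr.exec, show r ≠ d by omega]

theorem var (i : ℕ) : Definable fun _ ρ => ρ i := by
  refine ⟨1, 2, fun vs d β _ hvs hβ => ⟨.instr (.const d 0) ;; .instr (.add d (vs i) d),
    fun input m => ?_⟩⟩
  rw [eval_ofNat]
  refine .instr_seq (.instr ⟨by simp [Instr.exec, (hvs i).ne], fun r hr => ?_⟩)
  simp [Instr.exec, show r ≠ d by omega]

theorem bound : Definable fun c _ => c.B := by
  refine ⟨1, 2, fun vs d β hd _ hβ => ⟨.instr (.const d 0) ;; .instr (.add d 1 d),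
    fun input m => ?_⟩⟩
  rw [eval_ofNat]
  refine .instr_seq (.instr ⟨by simp [Instr.exec, show 1 ≠ d by omega, ctxOf], fun r hr => ?_⟩)
  simp [Instr.exec, show r ≠ d by omega]

theorem reindex (hF : Definable F) (f : ℕ → ℕ) : Definable fun c ρ => F c fun i => ρ (f i) := by
  obtain ⟨σ, T, h⟩ := hF
  exact ⟨σ, T, fun vs d β hd hvs hβ => h (vs ∘ f) d β hd (fun i => hvs _) hβ⟩

theorem binary {op : ℕ → ℕ → ℕ} {a : ℕ → Instr}
    (ha : ∀ input d m, (a d).exec input m = Function.update m d (op (m d) (m (d + 1))))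
    (hF : Definable F) (hG : Definable G) : Definable fun c ρ => op (F c ρ) (G c ρ) := by
  obtain ⟨σ, S, hF⟩ := hF
  obtain ⟨τ, T, hG⟩ := hG
  refine ⟨σ + τ + 2, S + (T + 1), fun vs d β hd hvs hβ => ?_⟩
  obtain ⟨p, hp⟩ := hF vs d β hd hvs (by omega)
  obtain ⟨q, hq⟩ := hG vs (d + 1) β (by omega) (fun i => (hvs i).trans (by omega)) (by omega)
  refine ⟨p ;; q ;; .instr (a d), fun input m => ?_⟩
  simp only [eval_add, eval_one]
  refine .seq ((hp input m).mono le_rfl fun m₁ h₁ => .seq ?_)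
  rw [← h₁.2 1 (.inl hd)]
  refine (hq input m₁).mono le_rfl fun m₂ h₂ => .instr ?_
  rw [h₁.2.ctxOf_eq hd, h₁.2.comp_eq hvs] at h₂
  rw [ha, h₂.1, h₂.2 d (.inl (by omega)), h₁.1]
  refine ⟨Function.update_self .., fun r hr => ?_⟩
  rw [Function.update_of_ne (by omega), h₁.2.trans h₂.2 (by omega) r hr]

theorem add (hF : Definable F) (hG : Definable G) : Definable fun c ρ => F c ρ + G c ρ :=
  binary (a := fun d => .add d d (d + 1)) (fun _ _ _ => rfl) hF hG

theorem sub (hF : Definable F) (hG : Definable G) : Definable fun c ρ => F c ρ - G c ρ :=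
  binary (a := fun d => .sub d d (d + 1)) (fun _ _ _ => rfl) hF hG

theorem subst {F : Ctx → (ℕ → ℕ) → ℕ → ℕ}
    (hF : Definable fun c ρ => F c (fun i => ρ (i + 1)) (ρ 0)) (hG : Definable G) :
    Definable fun c ρ => F c ρ (G c ρ) := by
  obtain ⟨σ, S, hF⟩ := hF
  obtain ⟨τ, T, hG⟩ := hG
  refine ⟨σ + τ + 2, T + (S + 2), fun vs d β hd hvs hβ => ?_⟩
  obtain ⟨q, hq⟩ := hG vs d β hd hvs (by omega)
  obtain ⟨p, hp⟩ := hF (push d vs) (d + 1) β (by omega)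
    (fun | 0 => Nat.lt_succ_self _ | i + 1 => (hvs i).trans (by omega)) (by omega)
  refine ⟨q ;; p ;; .instr (.const d 0) ;; .instr (.add d d (d + 1)), fun input m => ?_⟩
  simp only [eval_add, eval_ofNat]
  refine .seq ((hq input m).mono le_rfl fun m₁ h₁ => .seq ?_)
  rw [← h₁.2 1 (.inl hd)]
  refine (hp input m₁).mono le_rfl fun m₂ h₂ => .instr_seq (.instr ?_)
  have hvar : (fun i => (m₁ ∘ push d vs) (i + 1)) = m ∘ vs := h₁.2.comp_eq hvs
  have hfst : (m₁ ∘ push d vs) 0 = m₁ d := rfl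
  beta_reduce at h₂
  rw [hvar, hfst, h₁.1, h₁.2.ctxOf_eq hd] at h₂
  refine ⟨by simp [Instr.exec, h₂.1], fun r hr => ?_⟩
  simp [Instr.exec, show r ≠ d by omega, h₁.2.trans h₂.2 (by omega) r hr]

theorem inp (hF : Definable F) : Definable fun c ρ => c.inp.getD (F c ρ) 0 := by
  obtain ⟨σ, T, hF⟩ := hF
  refine ⟨σ + 1, T + 1, fun vs d β hd hvs hβ => ?_⟩
  obtain ⟨p, hp⟩ := hF vs d β hd hvs (by omega)
  refine ⟨p ;; .instr (.read d d), fun input m => ?_⟩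
  rw [eval_add, eval_one]
  refine .seq ((hp input m).mono le_rfl fun m₁ h₁ => .instr ?_)
  refine ⟨by simp [Instr.exec, h₁.1, ctxOf], fun r hr => ?_⟩
  simp [Instr.exec, show r ≠ d by omega, h₁.2 r hr]

theorem tab (hF : Definable F) : Definable fun c ρ => c.tab (F c ρ) := by
  obtain ⟨σ, T, hF⟩ := hF
  refine ⟨σ + 2, T + 3, fun vs d β hd hvs hβ => ?_⟩
  obtain ⟨p, hp⟩ := hF vs d β hd hvs (by omega)
  refine ⟨p ;; .instr (.const (d + 1) β) ;; .instr (.add d d (d + 1)) ;; .instr (.load d d),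
    fun input m => ?_⟩
  rw [eval_add, eval_ofNat]
  refine .seq ((hp input m).mono le_rfl fun m₁ h₁ => .instr_seq (.instr_seq (.instr ?_)))
  refine ⟨?_, fun r hr => ?_⟩
  · have hd' : m₁ d + β ≠ d := by omega
    have hd'' : m₁ d + β ≠ d + 1 := by omega
    have htab : m₁ (m₁ d + β) = m (β + m₁ d) := by rw [add_comm, h₁.2 _ (.inr (by omega))]
    simp only [Instr.exec, Function.update_self, ne_eq, (Nat.succ_ne_self d).symm,
      not_false_eq_true, Function.update_of_ne, hd', hd'']
    rw [htab, h₁.1, ctxOf]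
  · simp [Instr.exec, show r ≠ d by omega, show r ≠ d + 1 by omega, h₁.2 r hr]

/-- Loop invariant of a summation: register `d + 1` counts the `k` terms that are still missing from
the sum in register `d`. -/
def SumInvariant (f : ℕ → ℕ) (d β : ℕ) (m : Memory) (k : ℕ) (m' : Memory) : Prop :=
  m' (d + 1) = k ∧ m' d + ∑ x ∈ Finset.range k, f x = ∑ x ∈ Finset.range (m 1), f x ∧
    EqOff d β m m'

theorem SumInvariant.step {input : List ℕ} {p : Program} {f : ℕ → ℕ} {d β k T : ℕ}
    {m m₁ : Memory} (hβ : d + 3 ≤ β)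
    (hp : ∀ m₂, EqOff d β m m₂ → HaltsWithin input p m₂ T fun m₃ =>
      m₃ (d + 2) = f (m₂ (d + 1)) ∧ EqOff (d + 2) β m₂ m₃)
    (h : SumInvariant f d β m (k + 1) m₁) :
    HaltsWithin input (.instr (.const (d + 2) 1) ;; .instr (.sub (d + 1) (d + 1) (d + 2)) ;;
      p ;; .instr (.add d d (d + 2))) m₁ (1 + (1 + (T + 1))) (SumInvariant f d β m k) := by
  obtain ⟨hk, hsum, hm₁⟩ := h
  set m₂ := Function.update (Function.update m₁ (d + 2) 1) (d + 1) k with hm₂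
  have hexec : (Instr.sub (d + 1) (d + 1) (d + 2)).exec input
      ((Instr.const (d + 2) 1).exec input m₁) = m₂ := by simp [Instr.exec, hm₂, hk]
  have heq : EqOff d β m m₂ := hm₁.trans (fun r hr => by
    simp [hm₂, show r ≠ d + 1 by omega, show r ≠ d + 2 by omega]) le_rfl
  refine .instr_seq (.instr_seq (.seq ?_))
  rw [hexec]
  refine (hp m₂ heq).mono le_rfl fun m₃ h₃ => .instr ⟨?_, ?_, fun r hr => ?_⟩
  · simp [Instr.exec, h₃.2 (d + 1) (.inl (by omega)), hm₂]
  · have hm₂d : m₂ d = m₁ d := by simp [hm₂]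
    have hm₂k : m₂ (d + 1) = k := by simp [hm₂]
    simp only [Instr.exec, Function.update_self, h₃.1, h₃.2 d (.inl (by omega)), ← hsum,
      Finset.sum_range_succ, hm₂d, hm₂k]
    ring
  · rw [Instr.exec, Function.update_of_ne (by omega), heq.trans h₃.2 (by omega) r hr]

theorem sum {F : Ctx → (ℕ → ℕ) → ℕ → ℕ} (hF : Definable fun c ρ => F c (fun i => ρ (i + 1)) (ρ 0)) :
    Definable fun c ρ => ∑ x ∈ Finset.range c.B, F c ρ x := by
  obtain ⟨σ, T, hF⟩ := hF
  refine ⟨σ + 3, 4 + X * (4 + T), fun vs d β hd hvs hβ => ?_⟩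
  obtain ⟨p, hp⟩ := hF (push (d + 1) vs) (d + 2) β (by omega)
    (fun | 0 => Nat.lt_succ_self _ | i + 1 => (hvs i).trans (by omega)) (by omega)
  refine ⟨.instr (.const d 0) ;; .instr (.const (d + 1) 0) ;; .instr (.add (d + 1) 1 (d + 1)) ;;
    .loop (d + 1) (.instr (.const (d + 2) 1) ;; .instr (.sub (d + 1) (d + 1) (d + 2)) ;;
      p ;; .instr (.add d d (d + 2))), fun input m => ?_⟩
  let I := SumInvariant (F (ctxOf input β m) (m ∘ vs)) d β m
  have hstart : I (m 1) ((Instr.add (d + 1) 1 (d + 1)).exec input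
      ((Instr.const (d + 1) 0).exec input ((Instr.const d 0).exec input m))) := by
    refine ⟨?_, ?_, fun r hr => ?_⟩
    · simp [Instr.exec, show 1 ≠ d by omega, show d ≠ 0 by omega]
    · simp [Instr.exec]
    · simp [Instr.exec, show r ≠ d by omega, show r ≠ d + 1 by omega]
  have hbody (m₂ : Memory) (heq : EqOff d β m m₂) :
      HaltsWithin input p m₂ (T.eval (m 1)) fun m₃ =>
        m₃ (d + 2) = F (ctxOf input β m) (m ∘ vs) (m₂ (d + 1)) ∧ EqOff (d + 2) β m₂ m₃ := by
    have hvar : (fun i => (m₂ ∘ push (d + 1) vs) (i + 1)) = m ∘ vs := heq.comp_eq hvs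
    have h := hp input m₂
    beta_reduce at h
    rwa [heq 1 (.inl hd), heq.ctxOf_eq hd, hvar] at h
  refine (HaltsWithin.instr_seq (.instr_seq (.instr_seq (.countdown (I := I) (fun _ _ h => h.1)
    (fun _ _ => SumInvariant.step (by omega) hbody) _ _ hstart)))).mono ?_ fun m' h => ⟨?_, h.2.2⟩
  · simp only [eval_add, eval_mul, eval_X, eval_ofNat]
    exact Eq.le (by ring)
  · exact (Nat.add_zero _).symm.trans h.2.1

end Definable

end RAM

namespace RAM

open Polynomial
open scoped Finset

open Classical in
/-- The characteristic function of the predicate is `Definable`. -/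
def DefinablePred (P : Ctx → (ℕ → ℕ) → Prop) : Prop := Definable fun c ρ => if P c ρ then 1 else 0

variable {F G : Ctx → (ℕ → ℕ) → ℕ} {P Q : Ctx → (ℕ → ℕ) → Prop}

theorem Definable.congr (hF : Definable F) (h : ∀ c ρ, F c ρ = G c ρ) : Definable G := by
  rwa [← funext₂ h]

namespace DefinablePred

theorem congr (hP : DefinablePred P) (h : ∀ c ρ, P c ρ ↔ Q c ρ) : DefinablePred Q := by
  rwa [← funext₂ fun c ρ => propext (h c ρ)]

theorem reindex (hP : DefinablePred P) (f : ℕ → ℕ) :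
    DefinablePred fun c ρ => P c fun i => ρ (f i) :=
  Definable.reindex hP f

theorem ne_zero (hF : Definable F) : DefinablePred fun c ρ => F c ρ ≠ 0 :=
  ((Definable.const 1).sub ((Definable.const 1).sub hF)).congr fun c ρ => by split_ifs <;> omega

theorem not (hP : DefinablePred P) : DefinablePred fun c ρ => ¬P c ρ :=
  ((Definable.const 1).sub hP).congr fun c ρ => by
    by_cases hP : P c ρ <;> simp [hP]

theorem lt (hF : Definable F) (hG : Definable G) : DefinablePred fun c ρ => F c ρ < G c ρ :=
  (ne_zero (hG.sub hF)).congr fun c ρ => by omega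

theorem le (hF : Definable F) (hG : Definable G) : DefinablePred fun c ρ => F c ρ ≤ G c ρ :=
  (lt hG hF).not.congr fun _ _ => not_lt

theorem and (hP : DefinablePred P) (hQ : DefinablePred Q) :
    DefinablePred fun c ρ => P c ρ ∧ Q c ρ :=
  ((Definable.add hP hQ).sub (.const 1)).congr fun c ρ => by
    by_cases hP : P c ρ <;> by_cases hQ : Q c ρ <;> simp [hP, hQ]

theorem or (hP : DefinablePred P) (hQ : DefinablePred Q) :
    DefinablePred fun c ρ => P c ρ ∨ Q c ρ :=
  (hP.not.and hQ.not).not.congr fun c ρ => by tauto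

theorem imp (hP : DefinablePred P) (hQ : DefinablePred Q) :
    DefinablePred fun c ρ => P c ρ → Q c ρ :=
  (hP.not.or hQ).congr fun c ρ => by tauto

theorem eq (hF : Definable F) (hG : Definable G) : DefinablePred fun c ρ => F c ρ = G c ρ :=
  ((le hF hG).and (le hG hF)).congr fun c ρ => by omega

theorem ne (hF : Definable F) (hG : Definable G) : DefinablePred fun c ρ => F c ρ ≠ G c ρ :=
  (eq hF hG).not

end DefinablePred

theorem Definable.card {P : Ctx → (ℕ → ℕ) → ℕ → Prop} [∀ c ρ, DecidablePred (P c ρ)]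
    (hP : DefinablePred fun c ρ => P c (fun i => ρ (i + 1)) (ρ 0)) :
    Definable fun c ρ => #{x ∈ Finset.range c.B | P c ρ x} :=
  (Definable.sum (F := fun c ρ x => if P c ρ x then 1 else 0)
    (Definable.congr hP fun _ _ => by congr!)).congr fun _ _ => (Finset.card_filter _ _).symm

open Classical in
theorem DefinablePred.ex {P : Ctx → (ℕ → ℕ) → ℕ → Prop}
    (hP : DefinablePred fun c ρ => P c (fun i => ρ (i + 1)) (ρ 0)) :
    DefinablePred fun c ρ => ∃ x < c.B, P c ρ x :=
  (ne_zero (.card hP)).congr fun c ρ => by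
    simp [Finset.filter_eq_empty_iff]

theorem DefinablePred.all {P : Ctx → (ℕ → ℕ) → ℕ → Prop}
    (hP : DefinablePred fun c ρ => P c (fun i => ρ (i + 1)) (ρ 0)) :
    DefinablePred fun c ρ => ∀ x < c.B, P c ρ x :=
  (ex (P := fun c ρ x => ¬P c ρ x) hP.not).not.congr fun c ρ => by push Not; rfl

theorem Definable.mul_bound (hF : Definable F) : Definable fun c ρ => F c ρ * c.B :=
  (Definable.sum (F := fun c ρ _ => F c ρ) (hF.reindex _)).congr fun c ρ => by simp [mul_comm]

theorem Definable.bound_pow : ∀ k : ℕ, Definable fun c _ => c.B ^ k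
  | 0 => Definable.const 1
  | k + 1 => (bound_pow k).mul_bound

open Classical in
/-- The first `N` entries of the table of `c` are the truth values of the rule `P`, each of them
computed from a table that agrees with the final one on the smaller addresses. -/
def Filled (P : Ctx → ℕ → Prop) (N : ℕ) (c : Ctx) : Prop :=
  ∀ a < N, ∃ T : ℕ → ℕ, (∀ a' < a, T a' = c.tab a') ∧
    c.tab a = if P ⟨c.inp, T, c.B⟩ a then 1 else 0

open Classical in
theorem Filled.extend {P : Ctx → ℕ → Prop} {N : ℕ} {input : List ℕ} {T T' : ℕ → ℕ} {B : ℕ}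
    (h : Filled P N ⟨input, T, B⟩) (hT : ∀ a < N, T' a = T a)
    (hN : T' N = if P ⟨input, T, B⟩ N then 1 else 0) : Filled P (N + 1) ⟨input, T', B⟩ := by
  intro a ha
  rcases Nat.lt_succ_iff_lt_or_eq.1 ha with ha | rfl
  · obtain ⟨T'', hT'', hP⟩ := h a ha
    exact ⟨T'', fun a' ha' => (hT'' a' ha').trans (hT a' (ha'.trans ha)).symm, (hT a ha).trans hP⟩
  · exact ⟨T, fun a' ha' => (hT a' ha').symm, hN⟩

/-- Writes register `4` into the table at the address kept in register `2`, advances the address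
and decreases the counter in register `3`. -/
def storeNext (β : ℕ) : Program :=
  .instr (.const 5 β) ;; .instr (.add 5 5 2) ;; .instr (.store 5 4) ;; .instr (.const 5 1) ;;
    .instr (.add 2 2 5) ;; .instr (.sub 3 3 5)

theorem halts_storeNext {β : ℕ} (hβ : 6 ≤ β) (input : List ℕ) (m : Memory) :
    HaltsWithin input (storeNext β) m 6 fun m' =>
      m' 1 = m 1 ∧ m' 2 = m 2 + 1 ∧ m' 3 = m 3 - 1 ∧ m' (β + m 2) = m 4 ∧
        ∀ a ≠ m 2, m' (β + a) = m (β + a) := by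
  refine .instr_seq (.instr_seq (.instr_seq (.instr_seq (.instr_seq (.instr ?_)))))
  have h (r : ℕ) (hr : r < 6) (a : ℕ) : β + a ≠ r ∧ r ≠ β + a := by omega
  refine ⟨?_, ?_, ?_, ?_, fun a ha => ?_⟩ <;> simp [Instr.exec, *]

open Classical in
theorem halts_fillLoop {P : Ctx → ℕ → Prop} {p : Program} {β : ℕ} {T : ℕ[X]} (hβ : 6 ≤ β)
    (hp : Evaluates p (fun c ρ => if P c (ρ 0) then 1 else 0) (fun _ => 2) 4 β T) {input : List ℕ}
    {m : Memory} (h2 : m 2 = 0) :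
    HaltsWithin input (.loop 3 (p ;; storeNext β)) m (1 + m 3 * (7 + T.eval (m 1))) fun m' =>
      m' 1 = m 1 ∧ Filled P (m 3) (ctxOf input β m') := by
  let I : ℕ → Memory → Prop := fun k m' => m' 3 = k ∧ m' 1 = m 1 ∧ m' 2 + k = m 3 ∧
    Filled P (m' 2) (ctxOf input β m')
  have hstart : I (m 3) m := ⟨rfl, rfl, by omega, by simp [h2, Filled]⟩
  refine (HaltsWithin.countdown (I := I) (T := T.eval (m 1) + 6) (fun _ _ h => h.1)
    (fun k m₁ hI => ?_) _ _ hstart).mono (Nat.le_of_eq (by ring)) fun m' hI => ?_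
  · obtain ⟨h3, h1, h23, hfill⟩ := hI
    rw [← h1]
    refine .seq ((hp input m₁).mono le_rfl fun m₂ hm₂ => ?_)
    obtain ⟨hval, heq⟩ := hm₂
    refine (halts_storeNext hβ input m₂).mono le_rfl fun m₃ hm₃ => ?_
    obtain ⟨g1, g2, g3, hnew, hold⟩ := hm₃
    rw [heq 1 (by omega)] at g1
    rw [heq 2 (by omega)] at g2 hnew hold
    rw [heq 3 (by omega), h3] at g3
    refine ⟨g3, g1.trans h1, by omega, ?_⟩
    rw [g2, ctxOf, g1]
    refine hfill.extend (fun a ha => ?_) (hnew.trans hval)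
    exact (hold a ha.ne).trans (heq _ (.inr (by omega)))
  · obtain ⟨-, h1, h23, hfill⟩ := hI
    exact ⟨h1, by rwa [← h23]⟩

theorem exists_fill {P : Ctx → ℕ → Prop} (hP : DefinablePred fun c ρ => P c (ρ 0)) (k : ℕ) :
    ∃ (σ : ℕ) (T : ℕ[X]), ∀ β ≥ σ, ∃ p, ∀ input m, HaltsWithin input p m (T.eval (m 1)) fun m' =>
      m' 1 = m 1 ∧ Filled P (m 1 ^ k) (ctxOf input β m') := by
  obtain ⟨σ, S, hS⟩ := Definable.bound_pow k
  obtain ⟨τ, T, hT⟩ := hP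
  refine ⟨σ + τ + 6, S + (2 + X ^ k * (7 + T)), fun β hβ => ?_⟩
  obtain ⟨p, hp⟩ := hS (fun _ => 2) 3 β (by omega) (fun _ => by omega) (by omega)
  obtain ⟨q, hq⟩ := hT (fun _ => 2) 4 β (by omega) (fun _ => by omega) (by omega)
  refine ⟨p ;; .instr (.const 2 0) ;; .loop 3 (q ;; storeNext β), fun input m => ?_⟩
  simp only [eval_add, eval_mul, eval_ofNat, eval_pow, eval_X]
  refine .seq ((hp input m).mono le_rfl fun m₁ hm₁ => ?_)
  have h1 : (Instr.const 2 0).exec input m₁ 1 = m 1 := by simp [Instr.exec, hm₁.2 1]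
  have h3 : (Instr.const 2 0).exec input m₁ 3 = m 1 ^ k := by simp [Instr.exec, hm₁.1, ctxOf]
  have hloop := halts_fillLoop (by omega) hq (m := (Instr.const 2 0).exec input m₁)
    (input := input) (by simp [Instr.exec])
  rw [h1, h3] at hloop
  exact hloop.instr_seq.mono (by omega) fun _ h => h

theorem exists_double {S : Ctx → ℕ} (hS : Definable fun c _ => S c) :
    ∃ (σ : ℕ) (T : ℕ[X]), ∀ β ≥ σ, ∃ p, ∀ input m,
      HaltsWithin input p m (T.eval (m 1) + 3 * S (ctxOf input β m)) fun m' =>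
        m' 1 = m 1 * 2 ^ S (ctxOf input β m) := by
  obtain ⟨σ, T, hS⟩ := hS
  refine ⟨σ + 3, T + 2, fun β hβ => ?_⟩
  obtain ⟨p, hp⟩ := hS (fun _ => 2) 3 β (by omega) (fun _ => by omega) (by omega)
  refine ⟨p ;; .instr (.const 2 1) ;; .loop 3 (.instr (.add 1 1 1) ;; .instr (.sub 3 3 2)),
    fun input m => ?_⟩
  set s := S (ctxOf input β m)
  let I : ℕ → Memory → Prop := fun k m' => m' 3 = k ∧ m' 2 = 1 ∧ m' 1 * 2 ^ k = m 1 * 2 ^ s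
  rw [eval_add, eval_ofNat, add_assoc]
  refine .seq ((hp input m).mono le_rfl fun m₁ hm₁ => ?_)
  have hstart : I s ((Instr.const 2 1).exec input m₁) := by
    simp [I, Instr.exec, hm₁.1, hm₁.2 1, s]
  refine (HaltsWithin.instr_seq (.countdown (I := I) (T := 2) (fun _ _ h => h.1)
    (fun k m₂ ⟨h3, h2, h1⟩ => .instr_seq (.instr ?_)) _ _ hstart)).mono (by omega) fun m' h => ?_
  · refine ⟨by simp [Instr.exec, h3, h2], by simp [Instr.exec, h2], ?_⟩
    simp only [Instr.exec, Function.update_self, ne_eq, OfNat.one_ne_ofNat, not_false_eq_true,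
      Function.update_of_ne, ← h1]
    ring
  · simpa using h.2.2

theorem eval_le_eval (T : ℕ[X]) {x y : ℕ} (hxy : x ≤ y) : T.eval x ≤ T.eval y := by
  simp only [eval_eq_sum_range]
  gcongr

theorem eval_le_mul_pow (T : ℕ[X]) {x : ℕ} (hx : 1 ≤ x) :
    T.eval x ≤ T.eval 1 * x ^ T.natDegree := by
  simp only [eval_eq_sum_range, one_pow, mul_one, Finset.sum_mul]
  gcongr with i hi
  exact Nat.lt_succ_iff.1 (Finset.mem_range.1 hi)

/-- Puts the initial bound into register `1`. -/
def initBound : Program :=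
  .instr (.read 3 2) ;; .instr (.const 2 1) ;; .instr (.read 4 2) ;; .instr (.const 2 10) ;;
    .instr (.add 1 3 4) ;; .instr (.add 1 1 2)

theorem halts_initBound (input : List ℕ) : HaltsWithin input initBound (fun _ => 0) 6 fun m =>
    m 1 = input.getD 0 0 + input.getD 1 0 + 10 := by
  refine .instr_seq (.instr_seq (.instr_seq (.instr_seq (.instr_seq (.instr ?_)))))
  simp [Instr.exec]

theorem exists_answer {A : Ctx → Prop} (hA : DefinablePred fun c _ => A c) :
    ∃ (σ : ℕ) (T : ℕ[X]), ∀ β ≥ σ, ∃ p, ∀ input m, HaltsWithin input p m (T.eval (m 1)) fun m' =>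
      m' 0 = open Classical in if A (ctxOf input β m) then 1 else 0 := by
  obtain ⟨σ, T, hA⟩ := hA
  refine ⟨σ + 3, T + 2, fun β hβ => ?_⟩
  obtain ⟨p, hp⟩ := hA (fun _ => 2) 3 β (by omega) (fun _ => by omega) (by omega)
  refine ⟨p ;; .instr (.const 0 0) ;; .instr (.add 0 0 3), fun input m => ?_⟩
  rw [eval_add, eval_ofNat]
  refine .seq ((hp input m).mono le_rfl fun m₁ hm₁ => .instr_seq (.instr ?_))
  simp [Instr.exec, hm₁.1]

/-- The table is filled with a small bound, from it the number of doublings needed is read off, then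
the table is filled again with the enlarged bound. -/
theorem exists_program {P : Ctx → ℕ → Prop} (hP : DefinablePred fun c ρ => P c (ρ 0)) (k : ℕ)
    {S : Ctx → ℕ} (hS : Definable fun c _ => S c) {A : Ctx → Prop}
    (hA : DefinablePred fun c _ => A c) :
    ∃ (p : Program) (K D : ℕ), ∀ input : List ℕ, ∃ c c' : Ctx,
      c.inp = input ∧ c.B = input.getD 0 0 + input.getD 1 0 + 10 ∧ Filled P (c.B ^ k) c ∧
      c'.inp = input ∧ c'.B = c.B * 2 ^ S c ∧ Filled P (c'.B ^ k) c' ∧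
      ∃ t ≤ K * c'.B ^ D, Answers p input t (A c') := by
  obtain ⟨σ₁, T₁, h₁⟩ := exists_fill hP k
  obtain ⟨σ₂, T₂, h₂⟩ := exists_double hS
  obtain ⟨σ₃, T₃, h₃⟩ := exists_answer hA
  set β := σ₁ + σ₂ + σ₃
  obtain ⟨fill, hfill⟩ := h₁ β (by omega)
  obtain ⟨double, hdouble⟩ := h₂ β (by omega)
  obtain ⟨answer, hanswer⟩ := h₃ β (by omega)
  set U := 6 + T₁ + T₂ + 3 * X + T₁ + T₃ with hU
  refine ⟨initBound ;; fill ;; double ;; fill ;; answer, U.eval 1, U.natDegree, fun input => ?_⟩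
  obtain ⟨t₀, m₀, run₀, ht₀, hm₀⟩ := halts_initBound input
  obtain ⟨t₁, m₁, run₁, ht₁, hB₁, hm₁⟩ := hfill input m₀
  obtain ⟨t₂, m₂, run₂, ht₂, hm₂⟩ := hdouble input m₁
  obtain ⟨t₃, m₃, run₃, ht₃, hB₃, hm₃⟩ := hfill input m₂
  obtain ⟨t₄, m₄, run₄, ht₄, hm₄⟩ := hanswer input m₃
  set s := S (ctxOf input β m₁)
  rw [← hB₁] at ht₁ hm₁
  rw [← hB₃] at ht₃ hm₃
  have hB : m₃ 1 = m₁ 1 * 2 ^ s := hB₃.trans hm₂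
  have hB₁₃ : m₁ 1 ≤ m₃ 1 := hB ▸ Nat.le_mul_of_pos_right _ (by positivity)
  have hs : s ≤ m₃ 1 := hB ▸ Nat.lt_two_pow_self.le.trans (Nat.le_mul_of_pos_left _ (by omega))
  refine ⟨ctxOf input β m₁, ctxOf input β m₃, rfl, hB₁.trans hm₀, hm₁, rfl, hB, hm₃,
    _, ?_, m₄, .seq run₀ (.seq run₁ (.seq run₂ (.seq run₃ run₄))), fun h => by rw [hm₄, if_pos h],
    fun h => by rw [hm₄, if_neg h]⟩
  refine (?_ : _ ≤ U.eval (m₃ 1)).trans (eval_le_mul_pow U (by omega))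
  have l₁ := eval_le_eval T₁ hB₁₃
  have l₂ := eval_le_eval T₂ hB₁₃
  simp only [hU, eval_add, eval_mul, eval_X, eval_ofNat]
  omega

end RAM

namespace Elimination

open Set

section Order

variable (A : SimpleGraph ℕ) (g : ℕ)

/-- The vertices that may be eliminated from the graph induced by `A` on `S`: those of degree at
most one, or all of them if there are none of degree at most one. -/
def eligible (S : Set ℕ) : Set ℕ :=
  {v ∈ S | (A.neighborSet v ∩ S).Subsingleton ∨ ∀ u ∈ S, (A.neighborSet u ∩ S).Nontrivial}

/-- The vertices left after `s` elimination steps. -/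
noncomputable def alive : ℕ → Set ℕ
  | 0 => Iio g
  | s + 1 => alive s \ {sInf (eligible A (alive s))}

/-- The vertex eliminated by step `s`. -/
noncomputable def picked (s : ℕ) : ℕ := sInf (eligible A (alive A g s))

/-- The vertex into whose block the block of `picked A g s` is merged: its least neighbour that is
left, or the virtual vertex `g` if it has none. -/
noncomputable def target (s : ℕ) : ℕ := sInf (insert g (A.neighborSet (picked A g s) ∩ alive A g s))

/-- The vertex to whose block `u` belongs after `s` elimination steps. -/
noncomputable def root : ℕ → ℕ → ℕ
  | 0, u => u
  | s + 1, u => if root s u = picked A g s then target A g s else root s u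

variable {A} {g} {s u : ℕ}

theorem alive_succ : alive A g (s + 1) = alive A g s \ {picked A g s} := rfl

theorem alive_subset : alive A g s ⊆ Iio g := by
  induction s with
  | zero => exact subset_rfl
  | succ s ih => exact sdiff_subset.trans ih

theorem eligible_nonempty {S : Set ℕ} (hS : S.Nonempty) : (eligible A S).Nonempty := by
  by_cases h : ∃ v ∈ S, (A.neighborSet v ∩ S).Subsingleton
  · obtain ⟨v, hv, h⟩ := h
    exact ⟨v, hv, .inl h⟩
  · obtain ⟨v, hv⟩ := hS
    refine ⟨v, hv, .inr fun u hu => ?_⟩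
    rw [← not_subsingleton_iff]
    exact fun h' => h ⟨u, hu, h'⟩

theorem picked_mem_eligible (h : (alive A g s).Nonempty) :
    picked A g s ∈ eligible A (alive A g s) :=
  Nat.sInf_mem (eligible_nonempty h)

theorem ncard_alive (hs : s ≤ g) : (alive A g s).ncard = g - s := by
  induction s with
  | zero => simp [alive]
  | succ s ih =>
    have hcard := ih (by omega)
    have hmem := (picked_mem_eligible (A := A) (g := g) (s := s)
      (nonempty_of_ncard_ne_zero (by omega))).1
    rw [alive_succ, ncard_sdiff_singleton_of_mem hmem, hcard, Nat.sub_sub]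

theorem alive_self : alive A g g = ∅ :=
  (ncard_eq_zero ((finite_Iio g).subset alive_subset)).1 (by simp [ncard_alive])

theorem alive_nonempty (hs : s < g) : (alive A g s).Nonempty :=
  nonempty_of_ncard_ne_zero (by rw [ncard_alive hs.le]; omega)

theorem picked_mem (hs : s < g) : picked A g s ∈ alive A g s :=
  (picked_mem_eligible (alive_nonempty hs)).1

theorem target_cases :
    target A g s ∈ A.neighborSet (picked A g s) ∩ alive A g s ∨
      target A g s = g ∧ A.neighborSet (picked A g s) ∩ alive A g s = ∅ := by
  have hmem := Nat.sInf_mem (insert_nonempty g (A.neighborSet (picked A g s) ∩ alive A g s))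
  rcases eq_empty_or_nonempty (A.neighborSet (picked A g s) ∩ alive A g s) with h | ⟨u, hu⟩
  · exact .inr ⟨by simp [target, h], h⟩
  · have hlt : target A g s < g :=
      (Nat.sInf_le (mem_insert_of_mem g hu)).trans_lt (alive_subset hu.2)
    exact .inl (hmem.resolve_left hlt.ne)

theorem target_mem : target A g s ∈ insert g (alive A g s) :=
  target_cases.elim (fun h => .inr h.2) fun h => .inl h.1

theorem picked_ne_target (hs : s < g) : picked A g s ≠ target A g s := by
  rcases target_cases (A := A) (g := g) (s := s) with h | h
  · exact h.1.ne
  · rw [h.1]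
    exact (alive_subset (picked_mem hs)).ne

theorem root_succ_of_eq (h : root A g s u = picked A g s) : root A g (s + 1) u = target A g s :=
  if_pos h

theorem root_succ_of_ne (h : root A g s u ≠ picked A g s) : root A g (s + 1) u = root A g s u :=
  if_neg h

theorem root_succ_eq_of_eq {v : ℕ} (h : root A g s u = root A g s v) :
    root A g (s + 1) u = root A g (s + 1) v := by
  simp only [root, h]

theorem root_eq_self (hs : s ≤ g) (hu : u ∈ insert g (alive A g s)) : root A g s u = u := by
  induction s with
  | zero => rfl
  | succ s ih =>
    have hne : u ≠ picked A g s := by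
      rcases hu with rfl | hu
      · exact (alive_subset (picked_mem (by omega))).ne'
      · exact hu.2
    have hroot := ih (by omega) (hu.imp_right fun h => h.1)
    rw [root_succ_of_ne (hroot.symm ▸ hne), hroot]

theorem root_mem (hs : s ≤ g) (hu : u ≤ g) : root A g s u ∈ insert g (alive A g s) := by
  induction s with
  | zero => exact hu.eq_or_lt
  | succ s ih =>
    by_cases h : root A g s u = picked A g s
    · rw [root_succ_of_eq h]
      exact target_mem.imp_right fun hmem => ⟨hmem, (picked_ne_target (by omega)).symm⟩
    · rw [root_succ_of_ne h]
      exact (ih (by omega)).imp_right fun hmem => ⟨hmem, h⟩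

theorem root_final (hu : u ≤ g) : root A g g u = g := by
  simpa [alive_self] using root_mem (A := A) le_rfl hu

end Order

section Cut

/-- Every subgraph of minimum degree at least two has all degrees equal to two. -/
def HasOnlyDisjointCycles {V : Type*} (A : SimpleGraph V) : Prop :=
  ∀ U : Set V, (∀ v ∈ U, (A.neighborSet v ∩ U).Nontrivial) →
    ∀ v ∈ U, (A.neighborSet v ∩ U).encard ≤ 2

variable (A : SimpleGraph ℕ) (g : ℕ)

/-- The state of the elimination after `s` steps while it runs through a cycle that was cut at the
edge `v w`: apart from this edge, only edges between roots join different blocks. The cut is closed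
when `v` and `w` lie in the same block. -/
structure IsCut (s v w : ℕ) : Prop where
  le : v ≤ g ∧ w ≤ g
  cross : ∀ u u', A.Adj u u' → root A g s u ≠ root A g s u' →
    (root A g s u = u ∧ root A g s u' = u') ∨ (u = v ∧ u' = w) ∨ (u = w ∧ u' = v)
  degree : root A g s v ≠ root A g s w →
    ∀ u ∈ alive A g s, (A.neighborSet u ∩ alive A g s).encard ≤ 2
  low : root A g s v ≠ root A g s w → ∀ z, z = v ∨ z = w → root A g s z ∈ alive A g s →
    (A.neighborSet (root A g s z) ∩ alive A g s).Subsingleton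

/-- The vertex of block `p`, besides `p` itself, at which an edge may leave the block when the cut
edge is `v w` and the blocks are given by `r`. -/
def tag (r : ℕ → ℕ) (v w p : ℕ) : ℕ :=
  if r v = r w then p else if p = r v then v else if p = r w then w else p

theorem apply_tag {r : ℕ → ℕ} {v w p : ℕ} (hp : r p = p) : r (tag r v w p) = p := by
  grind [tag]

variable {A g} {s v w : ℕ}

theorem IsCut.eq_root_or_eq_tag (hc : IsCut A g s v w) {u u' : ℕ} (hadj : A.Adj u u')
    (hne : root A g s u ≠ root A g s u') :
    u = root A g s u ∨ u = tag (root A g s) v w (root A g s u) := by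
  grind [tag, hc.cross u u' hadj hne]

theorem isCut_zero : IsCut A g 0 g g where
  le := ⟨le_rfl, le_rfl⟩
  cross _ _ _ _ := .inl ⟨rfl, rfl⟩
  degree h := absurd rfl h
  low h := absurd rfl h

theorem subsingleton_diff_of_encard_le_two {α : Type*} {T : Set α} {a : α} (hT : T.encard ≤ 2)
    (ha : a ∈ T) : (T \ {a}).Subsingleton := by
  rw [← encard_le_one_iff_subsingleton]
  rw [← encard_sdiff_singleton_add_one ha, show (2 : ℕ∞) = 1 + 1 by rfl] at hT
  exact (ENat.add_le_add_iff_right (by simp)).1 hT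

theorem mem_alive_of_adj (hA : A.support ⊆ Iio g) (hs : s ≤ g) {u u' : ℕ} (hadj : A.Adj u u')
    (hu : root A g s u = u) : u ∈ alive A g s := by
  have hlt : u < g := hA ⟨u', hadj⟩
  exact (hu ▸ root_mem hs hlt.le : u ∈ insert g (alive A g s)).resolve_left hlt.ne

theorem target_mem_neighborSet {u : ℕ} (hu : u ∈ A.neighborSet (picked A g s) ∩ alive A g s) :
    target A g s ∈ A.neighborSet (picked A g s) ∩ alive A g s :=
  target_cases.resolve_right fun h => (h.2 ▸ hu :)

theorem IsCut.succ_of_subsingleton (hA : A.support ⊆ Iio g) (hs : s < g) (hc : IsCut A g s v w)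
    (hlow : (A.neighborSet (picked A g s) ∩ alive A g s).Subsingleton) :
    IsCut A g (s + 1) v w := by
  have hopen : root A g (s + 1) v ≠ root A g (s + 1) w → root A g s v ≠ root A g s w :=
    mt root_succ_eq_of_eq
  have hsub : alive A g (s + 1) ⊆ alive A g s := sdiff_subset
  have eq_target {u : ℕ} (hadj : A.Adj (picked A g s) u) (hu : root A g s u = u) :
      u = target A g s := by
    have hmem : u ∈ A.neighborSet (picked A g s) ∩ alive A g s :=
      ⟨hadj, mem_alive_of_adj hA hs.le hadj.symm hu⟩
    exact hlow hmem (target_mem_neighborSet hmem)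
  refine ⟨hc.le, fun u u' hadj hne => ?_, fun h u hu => ?_, fun h z hz hmem => ?_⟩
  · refine (hc.cross u u' hadj (mt root_succ_eq_of_eq hne)).imp_left fun ⟨hu, hu'⟩ => ?_
    have hnp : u ≠ picked A g s := by
      rintro rfl
      have := picked_ne_target (A := A) hs
      grind [root]
    have hnp' : u' ≠ picked A g s := by
      rintro rfl
      have := eq_target hadj.symm hu
      grind [root]
    rw [root_succ_of_ne (hu.symm ▸ hnp), root_succ_of_ne (hu'.symm ▸ hnp')]
    exact ⟨hu, hu'⟩
  · exact (encard_le_encard (inter_subset_inter_right _ hsub)).trans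
      (hc.degree (hopen h) u (hsub hu))
  · by_cases hroot : root A g s z = picked A g s
    · rw [root_succ_of_eq hroot] at hmem ⊢
      have hadj := target_cases.resolve_right fun h => (alive_subset hmem).ne h.1
      refine (subsingleton_diff_of_encard_le_two (hc.degree (hopen h) _ hadj.2)
        ⟨hadj.1.symm, picked_mem hs⟩).anti ?_
      rw [alive_succ, inter_sdiff_assoc]
    · rw [root_succ_of_ne hroot] at hmem ⊢
      exact (hc.low (hopen h) z hz hmem.1).anti (inter_subset_inter_right _ hsub)

theorem IsCut.succ_of_nontrivial (hA : A.support ⊆ Iio g) (hcyc : HasOnlyDisjointCycles A)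
    (hs : s < g) (hc : IsCut A g s v w)
    (hdeg : ∀ u ∈ alive A g s, (A.neighborSet u ∩ alive A g s).Nontrivial) :
    root A g s v = root A g s w ∧ ∃ u ∈ alive A g (s + 1), u ≠ target A g s ∧
      IsCut A g (s + 1) (picked A g s) u := by
  have hpick := picked_mem (A := A) hs
  have hle := hcyc _ hdeg
  have hclosed : root A g s v = root A g s w := by
    by_contra hne
    have hdead (z : ℕ) (hz : z = v ∨ z = w) (hzg : z ≤ g) : root A g s z = g :=
      (root_mem hs.le hzg).resolve_right fun hmem =>
        not_subsingleton_iff.2 (hdeg _ hmem) (hc.low hne z hz hmem)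
    exact hne ((hdead v (.inl rfl) hc.le.1).trans (hdead w (.inr rfl) hc.le.2).symm)
  obtain ⟨u, hu, hut⟩ := (hdeg _ hpick).exists_ne (target A g s)
  have hroot {z : ℕ} (hz : z ∈ alive A g s) : root A g s z = z := root_eq_self hs.le (.inr hz)
  have hnbr : ∀ z ∈ A.neighborSet (picked A g s) ∩ alive A g s, z = target A g s ∨ z = u := by
    intro z hz
    have := subsingleton_diff_of_encard_le_two (hle _ hpick) (target_mem_neighborSet hu)
    exact or_iff_not_imp_left.2 fun hzt => this ⟨hz, hzt⟩ ⟨hu, hut⟩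
  have hlow {z : ℕ} (hz : z ∈ A.neighborSet (picked A g s) ∩ alive A g s) :
      (A.neighborSet z ∩ alive A g (s + 1)).Subsingleton := by
    rw [alive_succ, ← inter_sdiff_assoc]
    exact subsingleton_diff_of_encard_le_two (hle z hz.2) ⟨hz.1.symm, hpick⟩
  have hualive : u ∈ alive A g (s + 1) := ⟨hu.2, hu.1.ne'⟩
  refine ⟨hclosed, u, hualive, hut, ⟨(alive_subset hpick).le, (alive_subset hu.2).le⟩,
    fun z z' hadj hne => ?_, fun _ z hz => ?_, fun _ z hz hmem => ?_⟩
  · have hcross := hc.cross z z' hadj (mt root_succ_eq_of_eq hne)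
    have halive := @mem_alive_of_adj A g s hA hs.le
    grind [root, hadj.symm, SimpleGraph.mem_neighborSet]
  · exact (encard_le_encard (inter_subset_inter_right _ sdiff_subset)).trans (hle z hz.1)
  · rcases hz with rfl | rfl
    · rw [root_succ_of_eq (hroot hpick)]
      exact hlow (target_mem_neighborSet hu)
    · rw [root_eq_self hs (.inr hualive)]
      exact hlow hu

/-- Eliminating a vertex of degree at most one leaves the cut as it is; if there is none, all
degrees are two and the eliminated vertex cuts a new cycle. -/
theorem IsCut.succ (hA : A.support ⊆ Iio g) (hcyc : HasOnlyDisjointCycles A)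
    (hs : s < g) (hc : IsCut A g s v w) :
    ∃ v' w', IsCut A g (s + 1) v' w' ∧
      (∀ p, p ≠ picked A g s → p ≠ target A g s →
        tag (root A g (s + 1)) v' w' p = tag (root A g s) v w p) ∧
      tag (root A g (s + 1)) v' w' (target A g s) ∈
        ({picked A g s, tag (root A g s) v w (picked A g s),
          target A g s, tag (root A g s) v w (target A g s)} : Set ℕ) := by
  have hpick := root_eq_self hs.le (.inr (picked_mem (A := A) hs))
  rcases (picked_mem_eligible (alive_nonempty (A := A) hs)).2 with hlow | hdeg
  · refine ⟨v, w, hc.succ_of_subsingleton hA hs hlow, fun p hp hp' => ?_, ?_⟩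
    · grind [tag, root]
    · grind [tag, root]
  · obtain ⟨hclosed, u, hu, hut, hcut⟩ := hc.succ_of_nontrivial hA hcyc hs hdeg
    have hu' := root_eq_self hs (.inr hu)
    refine ⟨picked A g s, u, hcut, fun p _ hp' => ?_, ?_⟩
    · grind [tag, root]
    · grind [tag, root]

end Cut

end Elimination

namespace Elimination

open Set

/-- The graph `H` without the edges at `x` or `t`. -/
def residual (H : SimpleGraph ℕ) (x t : ℕ) : SimpleGraph ℕ :=
  (H.deleteIncidenceSet x).deleteIncidenceSet t

theorem residual_adj {H : SimpleGraph ℕ} {x t y z : ℕ} :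
    (residual H x t).Adj y z ↔ H.Adj y z ∧ (y ≠ x ∧ z ≠ x) ∧ y ≠ t ∧ z ≠ t := by
  simp only [residual, SimpleGraph.deleteIncidenceSet_adj]
  tauto

/-- What the dynamic programme remembers of an embedding of a part `dom` of `H` into one block:
the vertex `x` of `H` mapped to the root of the block and the vertex `t` of `H` mapped to the
vertex `a` of the block. Both are only meaningful when they belong to `dom`. -/
structure Piece where
  (x t a : ℕ)
  dom : Set ℕ

namespace Piece

/-- The vertex `y` of `H` is known to be mapped to `w`, where `p` is the root of the block. -/
def Located (P : Piece) (p y w : ℕ) : Prop :=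
  y ∈ P.dom ∧ (y = P.x ∧ w = p ∨ y = P.t ∧ w = P.a)

/-- A set of vertices that only edges at `x` or `t` may leave: the domains that are considered
for given `x` and `t`. -/
def IsClosed (H : SimpleGraph ℕ) (x t : ℕ) (M : Set ℕ) : Prop :=
  ∀ y z, (residual H x t).Adj y z → y ∈ M → z ∈ M

/-- The pieces the dynamic programme ranges over; `h` and `g` stand for missing vertices. -/
structure IsValid (H : SimpleGraph ℕ) (h g : ℕ) (P : Piece) : Prop where
  le : P.x ≤ h ∧ P.t ≤ h ∧ P.a ≤ g
  subset : P.dom ⊆ Iio h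
  isClosed : IsClosed H P.x P.t P.dom

/-- The piece `P` at `p` arises from the piece `P₁` at `v` and the piece `P₂` at `p` when the block
of `v` is merged into the block of `p`. -/
structure IsMerge (H G : SimpleGraph ℕ) (v p : ℕ) (P₁ P₂ P : Piece) : Prop where
  x_eq : P₂.x = P.x
  dom_eq : P.dom = P₁.dom ∪ P₂.dom
  disjoint : Disjoint P₁.dom P₂.dom
  x_notMem : P.x ∉ P₁.dom
  adj : ∀ y ∈ P₁.dom, ∀ z ∈ P₂.dom, H.Adj y z →
    ∃ w w', P₁.Located v y w ∧ P₂.Located p z w' ∧ G.Adj w w'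
  tag : P.t ∈ P.dom → P₁.Located v P.t P.a ∨ P₂.Located p P.t P.a

end Piece

open Piece

/-- The pieces for the block of `p` before the first step, when this block is `{p}`, or empty if `p`
is the virtual vertex `g`. -/
def IsStart (g p : ℕ) (P : Piece) : Prop :=
  P.dom ⊆ {P.x} ∧ (P.dom.Nonempty → p < g) ∧ (P.t ∈ P.dom → P.a = p)

/-- `P` is obtained from pieces satisfying `F` in the step that merges the block of `v` into the
block of `w`. -/
def Advances (H G : SimpleGraph ℕ) (v w : ℕ) (F : ℕ → Piece → Prop) (p : ℕ) (P : Piece) : Prop :=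
  (p = w ∧ ∃ P₁ P₂, F v P₁ ∧ F p P₂ ∧ IsMerge H G v p P₁ P₂ P) ∨ (p ≠ w ∧ p ≠ v ∧ F p P)

variable (H G A : SimpleGraph ℕ) (h g : ℕ)

/-- The pieces found for the block of `p` after `s` elimination steps. -/
def Found : ℕ → ℕ → Piece → Prop
  | 0, p, P => P.IsValid H h g ∧ IsStart g p P
  | s + 1, p, P => P.IsValid H h g ∧ Advances H G (picked A g s) (target A g s) (Found s) p P

section Soundness

/-- The map `η` embeds `P.dom` into the block of `p` in the way recorded by `P`. -/
structure Realizes (s p : ℕ) (P : Piece) (η : ℕ → ℕ) : Prop where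
  lt : ∀ y ∈ P.dom, η y < g
  root : ∀ y ∈ P.dom, root A g s (η y) = p
  injOn : InjOn η P.dom
  adj : ∀ y ∈ P.dom, ∀ z ∈ P.dom, H.Adj y z → G.Adj (η y) (η z)
  x : P.x ∈ P.dom → η P.x = p
  t : P.t ∈ P.dom → η P.t = P.a

variable {H G A h g} {s p v : ℕ} {P P₁ P₂ : Piece} {η η₁ η₂ : ℕ → ℕ}

theorem Realizes.eq_of_located (hη : Realizes H G A g s p P η) {y w : ℕ} (hy : P.Located p y w) :
    η y = w := by
  obtain ⟨hy, ⟨rfl, rfl⟩ | ⟨rfl, rfl⟩⟩ := hy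
  · exact hη.x hy
  · exact hη.t hy

theorem Realizes.congr (hη : Realizes H G A g s p P η) (heq : EqOn η η₁ P.dom) :
    Realizes H G A g s p P η₁ where
  lt y hy := heq hy ▸ hη.lt y hy
  root y hy := heq hy ▸ hη.root y hy
  injOn := hη.injOn.congr heq
  adj y hy z hz hadj := heq hy ▸ heq hz ▸ hη.adj y hy z hz hadj
  x hx := heq hx ▸ hη.x hx
  t ht := heq ht ▸ hη.t ht

theorem Realizes.merge (hη₁ : Realizes H G A g s v P₁ η) (hη₂ : Realizes H G A g s p P₂ η)
    (hv : v = picked A g s) (hp : p = target A g s) (hvp : v ≠ p)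
    (hM : IsMerge H G v p P₁ P₂ P) : Realizes H G A g (s + 1) p P η := by
  have mem {y : ℕ} (hy : y ∈ P.dom) : y ∈ P₁.dom ∨ y ∈ P₂.dom := by rwa [hM.dom_eq] at hy
  have ne {y z : ℕ} (hy : y ∈ P₁.dom) (hz : z ∈ P₂.dom) : η y ≠ η z := fun heq =>
    hvp (by rw [← hη₁.root y hy, heq, hη₂.root z hz])
  have adj₁₂ {y z : ℕ} (hy : y ∈ P₁.dom) (hz : z ∈ P₂.dom) (hyz : H.Adj y z) :
      G.Adj (η y) (η z) := by
    obtain ⟨w, w', hw, hw', hadj⟩ := hM.adj y hy z hz hyz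
    rwa [hη₁.eq_of_located hw, hη₂.eq_of_located hw']
  refine ⟨fun y hy => ?_, fun y hy => ?_, ?_, fun y hy z hz hyz => ?_, fun hx => ?_, fun ht => ?_⟩
  · exact (mem hy).elim (hη₁.lt y) (hη₂.lt y)
  · rcases mem hy with hy | hy
    · rw [root_succ_of_eq ((hη₁.root y hy).trans hv), hp]
    · rw [root_succ_of_ne (hη₂.root y hy ▸ hv ▸ hvp.symm), hη₂.root y hy]
  · rw [hM.dom_eq, injOn_union hM.disjoint]
    exact ⟨hη₁.injOn, hη₂.injOn, fun y hy z hz => ne hy hz⟩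
  · rcases mem hy with hy | hy <;> rcases mem hz with hz | hz
    · exact hη₁.adj y hy z hz hyz
    · exact adj₁₂ hy hz hyz
    · exact (adj₁₂ hz hy hyz.symm).symm
    · exact hη₂.adj y hy z hz hyz
  · exact hM.x_eq ▸ hη₂.x (hM.x_eq.symm ▸ (mem hx).resolve_left hM.x_notMem)
  · exact (hM.tag ht).elim hη₁.eq_of_located hη₂.eq_of_located

theorem Found.exists_realizes (hs : s ≤ g) (hP : Found H G A h g s p P) :
    ∃ η, Realizes H G A g s p P η := by
  classical
  induction s generalizing p P with
  | zero =>
    obtain ⟨-, hx, hlt, ht⟩ := hP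
    exact ⟨fun _ => p, fun y hy => hlt ⟨y, hy⟩, fun _ _ => rfl,
      fun y hy z hz _ => (hx hy).trans (hx hz).symm,
      fun y hy z hz hadj => absurd ((hx hy).trans (hx hz).symm) hadj.ne, fun _ => rfl,
      fun h => (ht h).symm⟩
  | succ s ih =>
    obtain ⟨-, ⟨hp, P₁, P₂, hP₁, hP₂, hM⟩ | ⟨-, hp, hP⟩⟩ := hP
    · obtain ⟨η₁, hη₁⟩ := ih (by omega) hP₁
      obtain ⟨η₂, hη₂⟩ := ih (by omega) hP₂
      have heq₂ : EqOn (P₁.dom.piecewise η₁ η₂) η₂ P₂.dom :=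
        (piecewise_eqOn_compl _ _ _).mono hM.disjoint.subset_compl_left
      exact ⟨P₁.dom.piecewise η₁ η₂,
        (hη₁.congr (piecewise_eqOn _ _ _).symm).merge (hη₂.congr heq₂.symm) rfl hp
          (hp ▸ picked_ne_target hs) hM⟩
    · obtain ⟨η, hη⟩ := ih (by omega) hP
      exact ⟨η, hη.lt, fun y hy => by
        rw [root_succ_of_ne (hη.root y hy ▸ hp), hη.root y hy], hη.injOn, hη.adj, hη.x, hη.t⟩

end Soundness

section Completeness

variable {H G A h g} {η : ℕ → ℕ}

theorem exists_label (hη : InjOn η (Iio h)) :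
    ∃ ℓ : ℕ → ℕ, (∀ v, ℓ v ≤ h) ∧ ∀ v, ∀ y < h, y = ℓ v ↔ η y = v := by
  have (v : ℕ) : ∃ l ≤ h, ∀ y < h, y = l ↔ η y = v := by
    by_cases hv : ∃ y < h, η y = v
    · obtain ⟨l, hl, rfl⟩ := hv
      exact ⟨l, hl.le, fun y hy => ⟨congrArg η, hη hy hl⟩⟩
    · exact ⟨h, le_rfl, fun y hy =>
        ⟨fun hyh => absurd hyh hy.ne, fun hyv => (hv ⟨y, hy, hyv⟩).elim⟩⟩
  choose ℓ hle hℓ using this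
  exact ⟨ℓ, hle, hℓ⟩

/-- The piece recording the restriction of the embedding `η` of `H` to the block of `p`, where
the vertex `ℓ v` of `H` is mapped to `v`, and `r u` is the root of the block of `u`. -/
def pieceOf (h : ℕ) (η ℓ r τ : ℕ → ℕ) (p : ℕ) : Piece :=
  ⟨ℓ p, ℓ (τ p), τ p, {y | y < h ∧ r (η y) = p}⟩

variable {ℓ : ℕ → ℕ} {s v w p : ℕ}

theorem isValid_pieceOf (hH : H.support ⊆ Iio h) (hadj : ∀ y z, H.Adj y z → A.Adj (η y) (η z))
    (hℓle : ∀ v, ℓ v ≤ h) (hℓ : ∀ v, ∀ y < h, y = ℓ v ↔ η y = v) (hc : IsCut A g s v w)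
    (hp : p ≤ g) :
    (pieceOf h η ℓ (root A g s) (tag (root A g s) v w) p).IsValid H h g := by
  refine ⟨⟨hℓle _, hℓle _, ?_⟩, fun y hy => hy.1, fun y z hyz hy => ?_⟩
  · have := hc.le
    grind [pieceOf, tag]
  · rw [residual_adj] at hyz
    refine ⟨hH ⟨y, hyz.1.symm⟩, ?_⟩
    have hcut := hc.eq_root_or_eq_tag (hadj y z hyz.1)
    grind [pieceOf]

theorem located_pieceOf (hℓ : ∀ v, ∀ y < h, y = ℓ v ↔ η y = v) {r τ : ℕ → ℕ} {y u : ℕ}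
    (hy : y < h) (hu : η y = u) (hr : r u = p) (hmem : u = p ∨ u = τ p) :
    (pieceOf h η ℓ r τ p).Located p y u :=
  ⟨⟨hy, hu ▸ hr⟩, hmem.imp (fun h => ⟨(hℓ _ _ hy).2 (hu.trans h), h⟩)
    fun h => ⟨(hℓ _ _ hy).2 (hu.trans h), h⟩⟩

theorem isMerge_pieceOf (hGA : A ≤ G) (hadj : ∀ y z, H.Adj y z → A.Adj (η y) (η z))
    (hℓ : ∀ v, ∀ y < h, y = ℓ v ↔ η y = v) (hc : IsCut A g s v w) (hs : s < g)
    {τ : ℕ → ℕ}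
    (hτ : τ (target A g s) ∈
      ({picked A g s, tag (root A g s) v w (picked A g s),
        target A g s, tag (root A g s) v w (target A g s)} : Set ℕ)) :
    IsMerge H G (picked A g s) (target A g s)
      (pieceOf h η ℓ (root A g s) (tag (root A g s) v w) (picked A g s))
      (pieceOf h η ℓ (root A g s) (tag (root A g s) v w) (target A g s))
      (pieceOf h η ℓ (root A g (s + 1)) τ (target A g s)) := by
  have hpick := root_eq_self hs.le (.inr (picked_mem (A := A) hs))
  have htgt := root_eq_self hs.le (target_mem (A := A))
  have hne := picked_ne_target (A := A) hs
  refine ⟨rfl, ?_, ?_, ?_, fun y hy z hz hyz => ?_, fun ht => ?_⟩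
  · ext y
    grind [pieceOf, root]
  · exact disjoint_left.2 fun y hy hy' => hne (hy.2.symm.trans hy'.2)
  · rintro ⟨hlt, hroot⟩
    rw [(hℓ _ _ hlt).1 rfl, htgt] at hroot
    exact hne hroot.symm
  · have hroots : root A g s (η y) ≠ root A g s (η z) := by rwa [hy.2, hz.2]
    have hy' := hc.eq_root_or_eq_tag (hadj y z hyz) hroots
    have hz' := hc.eq_root_or_eq_tag (hadj z y hyz.symm) hroots.symm
    rw [hy.2] at hy'
    rw [hz.2] at hz'
    exact ⟨η y, η z, located_pieceOf hℓ hy.1 rfl hy.2 hy', located_pieceOf hℓ hz.1 rfl hz.2 hz',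
      hGA (hadj y z hyz)⟩
  · have hηt := (hℓ _ _ ht.1).1 rfl
    have htag₁ := apply_tag (v := v) (w := w) hpick
    have htag₂ := apply_tag (v := v) (w := w) htgt
    simp only [mem_insert_iff, mem_singleton_iff, ← or_assoc] at hτ
    rw [or_assoc] at hτ
    exact hτ.imp
      (fun hmem => located_pieceOf hℓ ht.1 hηt
        (hmem.elim (fun h => (congrArg _ h).trans hpick) fun h => (congrArg _ h).trans htag₁) hmem)
      fun hmem => located_pieceOf hℓ ht.1 hηt
        (hmem.elim (fun h => (congrArg _ h).trans htgt) fun h => (congrArg _ h).trans htag₂) hmem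

theorem exists_found_pieceOf (hA : A.support ⊆ Iio g) (hcyc : HasOnlyDisjointCycles A)
    (hGA : A ≤ G) (hH : H.support ⊆ Iio h) (hadj : ∀ y z, H.Adj y z → A.Adj (η y) (η z))
    (hηg : MapsTo η (Iio h) (Iio g)) (hℓle : ∀ v, ℓ v ≤ h)
    (hℓ : ∀ v, ∀ y < h, y = ℓ v ↔ η y = v) (hs : s ≤ g) :
    ∃ v w, IsCut A g s v w ∧ ∀ p ∈ insert g (alive A g s),
      Found H G A h g s p (pieceOf h η ℓ (root A g s) (tag (root A g s) v w) p) := by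
  induction s with
  | zero =>
    refine ⟨g, g, isCut_zero, fun p hp => ⟨isValid_pieceOf hH hadj hℓle hℓ isCut_zero
      (hp.elim Eq.le fun h => (alive_subset h).le), fun y hy => (hℓ _ _ hy.1).2 hy.2, ?_, ?_⟩⟩
    · rintro ⟨y, hy, hp⟩
      exact hp ▸ hηg hy
    · simp [pieceOf, tag]
  | succ s ih =>
    obtain ⟨v, w, hc, hfound⟩ := ih (by omega)
    obtain ⟨v', w', hc', hsame, htgt⟩ := hc.succ hA hcyc hs
    refine ⟨v', w', hc', fun p hp => ⟨isValid_pieceOf hH hadj hℓle hℓ hc'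
      (hp.elim Eq.le fun h => (alive_subset h).le), ?_⟩⟩
    by_cases hpt : p = target A g s
    · subst hpt
      exact .inl ⟨rfl, _, _, hfound _ (.inr (picked_mem hs)), hfound _ target_mem,
        isMerge_pieceOf hGA hadj hℓ hc hs htgt⟩
    · have hpp : p ≠ picked A g s := by
        rcases hp with rfl | hp
        · exact (alive_subset (picked_mem hs)).ne'
        · exact hp.2
      refine .inr ⟨hpt, hpp, ?_⟩
      convert hfound p (hp.imp_right fun h => h.1) using 1
      have hroot (u : ℕ) : root A g (s + 1) u = p ↔ root A g s u = p := by grind [root]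
      simp only [pieceOf, hsame p hpp hpt, hroot]

end Completeness

/-- The dynamic programme along the elimination of `A` finds an embedding of `H` into `G`. -/
def Accepts : Prop := ∃ P, Found H G A h g g g P ∧ Iio h ⊆ P.dom

variable {H G A h g}

theorem Accepts.exists_embedding (hacc : Accepts H G A h g) :
    ∃ η : ℕ → ℕ, MapsTo η (Iio h) (Iio g) ∧ InjOn η (Iio h) ∧
      ∀ y < h, ∀ z < h, H.Adj y z → G.Adj (η y) (η z) := by
  obtain ⟨P, hP, hdom⟩ := hacc
  obtain ⟨η, hη⟩ := hP.exists_realizes le_rfl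
  exact ⟨η, fun y hy => hη.lt y (hdom hy), hη.injOn.mono hdom,
    fun y hy z hz => hη.adj y (hdom hy) z (hdom hz)⟩

theorem accepts_of_embedding (hA : A.support ⊆ Iio g) (hcyc : HasOnlyDisjointCycles A)
    (hGA : A ≤ G) (hH : H.support ⊆ Iio h) {η : ℕ → ℕ} (hη : InjOn η (Iio h))
    (hadj : ∀ y z, H.Adj y z → A.Adj (η y) (η z)) (hηg : MapsTo η (Iio h) (Iio g)) :
    Accepts H G A h g := by
  obtain ⟨ℓ, hℓle, hℓ⟩ := exists_label hη
  obtain ⟨v, w, -, hfound⟩ := exists_found_pieceOf hA hcyc hGA hH hadj hηg hℓle hℓ le_rfl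
  exact ⟨_, hfound g (mem_insert _ _), fun y hy => ⟨hy, root_final (hηg hy).le⟩⟩

end Elimination

namespace SubgraphIso

open Elimination
open scoped Finset

section EdgeCount

open Finset

variable {V : Type*} [Fintype V] {G : SimpleGraph V} [DecidableRel G.Adj]

theorem card_edgeFinset_le_of_isAcyclic (hG : G.IsAcyclic) : #G.edgeFinset ≤ Fintype.card V := by
  classical
  cases isEmpty_or_nonempty V
  · simp [Finset.eq_empty_of_isEmpty]
  · obtain ⟨T, hGT, -, hT⟩ :=
      (SimpleGraph.connected_top (V := V)).exists_isTree_le_of_le_of_isAcyclic le_top hG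
    have hle : #G.edgeFinset ≤ #T.edgeFinset :=
      card_le_card (SimpleGraph.edgeFinset_subset_edgeFinset.2 hGT)
    have := hT.card_edgeFinset
    omega

theorem card_edgeFinset_le_add_of_induce_isAcyclic (S : Finset V)
    (hS : (G.induce {v | v ∉ S}).IsAcyclic) :
    #G.edgeFinset ≤ Fintype.card V + G.maxDegree * #S := by
  classical
  have hsub : G.edgeFinset ⊆
      (G.induce {v | v ∉ S}).edgeFinset.image (Sym2.map Subtype.val) ∪
        S.biUnion (G.incidenceFinset ·) := by
    intro e he
    induction e with | _ u v =>
    rw [SimpleGraph.mem_edgeFinset, SimpleGraph.mem_edgeSet] at he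
    by_cases hu : u ∈ S
    · exact mem_union_right _ (mem_biUnion.2 ⟨u, hu, by simp [SimpleGraph.incidenceSet, he]⟩)
    by_cases hv : v ∈ S
    · exact mem_union_right _ (mem_biUnion.2 ⟨v, hv, by simp [SimpleGraph.incidenceSet, he]⟩)
    · exact mem_union_left _ (mem_image.2 ⟨s(⟨u, hu⟩, ⟨v, hv⟩), by simpa using he, rfl⟩)
  have hforest : #(G.induce {v | v ∉ S}).edgeFinset ≤ Fintype.card V :=
    (card_edgeFinset_le_of_isAcyclic hS).trans (Fintype.card_subtype_le _)
  have hdeg : #(S.biUnion (G.incidenceFinset ·)) ≤ G.maxDegree * #S := by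
    rw [mul_comm]
    refine card_biUnion_le_card_mul _ _ _ fun v _ => ?_
    rw [SimpleGraph.card_incidenceFinset_eq_degree]
    exact G.degree_le_maxDegree v
  calc #G.edgeFinset ≤ _ := (card_le_card hsub).trans (card_union_le _ _)
    _ ≤ Fintype.card V + G.maxDegree * #S := add_le_add (card_image_le.trans hforest) hdeg

theorem sum_degree_le_of_induce_isAcyclic (hdeg : ∀ v, 2 ≤ G.degree v) (S : Finset V)
    (hS : (G.induce {v | v ∉ S}).IsAcyclic) :
    ∑ v with 3 ≤ G.degree v, G.degree v ≤ 6 * (G.maxDegree * #S) := by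
  have hexcess : ∑ v, (G.degree v - 2) + 2 * Fintype.card V = 2 * #G.edgeFinset := by
    rw [← G.sum_degrees_eq_twice_card_edges, ← card_univ, mul_comm, ← smul_eq_mul, ← sum_const,
      ← sum_add_distrib]
    exact sum_congr rfl fun v _ => Nat.sub_add_cancel (hdeg v)
  have hedges := card_edgeFinset_le_add_of_induce_isAcyclic S hS
  calc ∑ v with 3 ≤ G.degree v, G.degree v
      ≤ ∑ v with 3 ≤ G.degree v, 3 * (G.degree v - 2) :=
        sum_le_sum fun v hv => by have := (mem_filter.1 hv).2; omega
    _ ≤ ∑ v, 3 * (G.degree v - 2) := sum_le_sum_of_subset (filter_subset _ _)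
    _ ≤ 6 * (G.maxDegree * #S) := by rw [← mul_sum]; omega

theorem card_biUnion_incidenceFinset_le_of_induce_isAcyclic [DecidableEq V]
    (hdeg : ∀ v, 2 ≤ G.degree v) (S : Finset V) (hS : (G.induce {v | v ∉ S}).IsAcyclic) :
    #((univ.filter (3 ≤ G.degree ·)).biUnion (G.incidenceFinset ·)) ≤ 6 * (G.maxDegree * #S) :=
  calc #((univ.filter (3 ≤ G.degree ·)).biUnion (G.incidenceFinset ·))
    _ ≤ ∑ v with 3 ≤ G.degree v, G.degree v := by
        simpa only [G.card_incidenceFinset_eq_degree] using card_biUnion_le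
          (s := univ.filter (3 ≤ G.degree ·)) (t := (G.incidenceFinset ·))
    _ ≤ 6 * (G.maxDegree * #S) := sum_degree_le_of_induce_isAcyclic hdeg S hS

end EdgeCount

section Core

open Set

variable {V : Type*} (G : SimpleGraph V)

/-- The vertices of `S` that have at least two neighbours in `S`. -/
def peel (S : Set V) : Set V := {v ∈ S | (G.neighborSet v ∩ S).Nontrivial}

/-- The `2`-core: the largest set of vertices inducing a graph of minimum degree at least two. -/
def core : Set V := {v | ∃ S, v ∈ S ∧ S ⊆ peel G S}

/-- The vertices with at least three neighbours in `K`. -/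
def branch (K : Set V) : Set V := {v | 2 < (G.neighborSet v ∩ K).encard}

/-- The edges inside `K` with an end that has at least three neighbours in `K`. When `K` is the
`2`-core, the algorithm guesses which of them are avoided by the embedding. -/
def branchEdges (K : Set V) : Set (Sym2 V) :=
  {e ∈ G.edgeSet | (∀ v ∈ e, v ∈ K) ∧ ∃ v ∈ e, v ∈ branch G K}

variable {G}

theorem peel_mono {S T : Set V} (hST : S ⊆ T) : peel G S ⊆ peel G T := fun _ hv =>
  ⟨hST hv.1, hv.2.mono (inter_subset_inter_right _ hST)⟩

theorem peel_subset (S : Set V) : peel G S ⊆ S := Set.sep_subset _ _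

theorem subset_core {S : Set V} (hS : S ⊆ peel G S) : S ⊆ core G := fun _ hv => ⟨S, hv, hS⟩

theorem core_subset_peel_core : core G ⊆ peel G (core G) := fun _ ⟨_, hv, hS⟩ =>
  peel_mono (subset_core hS) (hS hv)

theorem core_subset_support : core G ⊆ G.support := fun _ hv =>
  let ⟨w, hw⟩ := (core_subset_peel_core hv).2.nonempty
  ⟨w, hw.1⟩

theorem iterate_subset {α : Type*} {F : Set α → Set α} (hF : ∀ S, F S ⊆ S) (n : ℕ) (S : Set α) :
    F^[n] S ⊆ S :=
  Function.Iterate.rec (· ⊆ S) subset_rfl (fun T hT => (hF T).trans hT) n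

theorem isFixedPt_iterate_of_ncard_le {α : Type*} {F : Set α → Set α} (hF : ∀ S, F S ⊆ S)
    {n : ℕ} {S : Set α} (hS : S.Finite) (hn : S.ncard ≤ n) : F.IsFixedPt (F^[n] S) := by
  induction n generalizing S with
  | zero => exact subset_antisymm (hF S) (by simp [(ncard_eq_zero hS).1 (Nat.le_zero.1 hn)])
  | succ n ih =>
    by_cases hfix : F S = S
    · rw [Function.iterate_fixed hfix]
      exact hfix
    · rw [Function.iterate_succ_apply]
      have := ncard_lt_ncard ((hF S).ssubset_of_ne hfix) hS
      exact ih (hS.subset (hF S)) (by omega)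

theorem subset_iterate {α : Type*} {F : Set α → Set α} {C : Set α}
    (hF : ∀ T, C ⊆ T → C ⊆ F T) (n : ℕ) {S : Set α} (hS : C ⊆ S) : C ⊆ F^[n] S := by
  induction n generalizing S with
  | zero => exact hS
  | succ _ ih => exact ih (hF S hS)

theorem iterate_peel_eq_core {n : ℕ} {S : Set V} (hfin : S.Finite) (hn : S.ncard ≤ n)
    (hS : core G ⊆ S) : (peel G)^[n] S = core G :=
  (subset_core (isFixedPt_iterate_of_ncard_le peel_subset hfin hn).ge).antisymm
    (subset_iterate (fun _ hT => core_subset_peel_core.trans (peel_mono hT)) n hS)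

theorem hasOnlyDisjointCycles_deleteEdges {F : SimpleGraph V}
    (hF : ∀ v, (F.neighborSet v).encard ≤ 2) :
    HasOnlyDisjointCycles (G.deleteEdges (branchEdges G (core G) \ F.edgeSet)) := by
  intro U hU v hv
  have hUcore : U ⊆ core G := subset_core fun u hu => ⟨hu, (hU u hu).mono
    (inter_subset_inter_left _ fun w hw => (G.deleteEdges_le _) hw)⟩
  by_cases hbr : v ∈ branch G (core G)
  · refine (encard_le_encard fun u hu => ?_).trans (hF v)
    obtain ⟨hadj, hkeep⟩ := SimpleGraph.deleteEdges_adj.1 hu.1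
    refine not_not.1 fun hnot => hkeep ⟨⟨hadj, ?_, v, by simp, hbr⟩, hnot⟩
    simp only [Sym2.mem_iff]
    rintro w (rfl | rfl)
    exacts [hUcore hv, hUcore hu.2]
  · exact (encard_le_encard (inter_subset_inter (fun w hw => (G.deleteEdges_le _) hw) hUcore)).trans
      (not_lt.1 hbr)

theorem degree_induce (K : Set V) [Fintype K] [DecidableRel (G.induce K).Adj]
    (v : K) : ((G.induce K).degree v : ℕ∞) = (G.neighborSet v ∩ K).encard := by
  rw [← SimpleGraph.card_neighborFinset_eq_degree, ← encard_coe_eq_coe_finsetCard,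
    SimpleGraph.coe_neighborFinset, ← Subtype.val_injective.encard_image]
  congr 1
  ext u
  simp [and_comm]

theorem encard_branchEdges_le (hfin : (core G).Finite) {d : ℕ}
    (hd : ∀ v, (G.neighborSet v).encard ≤ d) (S : Finset V)
    (hS : (G.induce (core G \ S)).IsAcyclic) : (branchEdges G (core G)).encard ≤ 6 * (d * #S) := by
  classical
  have := hfin.fintype
  set C := G.induce (core G)
  set S' : Finset (core G) := Finset.univ.filter fun v => ↑v ∈ S
  have hS' : (C.induce {v | v ∉ S'}).IsAcyclic := by
    refine hS.comap ⟨fun v => ⟨v.1, v.1.2, fun h => v.2 (by simpa [S'] using h)⟩, fun h => h⟩ ?_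
    intro u v huv
    have := congrArg (fun w => (w.1 : V)) huv
    exact Subtype.ext (Subtype.ext this)
  have hcard : #S' ≤ #S :=
    Finset.card_le_card_of_injOn Subtype.val (fun v hv => (Finset.mem_filter.1 hv).2)
      Subtype.val_injective.injOn
  have hcast (v : core G) : (C.degree v : ℕ∞) = (G.neighborSet v ∩ core G).encard :=
    degree_induce _ v
  have hdeg (v : core G) : 2 ≤ C.degree v := by
    have := one_lt_encard_iff_nontrivial.2 (core_subset_peel_core v.2).2
    rw [← hcast] at this
    exact_mod_cast this
  have hmax : C.maxDegree ≤ d := C.maxDegree_le_of_forall_degree_le d fun v =>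
    ENat.natCast_le_natCast.1 <|
      (hcast v).trans_le ((encard_le_encard inter_subset_left).trans (hd v))
  have hsub : branchEdges G (core G) ⊆ Finset.image (Sym2.map Subtype.val)
      ((Finset.univ.filter (3 ≤ C.degree ·)).biUnion (C.incidenceFinset ·)) := by
    rintro e ⟨he, hcore, v, hve, hbr⟩
    obtain ⟨u, rfl⟩ := hve
    have hv : 3 ≤ C.degree ⟨v, hcore v (by simp)⟩ :=
      ENat.natCast_lt_natCast.1 ((hcast ⟨v, _⟩).symm ▸ hbr : (2 : ℕ∞) < _)
    refine Finset.mem_coe.2 (Finset.mem_image.2 ⟨s(⟨v, hcore v (by simp)⟩, ⟨u, hcore u (by simp)⟩),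
      Finset.mem_biUnion.2 ⟨⟨v, hcore v (by simp)⟩, by simpa using hv, ?_⟩, rfl⟩)
    simpa [C] using he
  have hcount : 6 * (C.maxDegree * #S') ≤ 6 * (d * #S) := by gcongr
  refine (encard_le_encard hsub).trans ?_
  rw [encard_coe_eq_coe_finsetCard]
  exact_mod_cast Finset.card_image_le.trans
    ((card_biUnion_incidenceFinset_le_of_induce_isAcyclic hdeg S' hS').trans hcount)

end Core

end SubgraphIso

namespace SubgraphIso

open Elimination Set
open scoped Finset

section Rank

variable {α β : Type*} [LinearOrder β] {f : α → β} {S : Finset α} {x y : α}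

/-- The position of `x` when the elements of `S` are listed by increasing values of `f`. -/
def rank (f : α → β) (S : Finset α) (x : α) : ℕ := #{y ∈ S | f y < f x}

theorem rank_lt_card (hx : x ∈ S) : rank f S x < #S :=
  Finset.card_lt_card (Finset.filter_ssubset.2 ⟨x, hx, lt_irrefl _⟩)

theorem rank_lt_rank (hx : x ∈ S) (hxy : f x < f y) : rank f S x < rank f S y :=
  Finset.card_lt_card <| Finset.ssubset_iff_of_subset
    (Finset.monotone_filter_right _ fun _ _ hz => hz.trans hxy) |>.2
      ⟨x, Finset.mem_filter.2 ⟨hx, hxy⟩, by simp⟩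

theorem rank_injOn (hf : f.Injective) : InjOn (rank f S) S := fun _ hx _ hy h =>
  hf <| le_antisymm (not_lt.1 fun hlt => (rank_lt_rank hy hlt).ne' h)
    (not_lt.1 fun hlt => (rank_lt_rank hx hlt).ne h)

theorem exists_testBit_rank (hf : f.Injective) (p : α → Prop) :
    ∃ m < 2 ^ #S, ∀ x ∈ S, (m.testBit (rank f S x) ↔ p x) := by
  classical
  refine ⟨Nat.ofBits fun i : Fin #S => decide (∃ x ∈ S, rank f S x = i ∧ p x),
    Nat.ofBits_lt_two_pow _, fun x hx => ?_⟩
  rw [Nat.testBit_ofBits_lt _ _ (rank_lt_card hx), decide_eq_true_iff]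
  refine ⟨fun ⟨y, hy, hyx, hpy⟩ => ?_, fun hp => ⟨x, hx, rfl, hp⟩⟩
  rwa [← rank_injOn hf hy hx hyx]

end Rank

section Components

open Classical in
/-- The numbers below `h` that are least among the numbers related to them: if `R` is reachability
in a graph, the least vertices of the components. -/
noncomputable def reps (R : ℕ → ℕ → Prop) (h : ℕ) : Finset ℕ :=
  {r ∈ Finset.range h | ∀ z < h, R r z → r ≤ z}

/-- If `R` is reachability in a graph, the union of the components selected by `D`, which are
referred to by the ranks of their representatives. -/
def decode (R : ℕ → ℕ → Prop) (h : ℕ) (D : ℕ → Prop) : Set ℕ :=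
  {y | y < h ∧ ∃ r ∈ reps R h, R r y ∧ D (rank id (reps R h) r)}

variable {H : SimpleGraph ℕ} {h : ℕ}

theorem mem_reps {R : ℕ → ℕ → Prop} {r : ℕ} :
    r ∈ reps R h ↔ r < h ∧ ∀ z < h, R r z → r ≤ z := by simp [reps]

theorem exists_mem_reps_reachable {y : ℕ} (hy : y < h) :
    ∃ r ∈ reps H.Reachable h, H.Reachable r y := by
  set r := sInf {z | H.Reachable y z}
  have hr : H.Reachable y r := Nat.sInf_mem (s := {z | H.Reachable y z}) ⟨y, .rfl⟩
  have hle {z : ℕ} (hz : H.Reachable y z) : r ≤ z := Nat.sInf_le hz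
  exact ⟨r, mem_reps.2 ⟨(hle .rfl).trans_lt hy, fun z _ hz => hle (hr.trans hz)⟩, hr.symm⟩

theorem reps_congr {R R' : ℕ → ℕ → Prop} (hR : ∀ y < h, ∀ z < h, R y z ↔ R' y z) :
    reps R h = reps R' h := by
  ext r
  rw [mem_reps, mem_reps]
  exact and_congr_right fun hr => forall₂_congr fun z hz => by rw [hR r hr z hz]

theorem decode_congr {R R' : ℕ → ℕ → Prop} {D D' : ℕ → Prop}
    (hR : ∀ y < h, ∀ z < h, R y z ↔ R' y z) (hD : ∀ i < #(reps R' h), D i ↔ D' i) :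
    decode R h D = decode R' h D' := by
  ext y
  rw [decode, decode, reps_congr hR]
  refine and_congr_right fun hy => exists_congr fun r => and_congr_right fun hr => ?_
  rw [hR r (mem_reps.1 hr).1 y hy, hD _ (rank_lt_card hr)]

theorem eq_of_mem_reps_of_reachable {r r' : ℕ} (hr : r ∈ reps H.Reachable h)
    (hr' : r' ∈ reps H.Reachable h) (hrr' : H.Reachable r r') : r = r' :=
  ((mem_reps.1 hr).2 _ (mem_reps.1 hr').1 hrr').antisymm
    ((mem_reps.1 hr').2 _ (mem_reps.1 hr).1 hrr'.symm)

theorem exists_decode_eq {M : Set ℕ} (hM : M ⊆ Iio h)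
    (hclosed : ∀ y z, H.Adj y z → y ∈ M → z ∈ M) :
    ∃ m < 2 ^ #(reps H.Reachable h), decode H.Reachable h (m.testBit ·) = M := by
  have hreach {y z : ℕ} (hyz : H.Reachable y z) (hy : y ∈ M) : z ∈ M := by
    rw [SimpleGraph.reachable_iff_reflTransGen] at hyz
    exact hyz.head_induction_on (fun hz => hz) (fun hadj _ ih hy => ih (hclosed _ _ hadj hy)) hy
  obtain ⟨m, hm, hbit⟩ :=
    exists_testBit_rank (S := reps H.Reachable h) Function.injective_id (· ∈ M)
  refine ⟨m, hm, subset_antisymm ?_ fun y hy => ?_⟩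
  · rintro y ⟨-, r, hr, hry, hmr⟩
    exact hreach hry ((hbit r hr).1 hmr)
  · obtain ⟨r, hr, hry⟩ := exists_mem_reps_reachable (H := H) (hM hy)
    exact ⟨hM hy, r, hr, hry, (hbit r hr).2 (hreach hry.symm hy)⟩

/-- Every new component contains the deleted vertex or one of its neighbours. -/
theorem card_reps_deleteIncidenceSet_le {x d : ℕ} (hd : (H.neighborSet x).encard ≤ d) :
    #(reps (H.deleteIncidenceSet x).Reachable h) ≤ #(reps H.Reachable h) + (d + 1) := by
  classical
  set H' := H.deleteIncidenceSet x
  have hnew (r : ℕ) (hr : r ∈ reps H'.Reachable h \ reps H.Reachable h) :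
      ∃ y ∈ insert x (H.neighborSet x), H'.Reachable r y := by
    by_contra! hno
    refine (Finset.mem_sdiff.1 hr).2 (mem_reps.2 ⟨(mem_reps.1 (Finset.mem_sdiff.1 hr).1).1, ?_⟩)
    intro z hz hrz
    rw [SimpleGraph.reachable_iff_reflTransGen] at hrz
    refine (mem_reps.1 (Finset.mem_sdiff.1 hr).1).2 z hz ?_
    clear hz
    induction hrz with
    | refl => exact .rfl
    | @tail y z _ hyz ih =>
      have hyx : y ≠ x := fun h => hno y (.inl h) ih
      have hzx : z ≠ x := fun h => hno y (.inr (h ▸ hyz.symm)) ih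
      exact ih.trans (SimpleGraph.deleteIncidenceSet_adj.2 ⟨hyz, hyx, hzx⟩).reachable
  choose! f hf hreach using hnew
  have hinj : InjOn f (reps H'.Reachable h \ reps H.Reachable h) := fun r hr r' hr' hrr' =>
    eq_of_mem_reps_of_reachable hr.1 hr'.1 <|
      (hreach r (by simpa using hr)).trans (hrr' ▸ (hreach r' (by simpa using hr')).symm)
  have hcard : (#(reps H'.Reachable h \ reps H.Reachable h) : ℕ∞) ≤ d + 1 := by
    rw [← encard_coe_eq_coe_finsetCard, Finset.coe_sdiff, ← hinj.encard_image]
    calc _ ≤ (insert x (H.neighborSet x)).encard :=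
          encard_le_encard (image_subset_iff.2 fun r hr => hf r (by simpa using hr))
      _ ≤ d + 1 := (encard_insert_le _ _).trans (by gcongr)
  have := Finset.card_le_card_sdiff_add_card (s := reps H'.Reachable h)
    (t := reps H.Reachable h)
  have : #(reps H'.Reachable h \ reps H.Reachable h) ≤ d + 1 := by exact_mod_cast hcard
  omega

theorem card_reps_residual_le (hH : ∀ v, (H.neighborSet v).encard ≤ 2) (x t : ℕ) :
    #(reps (residual H x t).Reachable h) ≤ #(reps H.Reachable h) + 6 := by
  have hx := card_reps_deleteIncidenceSet_le (h := h) (d := 2) (hH x)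
  have ht := card_reps_deleteIncidenceSet_le (H := H.deleteIncidenceSet x) (h := h) (x := t)
    (d := 2) ((encard_le_encard fun v hv => (H.deleteIncidenceSet_le x) hv).trans (hH t))
  exact ht.trans (by omega)

theorem card_reps_map_le_cc (H : SimpleGraph (Fin h)) :
    #(reps (H.map Fin.valEmbedding).Reachable h) ≤ cc H := by
  rw [← Nat.card_eq_finsetCard]
  refine Nat.card_le_card_of_injective
    (fun r => H.connectedComponentMk ⟨r, (mem_reps.1 r.2).1⟩) fun r r' hrr' => ?_
  exact Subtype.ext <| eq_of_mem_reps_of_reachable r.2 r'.2 <|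
    (SimpleGraph.ConnectedComponent.exact hrr').map (SimpleGraph.Embedding.map _ H).toHom

/-- The vertices of `S` all of whose neighbours are in `S`. -/
def shrink (A : SimpleGraph ℕ) (S : Set ℕ) : Set ℕ := {z ∈ S | A.neighborSet z ⊆ S}

theorem iterate_shrink_eq (hH : H.support ⊆ Iio h) (y : ℕ) :
    (shrink H)^[h] (Iio h \ {y}) = {z | z < h ∧ ¬H.Reachable y z} := by
  set X := (shrink H)^[h] (Iio h \ {y})
  have hX : X ⊆ Iio h \ {y} := iterate_subset (fun _ => sep_subset _ _) h _
  have hfix : shrink H X = X :=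
    isFixedPt_iterate_of_ncard_le (fun _ => sep_subset _ _) ((finite_Iio h).subset sdiff_subset)
      ((ncard_le_ncard sdiff_subset (finite_Iio h)).trans_eq (by simp))
  refine subset_antisymm (fun z hz => ?_) (subset_iterate (fun S hS z hz => ?_) h fun z hz => ?_)
  · refine ⟨(hX hz).1, fun hyz => ?_⟩
    rw [SimpleGraph.reachable_iff_reflTransGen] at hyz
    refine (hX (hyz.head_induction_on (motive := fun y _ => y ∈ X) hz fun hadj _ hmem => ?_)).2 rfl
    exact (hfix.symm ▸ hmem : _ ∈ shrink H X).2 hadj.symm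
  · refine ⟨hS hz, fun w hzw => hS ?_⟩
    have hwz : H.Adj w z := SimpleGraph.Adj.symm hzw
    exact ⟨hH ⟨z, hwz⟩, fun hyw => hz.2 (hyw.trans hwz.reachable)⟩
  · exact ⟨hz.1, fun hzy => hz.2 (hzy ▸ .rfl)⟩

end Components

section BranchPairs

open Classical in
/-- The branch edges with ends below `n`, as increasing pairs. -/
noncomputable def branchPairs (G : SimpleGraph ℕ) (K : Set ℕ) (n : ℕ) : Finset (ℕ × ℕ) :=
  {e ∈ Finset.range n ×ˢ Finset.range n | e.1 < e.2 ∧ s(e.1, e.2) ∈ branchEdges G K}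

/-- The elements of `S` selected by `D`, which are referred to by their ranks. -/
def decodePairs (S : Finset (ℕ × ℕ)) (D : ℕ → Prop) : Set (ℕ × ℕ) :=
  {e | e ∈ S ∧ D (rank toLex S e)}

/-- The graph `G` without the edges of `S` selected by `D`. -/
def kept (G : SimpleGraph ℕ) (S : Finset (ℕ × ℕ)) (D : ℕ → Prop) : SimpleGraph ℕ :=
  G.deleteEdges ((fun e => s(e.1, e.2)) '' decodePairs S D)

variable {G : SimpleGraph ℕ} {K : Set ℕ} {n : ℕ}

theorem mem_branchPairs {e : ℕ × ℕ} : e ∈ branchPairs G K n ↔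
    (e.1 < n ∧ e.2 < n) ∧ e.1 < e.2 ∧ s(e.1, e.2) ∈ branchEdges G K := by
  simp [branchPairs]

theorem card_branchPairs_eq_encard (hG : G.support ⊆ Iio n) :
    (#(branchPairs G K n) : ℕ∞) = (branchEdges G K).encard := by
  have hinj : InjOn (fun e => s(e.1, e.2)) (branchPairs G K n : Set (ℕ × ℕ)) :=
    fun e he e' he' h => by grind [mem_branchPairs]
  rw [← encard_coe_eq_coe_finsetCard, ← hinj.encard_image]
  refine congrArg encard (subset_antisymm (image_subset_iff.2 fun e he =>
    (mem_branchPairs.1 he).2.2) fun e he => ?_)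
  induction e with | _ u v
  have huv : G.Adj u v := he.1
  have hu : u < n := hG ⟨v, huv⟩
  have hv : v < n := hG ⟨u, huv.symm⟩
  rcases huv.ne.lt_or_gt with hlt | hlt
  · exact ⟨(u, v), mem_branchPairs.2 ⟨⟨hu, hv⟩, hlt, he⟩, rfl⟩
  · exact ⟨(v, u), mem_branchPairs.2 ⟨⟨hv, hu⟩, hlt, Sym2.eq_swap ▸ he⟩, Sym2.eq_swap⟩

theorem kept_adj {S : Finset (ℕ × ℕ)} {D : ℕ → Prop} {u v : ℕ} : (kept G S D).Adj u v ↔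
    G.Adj u v ∧ (u, v) ∉ decodePairs S D ∧ (v, u) ∉ decodePairs S D := by
  rw [kept, SimpleGraph.deleteEdges_adj]
  refine and_congr_right fun _ => ?_
  grind

theorem kept_congr {S : Finset (ℕ × ℕ)} {D D' : ℕ → Prop} (hD : ∀ i < #S, D i ↔ D' i) :
    kept G S D = kept G S D' := by
  have : decodePairs S D = decodePairs S D' :=
    Set.ext fun e => and_congr_right fun he => hD _ (rank_lt_card he)
  rw [kept, kept, this]

theorem exists_kept_eq (hG : G.support ⊆ Iio n) {R : Set (Sym2 ℕ)} (hR : R ⊆ branchEdges G K) :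
    ∃ b < 2 ^ #(branchPairs G K n),
      kept G (branchPairs G K n) (b.testBit ·) = G.deleteEdges R := by
  obtain ⟨b, hb, hbit⟩ := exists_testBit_rank (S := branchPairs G K n) (f := toLex)
    toLex.injective fun e => s(e.1, e.2) ∈ R
  refine ⟨b, hb, ?_⟩
  ext u v
  rw [kept_adj, SimpleGraph.deleteEdges_adj]
  refine and_congr_right fun huv => ?_
  have hmem {u v : ℕ} (huv : G.Adj u v) :
      (u, v) ∈ decodePairs (branchPairs G K n) (b.testBit ·) ↔ u < v ∧ s(u, v) ∈ R := by
    have hu : u < n := hG ⟨v, huv⟩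
    have hv : v < n := hG ⟨u, huv.symm⟩
    refine ⟨fun ⟨he, hb⟩ => ⟨(mem_branchPairs.1 he).2.1, (hbit _ he).1 hb⟩, fun ⟨hlt, he⟩ => ?_⟩
    have hmem : (u, v) ∈ branchPairs G K n := mem_branchPairs.2 ⟨⟨hu, hv⟩, hlt, hR he⟩
    exact ⟨hmem, (hbit _ hmem).2 he⟩
  rw [hmem huv, hmem huv.symm, Sym2.eq_swap (a := v)]
  grind [huv.ne]

end BranchPairs

end SubgraphIso

namespace RAM

open Set Elimination SubgraphIso
open scoped Finset

/-- A family of sets of numbers below the bound whose membership relation is definable. -/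
structure DefinableSet (S : Ctx → (ℕ → ℕ) → Set ℕ) : Prop where
  subset (c ρ) : S c ρ ⊆ Iio c.B
  var_mem : DefinablePred fun c ρ => ρ 0 ∈ S c fun i => ρ (i + 1)

/-- A family of graphs on the numbers below the bound whose adjacency relation is definable. -/
structure DefinableGraph (A : Ctx → (ℕ → ℕ) → SimpleGraph ℕ) : Prop where
  support_subset (c ρ) : (A c ρ).support ⊆ Iio c.B
  var_adj : DefinablePred fun c ρ => (A c fun i => ρ (i + 2)).Adj (ρ 1) (ρ 0)

/-- A family of finite sets of pairs of numbers below the bound whose membership relation is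
definable. -/
structure DefinablePairs (S : Ctx → (ℕ → ℕ) → Finset (ℕ × ℕ)) : Prop where
  subset (c ρ) : S c ρ ⊆ Finset.range c.B ×ˢ Finset.range c.B
  var_mem : DefinablePred fun c ρ => (ρ 1, ρ 0) ∈ S c fun i => ρ (i + 2)

/-- A family of pieces all of whose data are definable. -/
structure DefinablePiece (P : Ctx → (ℕ → ℕ) → Piece) : Prop where
  x : Definable fun c ρ => (P c ρ).x
  t : Definable fun c ρ => (P c ρ).t
  a : Definable fun c ρ => (P c ρ).a
  dom : DefinableSet fun c ρ => (P c ρ).dom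

variable {F G : Ctx → (ℕ → ℕ) → ℕ} {P Q : Ctx → (ℕ → ℕ) → Prop} {S T : Ctx → (ℕ → ℕ) → Set ℕ}
  {A : Ctx → (ℕ → ℕ) → SimpleGraph ℕ}

theorem DefinablePred.subst {P : Ctx → (ℕ → ℕ) → ℕ → Prop}
    (hP : DefinablePred fun c ρ => P c (fun i => ρ (i + 1)) (ρ 0)) (hF : Definable F) :
    DefinablePred fun c ρ => P c ρ (F c ρ) :=
  Definable.subst (F := fun c ρ x => open Classical in if P c ρ x then 1 else 0) hP hF

theorem DefinablePred.ite [∀ c ρ, Decidable (P c ρ)] (hP : DefinablePred P)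
    (hQ : DefinablePred Q) {R : Ctx → (ℕ → ℕ) → Prop} (hR : DefinablePred R) :
    DefinablePred fun c ρ => if P c ρ then Q c ρ else R c ρ :=
  ((hP.imp hQ).and (hP.not.imp hR)).congr fun c ρ => by split_ifs <;> tauto

namespace DefinableSet

theorem reindex (hS : DefinableSet S) (f : ℕ → ℕ) : DefinableSet fun c ρ => S c fun i => ρ (f i) :=
  ⟨fun _ _ => hS.subset _ _, hS.var_mem.reindex fun | 0 => 0 | i + 1 => f i + 1⟩

theorem congr (hS : DefinableSet S) (h : ∀ c ρ, S c ρ = T c ρ) : DefinableSet T := by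
  rwa [← funext₂ h]

theorem mem (hS : DefinableSet S) (hF : Definable F) : DefinablePred fun c ρ => F c ρ ∈ S c ρ :=
  DefinablePred.subst (P := fun c ρ x => x ∈ S c ρ) hS.var_mem hF

theorem ex {P : Ctx → (ℕ → ℕ) → ℕ → Prop} (hS : DefinableSet S)
    (hP : DefinablePred fun c ρ => P c (fun i => ρ (i + 1)) (ρ 0)) :
    DefinablePred fun c ρ => ∃ x ∈ S c ρ, P c ρ x :=
  (DefinablePred.ex (P := fun c ρ x => x ∈ S c ρ ∧ P c ρ x) (hS.var_mem.and hP)).congr fun _ _ =>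
    ⟨fun ⟨x, _, h⟩ => ⟨x, h⟩, fun ⟨x, hx, h⟩ => ⟨x, hS.subset _ _ hx, hx, h⟩⟩

theorem all {P : Ctx → (ℕ → ℕ) → ℕ → Prop} (hS : DefinableSet S)
    (hP : DefinablePred fun c ρ => P c (fun i => ρ (i + 1)) (ρ 0)) :
    DefinablePred fun c ρ => ∀ x ∈ S c ρ, P c ρ x :=
  (DefinablePred.all (P := fun c ρ x => x ∈ S c ρ → P c ρ x) (hS.var_mem.imp hP)).congr fun _ _ =>
    ⟨fun h x hx => h x (hS.subset _ _ hx) hx, fun h x _ hx => h x hx⟩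

theorem sep {P : Ctx → (ℕ → ℕ) → ℕ → Prop} (hS : DefinableSet S)
    (hP : DefinablePred fun c ρ => P c (fun i => ρ (i + 1)) (ρ 0)) :
    DefinableSet fun c ρ => {x ∈ S c ρ | P c ρ x} :=
  ⟨fun _ _ _ hx => hS.subset _ _ hx.1, hS.var_mem.and hP⟩

theorem inter (hS : DefinableSet S) (hT : DefinableSet T) : DefinableSet fun c ρ => S c ρ ∩ T c ρ :=
  hS.sep hT.var_mem

theorem union (hS : DefinableSet S) (hT : DefinableSet T) : DefinableSet fun c ρ => S c ρ ∪ T c ρ :=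
  ⟨fun _ _ => union_subset (hS.subset _ _) (hT.subset _ _), hS.var_mem.or hT.var_mem⟩

theorem Iio (hF : Definable F) (hle : ∀ c ρ, F c ρ ≤ c.B) : DefinableSet fun c ρ => Iio (F c ρ) :=
  ⟨fun _ _ => Iio_subset_Iio (hle _ _), .lt (.var _) (hF.reindex _)⟩

theorem nonempty (hS : DefinableSet S) : DefinablePred fun c ρ => (S c ρ).Nonempty :=
  (hS.ex (P := fun _ _ x => x = x) (.eq (.var 0) (.var 0))).congr fun _ _ => by simp [Set.Nonempty]

theorem nontrivial (hS : DefinableSet S) : DefinablePred fun c ρ => (S c ρ).Nontrivial :=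
  hS.ex ((hS.reindex _).ex (.ne (.var _) (.var _)))

theorem subset_of (hS : DefinableSet S) (hT : DefinableSet T) :
    DefinablePred fun c ρ => S c ρ ⊆ T c ρ :=
  hS.all hT.var_mem

theorem disjoint (hS : DefinableSet S) (hT : DefinableSet T) :
    DefinablePred fun c ρ => Disjoint (S c ρ) (T c ρ) :=
  (hS.all hT.var_mem.not).congr fun _ _ => disjoint_left.symm

theorem ite {P : Ctx → (ℕ → ℕ) → Prop} [∀ c ρ, Decidable (P c ρ)] (hP : DefinablePred P)
    (hS : DefinableSet S) (hT : DefinableSet T) :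
    DefinableSet fun c ρ => if P c ρ then S c ρ else T c ρ :=
  ⟨fun c ρ => by split_ifs; exacts [hS.subset c ρ, hT.subset c ρ],
    ((hP.reindex (· + 1)).ite hS.var_mem hT.var_mem).congr fun c ρ => by split_ifs <;> rfl⟩

theorem eq (hS : DefinableSet S) (hT : DefinableSet T) : DefinablePred fun c ρ => S c ρ = T c ρ :=
  ((hS.subset_of hT).and (hT.subset_of hS)).congr fun _ _ => subset_antisymm_iff.symm

end DefinableSet

namespace Definable

theorem ncard (hS : DefinableSet S) : Definable fun c ρ => (S c ρ).ncard := by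
  classical
  refine (Definable.card (P := fun c ρ x => x ∈ S c ρ) hS.var_mem).congr fun c ρ => ?_
  rw [← ncard_coe_finset]
  congr 1
  ext x
  simpa using fun hx => hS.subset c ρ hx

theorem of_lt (hF : DefinablePred fun c ρ => ρ 0 < F c fun i => ρ (i + 1))
    (hle : ∀ c ρ, F c ρ ≤ c.B) : Definable F :=
  (ncard (S := fun c ρ => Iio (F c ρ)) ⟨fun c ρ => Iio_subset_Iio (hle c ρ), hF⟩).congr
    fun _ _ => ncard_Iio_nat _

theorem sInf (hS : DefinableSet S) : Definable fun c ρ => sInf (S c ρ) := by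
  have hS' := hS.reindex (· + 1)
  refine of_lt (((hS'.ex (P := fun _ ρ y => ρ 0 < y) (.lt (.var 1) (.var 0))).and
    (hS'.all (P := fun _ ρ y => ρ 0 < y) (.lt (.var 1) (.var 0)))).congr fun c ρ => ?_)
    fun c ρ => ?_
  · rcases (S c fun i => ρ (i + 1)).eq_empty_or_nonempty with h | h
    · simp [h]
    · exact ⟨fun hx => hx.2 _ (Nat.sInf_mem h), fun hx => ⟨⟨_, Nat.sInf_mem h, hx⟩,
        fun y hy => hx.trans_le (Nat.sInf_le hy)⟩⟩
  · rcases (S c ρ).eq_empty_or_nonempty with h | h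
    · simp [h]
    · exact (hS.subset c ρ (Nat.sInf_mem h)).le

theorem sInf_insert (hF : Definable F) (hle : ∀ c ρ, F c ρ ≤ c.B) (hS : DefinableSet S) :
    Definable fun c ρ => InfSet.sInf (insert (F c ρ) (S c ρ)) := by
  refine of_lt (((DefinablePred.lt (.var 0) (hF.reindex (· + 1))).and
    ((hS.reindex (· + 1)).all (P := fun _ ρ y => ρ 0 < y)
      (.lt (.var 1) (.var 0)))).congr fun c ρ => ?_)
    fun c ρ => (Nat.sInf_le (mem_insert _ _)).trans (hle c ρ)
  refine ⟨fun h => ?_, fun h => ⟨h.trans_le (Nat.sInf_le (mem_insert _ _)),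
    fun y hy => h.trans_le (Nat.sInf_le (mem_insert_of_mem _ hy))⟩⟩
  rcases Nat.sInf_mem (insert_nonempty (F c fun i => ρ (i + 1)) (S c fun i => ρ (i + 1)))
    with h' | h'
  · exact h.1.trans_eq h'.symm
  · exact h.2 _ h'

theorem finsetCard {S : Ctx → (ℕ → ℕ) → Finset ℕ} (hS : DefinableSet fun c ρ => (S c ρ : Set ℕ)) :
    Definable fun c ρ => #(S c ρ) :=
  (ncard hS).congr fun _ _ => ncard_coe_finset _

theorem rank {S : Ctx → (ℕ → ℕ) → Finset ℕ} (hS : DefinableSet fun c ρ => (S c ρ : Set ℕ))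
    (hF : Definable F) : Definable fun c ρ => rank id (S c ρ) (F c ρ) := by
  have hT := hS.sep (P := fun c ρ x => x < F c ρ) (.lt (.var 0) (hF.reindex _))
  refine (ncard hT).congr fun c ρ => ?_
  rw [SubgraphIso.rank, ← ncard_coe_finset, Finset.coe_filter]
  rfl

end Definable

namespace DefinableGraph

theorem reindex (hA : DefinableGraph A) (f : ℕ → ℕ) :
    DefinableGraph fun c ρ => A c fun i => ρ (f i) :=
  ⟨fun _ _ => hA.support_subset _ _, hA.var_adj.reindex fun | 0 => 0 | 1 => 1 | i + 2 => f i + 2⟩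

theorem neighborSet (hA : DefinableGraph A) (hF : Definable F) :
    DefinableSet fun c ρ => (A c ρ).neighborSet (F c ρ) := by
  refine ⟨fun c ρ v hv => hA.support_subset c ρ ⟨_, SimpleGraph.Adj.symm hv⟩, ?_⟩
  exact DefinablePred.subst (P := fun c ρ u => (A c fun i => ρ (i + 1)).Adj u (ρ 0))
    (hA.var_adj.reindex fun | 0 => 1 | 1 => 0 | i + 2 => i + 2) (hF.reindex _)

theorem adj (hA : DefinableGraph A) (hF : Definable F) (hG : Definable G) :
    DefinablePred fun c ρ => (A c ρ).Adj (F c ρ) (G c ρ) :=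
  (hA.neighborSet hF).mem hG

theorem residual (hA : DefinableGraph A) (hF : Definable F) (hG : Definable G) :
    DefinableGraph fun c ρ => residual (A c ρ) (F c ρ) (G c ρ) where
  support_subset c ρ := fun _ ⟨w, h⟩ => hA.support_subset c ρ ⟨w, (residual_adj.1 h).1⟩
  var_adj := (hA.var_adj.and (((DefinablePred.ne (.var _) (hF.reindex _)).and
    (.ne (.var _) (hF.reindex _))).and ((DefinablePred.ne (.var _) (hG.reindex _)).and
      (.ne (.var _) (hG.reindex _))))).congr fun _ _ => residual_adj.symm

end DefinableGraph

namespace DefinableSet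

theorem peel (hA : DefinableGraph A) (hS : DefinableSet S) :
    DefinableSet fun c ρ => peel (A c ρ) (S c ρ) :=
  hS.sep ((((hA.reindex _).neighborSet (.var _)).inter (hS.reindex _)).nontrivial)

theorem shrink (hA : DefinableGraph A) (hS : DefinableSet S) :
    DefinableSet fun c ρ => shrink (A c ρ) (S c ρ) :=
  hS.sep (((hA.reindex _).neighborSet (.var _)).subset_of (hS.reindex _))

theorem eligible (hA : DefinableGraph A) (hS : DefinableSet S) :
    DefinableSet fun c ρ => eligible (A c ρ) (S c ρ) :=
  have hT := ((hA.reindex (· + 1)).neighborSet (.var 0)).inter (hS.reindex (· + 1))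
  hS.sep ((hT.nontrivial.not.congr fun _ _ => not_nontrivial_iff).or ((hS.reindex _).all
    (((hA.reindex _).neighborSet (.var _)).inter (hS.reindex _)).nontrivial))

theorem branch (hA : DefinableGraph A) (hS : DefinableSet S) :
    DefinableSet fun c ρ => {v ∈ S c ρ | v ∈ branch (A c ρ) (S c ρ)} := by
  have hT := ((hA.reindex (· + 1)).neighborSet (.var 0)).inter (hS.reindex (· + 1))
  refine hS.sep ((DefinablePred.lt (.const 2) (.ncard hT)).congr fun c ρ => ?_)
  rw [SubgraphIso.branch, mem_ofPred,
    ← ((finite_Iio _).subset (hT.subset c ρ)).cast_ncard_eq]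
  norm_cast

theorem reps {R : Ctx → (ℕ → ℕ) → ℕ → ℕ → Prop}
    (hR : DefinablePred fun c ρ => R c (fun i => ρ (i + 2)) (ρ 1) (ρ 0)) (hF : Definable F)
    (hle : ∀ c ρ, F c ρ ≤ c.B) :
    DefinableSet fun c ρ => (reps (R c ρ) (F c ρ) : Set ℕ) := by
  have hI := Iio hF hle
  refine (hI.sep (P := fun c ρ r => ∀ z ∈ Set.Iio (F c ρ), R c ρ r z → r ≤ z)
    ((hI.reindex _).all (hR.imp (.le (.var 1) (.var 0))))).congr fun c ρ => ?_
  ext r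
  exact mem_reps.symm

theorem decode {R : Ctx → (ℕ → ℕ) → ℕ → ℕ → Prop} {D : Ctx → (ℕ → ℕ) → ℕ → Prop}
    (hR : DefinablePred fun c ρ => R c (fun i => ρ (i + 2)) (ρ 1) (ρ 0)) (hF : Definable F)
    (hle : ∀ c ρ, F c ρ ≤ c.B) (hD : DefinablePred fun c ρ => D c (fun i => ρ (i + 1)) (ρ 0)) :
    DefinableSet fun c ρ => decode (R c ρ) (F c ρ) (D c ρ) := by
  have hreps := reps hR hF hle
  refine (Iio hF hle).sep ((hreps.reindex _).ex
    ((hR.reindex fun | 0 => 1 | 1 => 0 | i + 2 => i + 2).and ?_))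
  exact DefinablePred.subst (P := fun c ρ x => D c (fun i => ρ (i + 2)) x)
    (hD.reindex fun | 0 => 0 | i + 1 => i + 3) (.rank (hreps.reindex _) (.var _))

end DefinableSet

namespace DefinablePairs

variable {S : Ctx → (ℕ → ℕ) → Finset (ℕ × ℕ)}

theorem reindex (hS : DefinablePairs S) (f : ℕ → ℕ) :
    DefinablePairs fun c ρ => S c fun i => ρ (f i) :=
  ⟨fun _ _ => hS.subset _ _, hS.var_mem.reindex fun | 0 => 0 | 1 => 1 | i + 2 => f i + 2⟩

theorem mem (hS : DefinablePairs S) (hF : Definable F) (hG : Definable G) :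
    DefinablePred fun c ρ => (F c ρ, G c ρ) ∈ S c ρ :=
  DefinablePred.subst (P := fun c ρ x => (F c ρ, x) ∈ S c ρ)
    (DefinablePred.subst (P := fun c ρ x => (x, ρ 0) ∈ S c fun i => ρ (i + 1))
      (hS.var_mem.reindex fun | 0 => 1 | 1 => 0 | i + 2 => i + 2) (hF.reindex _)) hG

theorem sep {P : Ctx → (ℕ → ℕ) → ℕ × ℕ → Prop} [∀ c ρ, DecidablePred (P c ρ)]
    (hS : DefinablePairs S)
    (hP : DefinablePred fun c ρ => P c (fun i => ρ (i + 2)) (ρ 1, ρ 0)) :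
    DefinablePairs fun c ρ => {e ∈ S c ρ | P c ρ e} :=
  ⟨fun _ _ => (Finset.filter_subset _ _).trans (hS.subset _ _),
    (hS.var_mem.and hP).congr fun _ _ => Finset.mem_filter.symm⟩

theorem card (hS : DefinablePairs S) : Definable fun c ρ => #(S c ρ) := by
  classical
  refine (Definable.sum (F := fun c ρ u => #{v ∈ Finset.range c.B | (u, v) ∈ S c ρ})
    (.card (P := fun c ρ v => (ρ 0, v) ∈ S c fun i => ρ (i + 1)) hS.var_mem)).congr fun c ρ => ?_
  calc _ = #{e ∈ Finset.range c.B ×ˢ Finset.range c.B | e ∈ S c ρ} := by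
        simp only [Finset.card_filter, Finset.sum_product]
    _ = #(S c ρ) := by rw [Finset.filter_mem_eq_inter, Finset.inter_eq_right.2 (hS.subset c ρ)]

theorem rank (hS : DefinablePairs S) (hF : Definable F) (hG : Definable G) :
    Definable fun c ρ => rank toLex (S c ρ) (F c ρ, G c ρ) :=
  have hF' := hF.reindex (· + 2)
  have hlt : DefinablePred fun c ρ => toLex (ρ 1, ρ 0) <
      toLex (F c fun i => ρ (i + 2), G c fun i => ρ (i + 2)) :=
    ((DefinablePred.lt (.var 1) hF').or ((DefinablePred.eq (.var 1) hF').and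
      (.lt (.var 0) (hG.reindex (· + 2))))).congr fun _ _ =>
      (Prod.Lex.toLex_lt_toLex (x := (_, _)) (y := (_, _))).symm
  (hS.sep (P := fun c ρ e => toLex e < toLex (F c ρ, G c ρ)) hlt).card

theorem branchPairs (hA : DefinableGraph A) {K : Ctx → (ℕ → ℕ) → Set ℕ} (hK : DefinableSet K) :
    DefinablePairs fun c ρ => branchPairs (A c ρ) (K c ρ) c.B := by
  have hA' := hA.reindex (· + 2)
  have hK' := hK.reindex (· + 2)
  have hbranch (i : ℕ) := (DefinableSet.branch hA' hK').mem (.var i)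
  refine ⟨fun c ρ => by classical exact Finset.filter_subset _ _, ?_⟩
  refine ((DefinablePred.lt (.var 1) (.var 0)).and ((hA'.adj (.var 1) (.var 0)).and
    (((hK'.mem (.var 1)).and (hK'.mem (.var 0))).and
      ((hbranch 1).or (hbranch 0))))).congr fun c ρ => ?_
  have hlt {v : ℕ} (hv : v ∈ K c fun i => ρ (i + 2)) : v < c.B := hK.subset _ _ hv
  simp only [mem_branchPairs, branchEdges, mem_ofPred_eq, SimpleGraph.mem_edgeSet, Sym2.mem_iff]
  grind

end DefinablePairs

theorem DefinableGraph.kept {S : Ctx → (ℕ → ℕ) → Finset (ℕ × ℕ)} {D : Ctx → (ℕ → ℕ) → ℕ → Prop}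
    (hA : DefinableGraph A) (hS : DefinablePairs S)
    (hD : DefinablePred fun c ρ => D c (fun i => ρ (i + 1)) (ρ 0)) :
    DefinableGraph fun c ρ => kept (A c ρ) (S c ρ) (D c ρ) where
  support_subset c ρ := fun _ ⟨w, h⟩ => hA.support_subset c ρ ⟨w, (kept_adj.1 h).1⟩
  var_adj := by
    have hmem (i j : ℕ) : DefinablePred fun c ρ =>
        (ρ i, ρ j) ∈ decodePairs (S c fun i => ρ (i + 2)) (D c fun i => ρ (i + 2)) :=
      ((hS.reindex _).mem (.var i) (.var j)).and
        (DefinablePred.subst (P := fun c ρ x => D c (fun i => ρ (i + 2)) x)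
          (hD.reindex fun | 0 => 0 | i + 1 => i + 3) ((hS.reindex _).rank (.var i) (.var j)))
    exact (hA.var_adj.and ((hmem 1 0).not.and (hmem 0 1).not)).congr fun _ _ => kept_adj.symm

namespace DefinablePiece

variable {P P₁ P₂ : Ctx → (ℕ → ℕ) → Piece}

theorem reindex (hP : DefinablePiece P) (f : ℕ → ℕ) :
    DefinablePiece fun c ρ => P c fun i => ρ (f i) :=
  ⟨hP.x.reindex _, hP.t.reindex _, hP.a.reindex _, hP.dom.reindex _⟩

theorem eq (hP : DefinablePiece P) (hQ : DefinablePiece P₁) :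
    DefinablePred fun c ρ => P c ρ = P₁ c ρ :=
  ((DefinablePred.eq hP.x hQ.x).and ((DefinablePred.eq hP.t hQ.t).and
    ((DefinablePred.eq hP.a hQ.a).and (hP.dom.eq hQ.dom)))).congr fun c ρ => by
      cases P c ρ
      cases P₁ c ρ
      simp

theorem isValid (hP : DefinablePiece P) (hA : DefinableGraph A) (hF : Definable F)
    (hle : ∀ c ρ, F c ρ ≤ c.B) (hG : Definable G) :
    DefinablePred fun c ρ => (P c ρ).IsValid (A c ρ) (F c ρ) (G c ρ) := by
  have hR := hA.residual hP.x hP.t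
  have hclosed : DefinablePred fun c ρ => ∀ y ∈ (P c ρ).dom,
      (residual (A c ρ) (P c ρ).x (P c ρ).t).neighborSet y ⊆ (P c ρ).dom :=
    hP.dom.all (((hR.reindex _).neighborSet (.var 0)).subset_of (hP.dom.reindex _))
  refine (((DefinablePred.le hP.x hF).and ((DefinablePred.le hP.t hF).and (.le hP.a hG))).and
    ((hP.dom.subset_of (.Iio hF hle)).and hclosed)).congr fun c ρ => ?_
  exact ⟨fun h => ⟨h.1, h.2.1, fun y z hyz hy => h.2.2 y hy hyz⟩,
    fun h => ⟨h.le, h.subset, fun y hy z hyz => h.isClosed y z hyz hy⟩⟩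

theorem isStart (hP : DefinablePiece P) (hF : Definable F) (hG : Definable G) :
    DefinablePred fun c ρ => IsStart (F c ρ) (G c ρ) (P c ρ) :=
  (hP.dom.all (DefinablePred.eq (.var _) (hP.x.reindex _))).and
    ((hP.dom.nonempty.imp (.lt hG hF)).and
      ((hP.dom.mem hP.t).imp (.eq hP.a hG)))

theorem located (hP : DefinablePiece P) {F' : Ctx → (ℕ → ℕ) → ℕ} (hF : Definable F)
    (hG : Definable G) (hF' : Definable F') :
    DefinablePred fun c ρ => (P c ρ).Located (F c ρ) (G c ρ) (F' c ρ) :=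
  (hP.dom.mem hG).and (((DefinablePred.eq hG hP.x).and (.eq hF' hF)).or
    ((DefinablePred.eq hG hP.t).and (.eq hF' hP.a)))

theorem isMerge {A' : Ctx → (ℕ → ℕ) → SimpleGraph ℕ} (hA : DefinableGraph A)
    (hA' : DefinableGraph A') (hF : Definable F) (hG : Definable G) (hP₁ : DefinablePiece P₁)
    (hP₂ : DefinablePiece P₂) (hP : DefinablePiece P) :
    DefinablePred fun c ρ =>
      Piece.IsMerge (A c ρ) (A' c ρ) (F c ρ) (G c ρ) (P₁ c ρ) (P₂ c ρ) (P c ρ) := by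
  have hadj : DefinablePred fun c ρ => ∀ y ∈ (P₁ c ρ).dom, ∀ z ∈ (P₂ c ρ).dom, (A c ρ).Adj y z →
      ∃ w < c.B, ∃ w' ∈ (A' c ρ).neighborSet w,
        (P₁ c ρ).Located (F c ρ) y w ∧ (P₂ c ρ).Located (G c ρ) z w' :=
    hP₁.dom.all <| (hP₂.dom.reindex _).all <| ((hA.reindex _).adj (.var 1) (.var 0)).imp <|
      .ex <| ((hA'.reindex _).neighborSet (.var 0)).ex <|
        ((hP₁.reindex _).located (hF.reindex _) (.var 3) (.var 1)).and
          ((hP₂.reindex _).located (hG.reindex _) (.var 2) (.var 0))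
  have hlt {c ρ w w'} (h : (A' c ρ).Adj w w') : w < c.B := hA'.support_subset c ρ ⟨w', h⟩
  refine ((DefinablePred.eq hP₂.x hP.x).and ((hP.dom.eq (hP₁.dom.union hP₂.dom)).and
    ((hP₁.dom.disjoint hP₂.dom).and ((hP₁.dom.mem hP.x).not.and (hadj.and
      ((hP.dom.mem hP.t).imp ((hP₁.located hF hP.t hP.a).or
        (hP₂.located hG hP.t hP.a)))))))).congr fun c ρ => ?_
  constructor
  · rintro ⟨hx, hdom, hdisj, hnot, hadj, htag⟩
    refine ⟨hx, hdom, hdisj, hnot, fun y hy z hz hyz => ?_, htag⟩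
    obtain ⟨w, -, w', hww', hw, hw'⟩ := hadj y hy z hz hyz
    exact ⟨w, w', hw, hw', hww'⟩
  · rintro ⟨hx, hdom, hdisj, hnot, hadj, htag⟩
    refine ⟨hx, hdom, hdisj, hnot, fun y hy z hz hyz => ?_, htag⟩
    obtain ⟨w, w', hw, hw', hww'⟩ := hadj y hy z hz hyz
    exact ⟨w, hlt hww', w', hww', hw, hw'⟩

end DefinablePiece

end RAM

namespace RAM

open Set Elimination SubgraphIso
open scoped Finset

/-- The entries of the table, which are truth values: the `s`-th binary digit of `m` is `1`; the
vertex `v` survives `s` rounds of the computation of the core of the host; the vertex `z` survives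
`s` rounds of the computation of the component of `y` in the pattern without the edges at `x`
or `t`; the vertex `v` is left after `s` steps of the elimination belonging to the number `b`; the
piece given by `x`, `t`, `a` and `m` is found for the block of `p` after these `s` steps. -/
inductive Query
  | bit (s m : ℕ)
  | core (s v : ℕ)
  | apart (s x t y z : ℕ)
  | alive (s b v : ℕ)
  | found (s b p x t a m : ℕ)

namespace Query

/-- The kind of the query, used as the leading digit of its address: queries of larger tag may refer
to all those of smaller tag. -/
def tag : Query → ℕ
  | bit .. => 0
  | core .. => 1
  | apart .. => 2
  | alive .. => 3
  | found .. => 4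

/-- The number of the round or step that the query asks about. Queries refer to queries of the same
kind only in the preceding round. -/
def round : Query → ℕ
  | bit s _ | core s _ | apart s _ _ _ _ | alive s _ _ | found s _ _ _ _ _ _ => s

/-- The arguments of the query other than its round, at most six. -/
def args : Query → List ℕ
  | bit _ m => [m]
  | core _ v => [v]
  | apart _ x t y z => [x, t, y, z]
  | alive _ b v => [b, v]
  | found _ b p x t a m => [b, p, x, t, a, m]

/-- The digits of the address of a query, the least significant one first. -/
def digits (q : Query) : List ℕ := q.args.rightpad 6 0 ++ [q.round, q.tag]

/-- The position of the answer to a query in the table. -/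
def addr (B : ℕ) (q : Query) : ℕ := Nat.ofDigits B q.digits

/-- A query refers only to queries of smaller level. -/
def level (B : ℕ) (q : Query) : ℕ := q.round + B * q.tag

/-- The query can be asked with bound `B`: its round and its arguments are digits in base `B`. -/
def Fits (B : ℕ) (q : Query) : Prop := q.round < B ∧ ∀ d ∈ q.args, d < B

variable {B : ℕ} {q q' : Query}

theorem exists_fits_iff {P : Query → Prop} : (∃ q : Query, q.Fits B ∧ P q) ↔
    (∃ s < B, ∃ m < B, P (bit s m)) ∨ (∃ s < B, ∃ v < B, P (core s v)) ∨
      (∃ s < B, ∃ x < B, ∃ t < B, ∃ y < B, ∃ z < B, P (apart s x t y z)) ∨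
      (∃ s < B, ∃ b < B, ∃ v < B, P (alive s b v)) ∨
      ∃ s < B, ∃ b < B, ∃ p < B, ∃ x < B, ∃ t < B, ∃ a < B, ∃ m < B,
        P (found s b p x t a m) := by
  constructor
  · rintro ⟨_ | _ | _ | _ | _, ⟨hs, hargs⟩, h⟩ <;>
      simp only [args, List.forall_mem_cons] at hargs
    · exact .inl ⟨_, hs, _, hargs.1, h⟩
    · exact .inr (.inl ⟨_, hs, _, hargs.1, h⟩)
    · obtain ⟨hx, ht, hy, hz, -⟩ := hargs
      exact .inr (.inr (.inl ⟨_, hs, _, hx, _, ht, _, hy, _, hz, h⟩))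
    · obtain ⟨hb, hv, -⟩ := hargs
      exact .inr (.inr (.inr (.inl ⟨_, hs, _, hb, _, hv, h⟩)))
    · obtain ⟨hb, hp, hx, ht, ha, hm, -⟩ := hargs
      exact .inr (.inr (.inr (.inr
        ⟨_, hs, _, hb, _, hp, _, hx, _, ht, _, ha, _, hm, h⟩)))
  · rintro (⟨s, hs, m, hm, h⟩ | ⟨s, hs, v, hv, h⟩ | ⟨s, hs, x, hx, t, ht, y, hy, z, hz, h⟩ |
      ⟨s, hs, b, hb, v, hv, h⟩ | ⟨s, hs, b, hb, p, hp, x, hx, t, ht, a, ha, m, hm, h⟩)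
    all_goals
      refine ⟨_, ?_, h⟩
      exact ⟨hs, by simp [args, *]⟩

theorem length_args_le : q.args.length ≤ 6 := by cases q <;> simp [args]

theorem length_digits : q.digits.length = 8 := by
  have := q.length_args_le
  simp only [digits, List.rightpad, List.length_append, List.length_replicate, List.length_cons,
    List.length_nil]
  omega

theorem digits_injective : Function.Injective digits := fun q q' h => by
  cases q <;> cases q' <;> simp_all [digits, args, round, tag, List.rightpad]

theorem tag_lt : q.tag < 5 := by cases q <;> simp [tag]

theorem Fits.lt_of_mem_digits (hq : q.Fits B) (hB : 5 ≤ B) {d : ℕ} (hd : d ∈ q.digits) :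
    d < B := by
  have := q.tag_lt
  simp only [digits, List.rightpad, List.mem_append, List.mem_replicate, List.mem_cons,
    List.not_mem_nil, or_false] at hd
  rcases hd with (hd | ⟨-, rfl⟩) | rfl | rfl
  · exact hq.2 d hd
  · omega
  · exact hq.1
  · omega

theorem addr_lt (hq : q.Fits B) (hB : 5 ≤ B) : q.addr B < B ^ 8 :=
  length_digits (q := q) ▸
    Nat.ofDigits_lt_base_pow_length (by omega) fun _ hd => hq.lt_of_mem_digits hB hd

theorem addr_inj (hq : q.Fits B) (hq' : q'.Fits B) (hB : 5 ≤ B) :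
    q.addr B = q'.addr B ↔ q = q' := by
  refine ⟨fun h => digits_injective ?_, congrArg _⟩
  exact Nat.ofDigits_inj_of_len_eq (by omega) (length_digits.trans length_digits.symm)
    (fun _ hd => hq.lt_of_mem_digits hB hd) (fun _ hd => hq'.lt_of_mem_digits hB hd) h

theorem addr_eq (B : ℕ) (q : Query) :
    q.addr B = Nat.ofDigits B (q.args.rightpad 6 0) + B ^ 6 * q.level B := by
  have : (q.args.rightpad 6 0).length = 6 := by
    have := q.length_args_le
    rw [List.length_rightpad]
    omega
  rw [addr, digits, Nat.ofDigits_append, this]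
  simp [level, Nat.ofDigits_cons]

theorem addr_lt_addr (hq : q.Fits B) (hB : 5 ≤ B) (h : q.level B < q'.level B) :
    q.addr B < q'.addr B := by
  have hlt : Nat.ofDigits B (q.args.rightpad 6 0) < B ^ (q.args.rightpad 6 0).length :=
    Nat.ofDigits_lt_base_pow_length (by omega) fun _ hd =>
      hq.lt_of_mem_digits hB (List.mem_append_left _ hd)
  rw [List.length_rightpad, max_eq_left q.length_args_le] at hlt
  have hmul := Nat.mul_le_mul_left (B ^ 6) h
  rw [addr_eq, addr_eq]
  rw [Nat.mul_succ] at hmul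
  omega

end Query

/-- The graph on the numbers below `n` whose adjacency matrix occupies the input from position `o`
on. -/
def Ctx.graphAt (c : Ctx) (o n : ℕ) : SimpleGraph ℕ :=
  SimpleGraph.fromRel fun u v => (u < n ∧ v < n) ∧ c.inp.getD (o + (u * n + v)) 0 ≠ 0

namespace Ctx

variable (c : Ctx)

/-- The number of vertices of the pattern, cut off below the bound. -/
def patternSize : ℕ := min (c.inp.getD 0 0) (c.B - 1)

/-- The number of vertices of the host, cut off below the bound. -/
def hostSize : ℕ := min (c.inp.getD 1 0) (c.B - 1)

/-- The graph `H` that is to be found in the host. -/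
def pattern : SimpleGraph ℕ := c.graphAt 2 c.patternSize

/-- The graph `G` in which the pattern is to be found. -/
def host : SimpleGraph ℕ := c.graphAt (2 + c.patternSize * c.patternSize) c.hostSize

/-- The answer to the query `q` stored in the table. -/
def Entry (q : Query) : Prop := c.tab (q.addr c.B) = 1

/-- The vertices that survive `s` rounds of the core computation, according to the table. -/
def coreTable (s : ℕ) : Set ℕ := {v ∈ Iio c.B | c.Entry (.core s v)}

/-- The vertices still considered to be disconnected from `y` after `s` rounds of the component
computation, according to the table. -/
def apartTable (s x t y : ℕ) : Set ℕ := {z ∈ Iio c.B | c.Entry (.apart s x t y z)}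

/-- The counterpart of `alive` read off the table. -/
def aliveTable (s b : ℕ) : Set ℕ := {v ∈ Iio c.B | c.Entry (.alive s b v)}

/-- The branch edges of the host, computed from the table. -/
noncomputable def tableBranchPairs : Finset (ℕ × ℕ) :=
  branchPairs c.host (c.coreTable c.hostSize) c.B

/-- The host without the branch edges selected by the binary digits of `b`. -/
noncomputable def tableKept (b : ℕ) : SimpleGraph ℕ :=
  kept c.host c.tableBranchPairs fun i => c.Entry (.bit i b)

/-- The counterpart of `picked` read off the table. -/
noncomputable def tablePicked (s b : ℕ) : ℕ :=
  sInf (eligible (c.tableKept b) (c.aliveTable s b))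

/-- The counterpart of `target` read off the table. -/
noncomputable def tableTarget (s b : ℕ) : ℕ :=
  sInf (insert c.hostSize ((c.tableKept b).neighborSet (c.tablePicked s b) ∩ c.aliveTable s b))

/-- The vertices `y` and `z` are connected in the pattern without the edges at `x` or `t`, according
to the table. -/
def Linked (x t y z : ℕ) : Prop := ¬c.Entry (.apart c.patternSize x t y z)

/-- The piece whose domain is the union of the components selected by the binary digits of `m`. -/
def tablePiece (x t a m : ℕ) : Piece :=
  ⟨x, t, a, decode (c.Linked x t) c.patternSize fun i => c.Entry (.bit i m)⟩

/-- The counterpart of `Found` for the block of `p`, read off the table. -/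
def foundTable (s b p : ℕ) : Set Piece :=
  {P | ∃ x < c.B, ∃ t < c.B, ∃ a < c.B, ∃ m < c.B,
    c.Entry (.found s b p x t a m) ∧ P = c.tablePiece x t a m}

/-- The answer to the query `q` in terms of the answers to queries of smaller level. -/
def Step : Query → Prop
  | .bit s m => if s = 0 then ∃ k < c.B, m = k + k + 1
      else ∃ k < c.B, (m = k + k ∨ m = k + k + 1) ∧ c.Entry (.bit (s - 1) k)
  | .core s v => v ∈ if s = 0 then Iio c.hostSize else peel c.host (c.coreTable (s - 1))
  | .apart s x t y z => z ∈ if s = 0 then Iio c.patternSize \ {y}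
      else shrink (residual c.pattern x t) (c.apartTable (s - 1) x t y)
  | .alive s b v => v ∈ if s = 0 then Iio c.hostSize
      else c.aliveTable (s - 1) b \ {c.tablePicked (s - 1) b}
  | .found s b p x t a m => (c.tablePiece x t a m).IsValid c.pattern c.patternSize c.hostSize ∧
      if s = 0 then IsStart c.hostSize p (c.tablePiece x t a m)
      else Advances c.pattern c.host (c.tablePicked (s - 1) b) (c.tableTarget (s - 1) b)
        (fun p P => P ∈ c.foundTable (s - 1) b p) p (c.tablePiece x t a m)

/-- The content of the table at address `a`. -/
def Rule (a : ℕ) : Prop := ∃ q : Query, q.Fits c.B ∧ a = q.addr c.B ∧ c.Step q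

/-- The dynamic programme succeeds for some choice of branch edges, according to the table. -/
def TableAccepts : Prop :=
  ∃ b < c.B, ∃ P ∈ c.foundTable c.hostSize b c.hostSize, Iio c.patternSize ⊆ P.dom

/-- Once the bound exceeds `2` to this power, it exceeds all numbers that encode a set of branch
edges or of components. -/
noncomputable def width : ℕ :=
  #c.tableBranchPairs + (#(reps (c.Linked c.patternSize c.patternSize) c.patternSize) + 6)

end Ctx

end RAM

namespace RAM

open Set Elimination SubgraphIso
open scoped Finset

variable {F G X Y Z W V : Ctx → (ℕ → ℕ) → ℕ}

namespace Definable

theorem mul_of_le (hF : Definable F) (hG : Definable G) (hFle : ∀ c ρ, F c ρ ≤ c.B)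
    (hGle : ∀ c ρ, G c ρ ≤ c.B) : Definable fun c ρ => F c ρ * G c ρ := by
  have hS : DefinablePairs fun c ρ => Finset.range (F c ρ) ×ˢ Finset.range (G c ρ) :=
    ⟨fun c ρ => Finset.product_subset_product (Finset.range_subset_range.2 (hFle c ρ))
      (Finset.range_subset_range.2 (hGle c ρ)),
      ((DefinablePred.lt (.var 1) (hF.reindex (· + 2))).and
        (.lt (.var 0) (hG.reindex (· + 2)))).congr fun _ _ => by simp⟩
  exact hS.card.congr fun _ _ => by simp

theorem ofDigits : ∀ L : List (Ctx → (ℕ → ℕ) → ℕ), (∀ F ∈ L, Definable F) →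
    Definable fun c ρ => Nat.ofDigits c.B (L.map fun F => F c ρ)
  | [], _ => .const 0
  | F :: L, h => ((h F (by simp)).add (ofDigits L fun G hG => h G (by simp [hG])).mul_bound).congr
      fun _ _ => by simp [Nat.ofDigits_cons, mul_comm]

theorem min (hF : Definable F) (hG : Definable G) : Definable fun c ρ => min (F c ρ) (G c ρ) :=
  (hF.sub (hF.sub hG)).congr fun _ _ => by omega

theorem patternSize : Definable fun c _ => c.patternSize :=
  (Definable.inp (.const 0)).min (.sub .bound (.const 1))

theorem hostSize : Definable fun c _ => c.hostSize :=
  (Definable.inp (.const 1)).min (.sub .bound (.const 1))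

end Definable

theorem Ctx.patternSize_le (c : Ctx) : c.patternSize ≤ c.B := (min_le_right _ _).trans (by omega)

theorem Ctx.hostSize_le (c : Ctx) : c.hostSize ≤ c.B := (min_le_right _ _).trans (by omega)

namespace DefinableGraph

theorem graphAt (hF : Definable F) (hG : Definable G) (hle : ∀ c ρ, G c ρ ≤ c.B) :
    DefinableGraph fun c ρ => c.graphAt (F c ρ) (G c ρ) := by
  have hlt (i j : ℕ) : DefinablePred fun c ρ =>
      ρ i < G c (fun k => ρ (k + 2)) ∧ ρ j < G c fun k => ρ (k + 2) :=
    (DefinablePred.lt (.var i) (hG.reindex _)).and (.lt (.var j) (hG.reindex _))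
  have hmat (i j : ℕ) : DefinablePred fun c ρ =>
      (ρ i < G c (fun k => ρ (k + 2)) ∧ ρ j < G c fun k => ρ (k + 2)) ∧
        c.inp.getD (F c (fun k => ρ (k + 2)) + (ρ i * G c (fun k => ρ (k + 2)) + ρ j)) 0 ≠ 0 := by
    have hmul := Definable.mul_of_le (F := fun c ρ => Min.min (ρ i) c.B)
      ((Definable.var i).min .bound) (hG.reindex (· + 2)) (fun _ _ => min_le_right _ _)
      fun _ _ => hle _ _
    refine ((hlt i j).and (.ne (.inp ((hF.reindex (· + 2)).add (hmul.add (.var j))))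
      (.const 0))).congr fun c ρ => and_congr_right fun h => ?_
    rw [min_eq_left (h.1.le.trans (hle _ _))]
  refine ⟨fun c ρ u ⟨v, huv⟩ => ?_, ((DefinablePred.ne (.var 1) (.var 0)).and
    ((hmat 1 0).or (hmat 0 1))).congr fun _ _ => Iff.rfl⟩
  rcases huv.2 with h | h
  · exact h.1.1.trans_le (hle c ρ)
  · exact h.1.2.trans_le (hle c ρ)

theorem pattern : DefinableGraph fun c _ => c.pattern :=
  graphAt (.const 2) .patternSize fun c _ => c.patternSize_le

theorem host : DefinableGraph fun c _ => c.host :=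
  graphAt ((Definable.const 2).add (.mul_of_le .patternSize .patternSize
    (fun c _ => c.patternSize_le) fun c _ => c.patternSize_le)) .hostSize fun c _ => c.hostSize_le

end DefinableGraph

/-- A family of queries whose addresses are definable. -/
def DefinableQuery (q : Ctx → (ℕ → ℕ) → Query) : Prop := Definable fun c ρ => (q c ρ).addr c.B

namespace DefinableQuery

theorem of_digits {q : Ctx → (ℕ → ℕ) → Query} (L : List (Ctx → (ℕ → ℕ) → ℕ))
    (hL : ∀ F ∈ L, Definable F) (hq : ∀ c ρ, (q c ρ).digits = L.map fun F => F c ρ) :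
    DefinableQuery q :=
  (Definable.ofDigits L hL).congr fun c ρ => by rw [Query.addr, hq]

theorem bit (hF : Definable F) (hG : Definable G) :
    DefinableQuery fun c ρ => .bit (F c ρ) (G c ρ) :=
  of_digits [G, fun _ _ => 0, fun _ _ => 0, fun _ _ => 0, fun _ _ => 0, fun _ _ => 0, F,
    fun _ _ => 0] (by simp [hF, hG, Definable.const]) fun _ _ => rfl

theorem core (hF : Definable F) (hG : Definable G) :
    DefinableQuery fun c ρ => .core (F c ρ) (G c ρ) :=
  of_digits [G, fun _ _ => 0, fun _ _ => 0, fun _ _ => 0, fun _ _ => 0, fun _ _ => 0, F,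
    fun _ _ => 1] (by simp [hF, hG, Definable.const]) fun _ _ => rfl

theorem apart (hF : Definable F) (hX : Definable X) (hY : Definable Y) (hZ : Definable Z)
    (hW : Definable W) :
    DefinableQuery fun c ρ => .apart (F c ρ) (X c ρ) (Y c ρ) (Z c ρ) (W c ρ) :=
  of_digits [X, Y, Z, W, fun _ _ => 0, fun _ _ => 0, F, fun _ _ => 2]
    (by simp [hF, hX, hY, hZ, hW, Definable.const]) fun _ _ => rfl

theorem alive (hF : Definable F) (hG : Definable G) (hX : Definable X) :
    DefinableQuery fun c ρ => .alive (F c ρ) (G c ρ) (X c ρ) :=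
  of_digits [G, X, fun _ _ => 0, fun _ _ => 0, fun _ _ => 0, fun _ _ => 0, F, fun _ _ => 3]
    (by simp [hF, hG, hX, Definable.const]) fun _ _ => rfl

theorem found (hF : Definable F) (hG : Definable G) (hX : Definable X) (hY : Definable Y)
    (hZ : Definable Z) (hW : Definable W) (hV : Definable V) :
    DefinableQuery fun c ρ => .found (F c ρ) (G c ρ) (X c ρ) (Y c ρ) (Z c ρ) (W c ρ) (V c ρ) :=
  of_digits [G, X, Y, Z, W, V, F, fun _ _ => 4]
    (by simp [hF, hG, hX, hY, hZ, hW, hV, Definable.const]) fun _ _ => rfl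

theorem entry {q : Ctx → (ℕ → ℕ) → Query} (hq : DefinableQuery q) :
    DefinablePred fun c ρ => c.Entry (q c ρ) :=
  .eq (.tab hq) (.const 1)

end DefinableQuery

namespace DefinablePred

theorem linked (hX : Definable X) (hY : Definable Y) (hZ : Definable Z) (hW : Definable W) :
    DefinablePred fun c ρ => c.Linked (X c ρ) (Y c ρ) (Z c ρ) (W c ρ) :=
  (DefinableQuery.apart .patternSize hX hY hZ hW).entry.not

theorem exQuery {P : Ctx → (ℕ → ℕ) → Query → Prop}
    (hbit : DefinablePred fun c ρ => P c (fun i => ρ (i + 2)) (.bit (ρ 1) (ρ 0)))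
    (hcore : DefinablePred fun c ρ => P c (fun i => ρ (i + 2)) (.core (ρ 1) (ρ 0)))
    (hapart : DefinablePred fun c ρ =>
      P c (fun i => ρ (i + 5)) (.apart (ρ 4) (ρ 3) (ρ 2) (ρ 1) (ρ 0)))
    (halive : DefinablePred fun c ρ => P c (fun i => ρ (i + 3)) (.alive (ρ 2) (ρ 1) (ρ 0)))
    (hfound : DefinablePred fun c ρ =>
      P c (fun i => ρ (i + 7)) (.found (ρ 6) (ρ 5) (ρ 4) (ρ 3) (ρ 2) (ρ 1) (ρ 0))) :
    DefinablePred fun c ρ => ∃ q : Query, q.Fits c.B ∧ P c ρ q := by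
  simp only [Query.exists_fits_iff]
  exact .or (.ex (.ex hbit)) <| .or (.ex (.ex hcore)) <| .or (.ex (.ex (.ex (.ex (.ex hapart))))) <|
    .or (.ex (.ex (.ex halive))) (.ex (.ex (.ex (.ex (.ex (.ex (.ex hfound)))))))

end DefinablePred

namespace DefinableSet

theorem coreTable (hF : Definable F) : DefinableSet fun c ρ => c.coreTable (F c ρ) :=
  (Iio .bound fun _ _ => le_rfl).sep (DefinableQuery.core (hF.reindex _) (.var 0)).entry

theorem apartTable (hF : Definable F) (hX : Definable X) (hY : Definable Y) (hZ : Definable Z) :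
    DefinableSet fun c ρ => c.apartTable (F c ρ) (X c ρ) (Y c ρ) (Z c ρ) :=
  (Iio .bound fun _ _ => le_rfl).sep (DefinableQuery.apart (hF.reindex _) (hX.reindex _)
    (hY.reindex _) (hZ.reindex _) (.var 0)).entry

theorem aliveTable (hF : Definable F) (hG : Definable G) :
    DefinableSet fun c ρ => c.aliveTable (F c ρ) (G c ρ) :=
  (Iio .bound fun _ _ => le_rfl).sep
    (DefinableQuery.alive (hF.reindex _) (hG.reindex _) (.var 0)).entry

end DefinableSet

theorem DefinablePairs.tableBranchPairs : DefinablePairs fun c _ => c.tableBranchPairs :=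
  .branchPairs .host (.coreTable .hostSize)

theorem DefinableGraph.tableKept (hF : Definable F) :
    DefinableGraph fun c ρ => c.tableKept (F c ρ) :=
  .kept .host .tableBranchPairs (DefinableQuery.bit (.var 0) (hF.reindex _)).entry

namespace Definable

theorem tablePicked (hF : Definable F) (hG : Definable G) :
    Definable fun c ρ => c.tablePicked (F c ρ) (G c ρ) :=
  .sInf (.eligible (.tableKept hG) (.aliveTable hF hG))

theorem tableTarget (hF : Definable F) (hG : Definable G) :
    Definable fun c ρ => c.tableTarget (F c ρ) (G c ρ) :=
  .sInf_insert hostSize (fun c _ => c.hostSize_le)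
    (((DefinableGraph.tableKept hG).neighborSet (.tablePicked hF hG)).inter (.aliveTable hF hG))

theorem width : Definable fun c _ => c.width :=
  (DefinablePairs.tableBranchPairs.card).add ((finsetCard (.reps
    (.linked patternSize patternSize (.var 1) (.var 0)) patternSize
    fun c _ => c.patternSize_le)).add (.const 6))

end Definable

theorem DefinablePiece.tablePiece (hX : Definable X) (hY : Definable Y) (hZ : Definable Z)
    (hW : Definable W) :
    DefinablePiece fun c ρ => c.tablePiece (X c ρ) (Y c ρ) (Z c ρ) (W c ρ) where
  x := hX
  t := hY
  a := hZ
  dom := .decode (R := fun c ρ => c.Linked (X c ρ) (Y c ρ))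
    (D := fun c ρ i => c.Entry (.bit i (W c ρ)))
    (.linked (hX.reindex (· + 2)) (hY.reindex (· + 2)) (.var 1) (.var 0)) .patternSize
    (fun c _ => c.patternSize_le) (DefinableQuery.bit (.var 0) (hW.reindex (· + 1))).entry

namespace DefinablePred

theorem exFound (hF : Definable F) (hG : Definable G) (hX : Definable X)
    {Q : Ctx → (ℕ → ℕ) → Piece → Prop} (hQ : DefinablePred fun c ρ =>
      Q c (fun i => ρ (i + 4)) (c.tablePiece (ρ 3) (ρ 2) (ρ 1) (ρ 0))) :
    DefinablePred fun c ρ => ∃ P ∈ c.foundTable (F c ρ) (G c ρ) (X c ρ), Q c ρ P := by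
  have hentry := (DefinableQuery.found (hF.reindex (· + 4)) (hG.reindex (· + 4))
    (hX.reindex (· + 4)) (.var 3) (.var 2) (.var 1) (.var 0)).entry
  have hex : DefinablePred fun c ρ => ∃ x < c.B, ∃ t < c.B, ∃ a < c.B, ∃ m < c.B,
      c.Entry (.found (F c ρ) (G c ρ) (X c ρ) x t a m) ∧ Q c ρ (c.tablePiece x t a m) :=
    .ex (.ex (.ex (.ex (hentry.and hQ))))
  refine hex.congr fun c ρ => ⟨?_, ?_⟩
  · rintro ⟨x, hx, t, ht, a, ha, m, hm, hP, hQ⟩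
    exact ⟨_, ⟨x, hx, t, ht, a, ha, m, hm, hP, rfl⟩, hQ⟩
  · rintro ⟨_, ⟨x, hx, t, ht, a, ha, m, hm, hP, rfl⟩, hQ⟩
    exact ⟨x, hx, t, ht, a, ha, m, hm, hP, hQ⟩

theorem mem_foundTable (hF : Definable F) (hG : Definable G) (hX : Definable X)
    {P : Ctx → (ℕ → ℕ) → Piece} (hP : DefinablePiece P) :
    DefinablePred fun c ρ => P c ρ ∈ c.foundTable (F c ρ) (G c ρ) (X c ρ) :=
  (exFound (Q := fun c ρ P' => P c ρ = P') hF hG hX ((hP.reindex (· + 4)).eq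
    (.tablePiece (.var 3) (.var 2) (.var 1) (.var 0)))).congr fun c ρ => by simp

theorem stepBit (hF : Definable F) (hG : Definable G) :
    DefinablePred fun c ρ => c.Step (.bit (F c ρ) (G c ρ)) :=
  have hk : DefinableQuery fun c ρ => .bit (F c (fun i => ρ (i + 1)) - 1) (ρ 0) :=
    .bit ((hF.reindex _).sub (.const 1)) (.var 0)
  have hdouble : Definable fun _ ρ => ρ 0 + ρ 0 := .add (.var 0) (.var 0)
  .ite (DefinablePred.eq hF (.const 0)) (.ex (.eq (hG.reindex _) (hdouble.add (.const 1))))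
    (.ex (.and (.or (.eq (hG.reindex _) hdouble) (.eq (hG.reindex _) (hdouble.add (.const 1))))
      hk.entry))

theorem stepCore (hF : Definable F) (hG : Definable G) :
    DefinablePred fun c ρ => c.Step (.core (F c ρ) (G c ρ)) :=
  DefinableSet.mem (.ite (.eq hF (.const 0)) (.Iio .hostSize fun c _ => c.hostSize_le)
    (.peel .host (.coreTable (hF.sub (.const 1))))) hG

theorem stepApart (hF : Definable F) (hX : Definable X) (hY : Definable Y) (hZ : Definable Z)
    (hW : Definable W) :
    DefinablePred fun c ρ => c.Step (.apart (F c ρ) (X c ρ) (Y c ρ) (Z c ρ) (W c ρ)) :=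
  DefinableSet.mem (.ite (.eq hF (.const 0))
    ((DefinableSet.Iio .patternSize fun c _ => c.patternSize_le).sep (.ne (.var 0) (hZ.reindex _)))
    (.shrink (.residual .pattern hX hY) (.apartTable (hF.sub (.const 1)) hX hY hZ))) hW

theorem stepAlive (hF : Definable F) (hG : Definable G) (hX : Definable X) :
    DefinablePred fun c ρ => c.Step (.alive (F c ρ) (G c ρ) (X c ρ)) :=
  have hs := hF.sub (.const 1)
  DefinableSet.mem (.ite (.eq hF (.const 0)) (.Iio .hostSize fun c _ => c.hostSize_le)
    ((DefinableSet.aliveTable hs hG).sep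
      (.ne (.var 0) ((Definable.tablePicked hs hG).reindex _)))) hX

theorem advances {P : Ctx → (ℕ → ℕ) → Piece} (hF : Definable F) (hG : Definable G)
    (hX : Definable X) (hP : DefinablePiece P) :
    DefinablePred fun c ρ => Advances c.pattern c.host (c.tablePicked (F c ρ) (G c ρ))
      (c.tableTarget (F c ρ) (G c ρ)) (fun p P => P ∈ c.foundTable (F c ρ) (G c ρ) p)
      (X c ρ) (P c ρ) := by
  have hv := Definable.tablePicked hF hG
  have hw := Definable.tableTarget hF hG
  have hpiece (i : ℕ) := DefinablePiece.tablePiece (.var (i + 3)) (.var (i + 2)) (.var (i + 1))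
    (.var i)
  have hmerge := DefinablePiece.isMerge .pattern .host (hv.reindex (· + 8)) (hX.reindex (· + 8))
    (hpiece 4) (hpiece 0) (hP.reindex (· + 8))
  have hex : DefinablePred fun c ρ => ∃ P₁ ∈ c.foundTable (F c ρ) (G c ρ)
      (c.tablePicked (F c ρ) (G c ρ)), ∃ P₂ ∈ c.foundTable (F c ρ) (G c ρ) (X c ρ),
      Piece.IsMerge c.pattern c.host (c.tablePicked (F c ρ) (G c ρ)) (X c ρ) P₁ P₂ (P c ρ) :=
    exFound hF hG hv (Q := fun c ρ P₁ => ∃ P₂ ∈ c.foundTable (F c ρ) (G c ρ) (X c ρ),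
      Piece.IsMerge c.pattern c.host (c.tablePicked (F c ρ) (G c ρ)) (X c ρ) P₁ P₂ (P c ρ))
      (exFound (hF.reindex (· + 4)) (hG.reindex (· + 4)) (hX.reindex (· + 4))
        (Q := fun c ρ P₂ => Piece.IsMerge c.pattern c.host
          (c.tablePicked (F c fun i => ρ (i + 4)) (G c fun i => ρ (i + 4)))
          (X c fun i => ρ (i + 4)) (c.tablePiece (ρ 3) (ρ 2) (ρ 1) (ρ 0)) P₂
          (P c fun i => ρ (i + 4))) hmerge)
  exact (((DefinablePred.eq hX hw).and hex).or ((DefinablePred.ne hX hw).and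
    ((DefinablePred.ne hX hv).and (mem_foundTable hF hG hX hP)))).congr fun c ρ =>
      or_congr_left (and_congr_right fun _ => by grind)

theorem stepFound (hF : Definable F) (hG : Definable G) (hX : Definable X) (hY : Definable Y)
    (hZ : Definable Z) (hW : Definable W) (hV : Definable V) :
    DefinablePred fun c ρ =>
      c.Step (.found (F c ρ) (G c ρ) (X c ρ) (Y c ρ) (Z c ρ) (W c ρ) (V c ρ)) :=
  have hP := DefinablePiece.tablePiece hY hZ hW hV
  .and (hP.isValid .pattern .patternSize (fun c _ => c.patternSize_le) .hostSize)
    (.ite (.eq hF (.const 0)) (hP.isStart .hostSize hX)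
      (.advances (hF.sub (.const 1)) hG hX hP))

theorem rule : DefinablePred fun c ρ => c.Rule (ρ 0) :=
  exQuery
    (.and (.eq (.var 2) (DefinableQuery.bit (.var 1) (.var 0))) (.stepBit (.var 1) (.var 0)))
    (.and (.eq (.var 2) (DefinableQuery.core (.var 1) (.var 0))) (.stepCore (.var 1) (.var 0)))
    (.and (.eq (.var 5) (DefinableQuery.apart (.var 4) (.var 3) (.var 2) (.var 1) (.var 0)))
      (.stepApart (.var 4) (.var 3) (.var 2) (.var 1) (.var 0)))
    (.and (.eq (.var 3) (DefinableQuery.alive (.var 2) (.var 1) (.var 0)))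
      (.stepAlive (.var 2) (.var 1) (.var 0)))
    (.and (.eq (.var 7) (DefinableQuery.found (.var 6) (.var 5) (.var 4) (.var 3) (.var 2) (.var 1)
      (.var 0))) (.stepFound (.var 6) (.var 5) (.var 4) (.var 3) (.var 2) (.var 1) (.var 0)))

theorem tableAccepts : DefinablePred fun c _ => c.TableAccepts :=
  .ex (.exFound .hostSize (.var 0) .hostSize
    ((DefinableSet.Iio .patternSize fun c _ => c.patternSize_le).subset_of
      (DefinablePiece.tablePiece (.var 3) (.var 2) (.var 1) (.var 0)).dom))

end DefinablePred

end RAM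

namespace RAM.Ctx

open Set Elimination SubgraphIso
open scoped Finset

variable {c : Ctx} {n : ℕ}

theorem graphAt_support (o n : ℕ) : (c.graphAt o n).support ⊆ Iio n := by
  rintro u ⟨v, -, huv | huv⟩
  exacts [huv.1.1, huv.1.2]

theorem hostSize_lt (hB : 0 < c.B) : c.hostSize < c.B := (min_le_right _ _).trans_lt (by omega)

theorem patternSize_lt (hB : 0 < c.B) : c.patternSize < c.B :=
  (min_le_right _ _).trans_lt (by omega)

variable (c) in
/-- The host without the branch edges selected by the binary digits of `b`. -/
noncomputable def prunedHost (b : ℕ) : SimpleGraph ℕ :=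
  kept c.host (branchPairs c.host (core c.host) c.B) (b.testBit ·)

variable (c) in
/-- The piece that is represented by the numbers `x`, `t`, `a` and `m`. -/
def piece (x t a m : ℕ) : Piece :=
  ⟨x, t, a, decode (residual c.pattern x t).Reachable c.patternSize (m.testBit ·)⟩

variable (c) in
/-- The correct answer to a query. -/
def Holds : Query → Prop
  | .bit s m => m.testBit s
  | .core s v => v ∈ (peel c.host)^[s] (Iio c.hostSize)
  | .apart s x t y z => z ∈ (shrink (residual c.pattern x t))^[s] (Iio c.patternSize \ {y})
  | .alive s b v => v ∈ alive (c.prunedHost b) c.hostSize s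
  | .found s b p x t a m =>
      Found c.pattern c.host (c.prunedHost b) c.patternSize c.hostSize s p (c.piece x t a m)

variable (c) in
/-- All sets of branch edges and all domains of pieces are represented by numbers below the
bound. -/
structure IsWide : Prop where
  branchPairs : 2 ^ #(branchPairs c.host (core c.host) c.B) ≤ c.B
  reps (x t : ℕ) : 2 ^ #(reps (residual c.pattern x t).Reachable c.patternSize) ≤ c.B

variable (c) in
/-- The table answers the queries of level below `n`. The elimination and the dynamic programme
refer to sets of branch edges and to pieces by number and need a wide bound. -/
def CorrectBelow (n : ℕ) : Prop := ∀ q : Query, q.Fits c.B → (q.tag < 3 ∨ c.IsWide) →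
  q.level c.B < n → (c.Entry q ↔ c.Holds q)

theorem sep_Iio_eq {P : ℕ → Prop} {S : Set ℕ} {B : ℕ} (hS : S ⊆ Iio B)
    (hP : ∀ v < B, P v ↔ v ∈ S) : {v ∈ Iio B | P v} = S :=
  Set.ext fun v => ⟨fun hv => (hP v hv.1).1 hv.2, fun hv => ⟨hS hv, (hP v (hS hv)).2 hv⟩⟩

namespace CorrectBelow

theorem entry_bit (hc : c.CorrectBelow n) {i m : ℕ} (hi : i < c.B) (hm : m < c.B) (hn : i < n) :
    c.Entry (.bit i m) ↔ m.testBit i :=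
  hc (.bit i m) ⟨hi, by simp [Query.args, hm]⟩ (.inl (by simp [Query.tag]))
    (by simpa [Query.level, Query.round, Query.tag])

theorem coreTable_eq (hc : c.CorrectBelow n) {s : ℕ} (hs : s < c.B) (hn : s + c.B < n) :
    c.coreTable s = (peel c.host)^[s] (Iio c.hostSize) :=
  sep_Iio_eq ((iterate_subset peel_subset s _).trans (Iio_subset_Iio c.hostSize_le)) fun v hv =>
    hc (.core s v) ⟨hs, by simp [Query.args, hv]⟩ (.inl (by simp [Query.tag]))
      (by simpa [Query.level, Query.round, Query.tag])

theorem apartTable_eq (hc : c.CorrectBelow n) {s x t y : ℕ} (hs : s < c.B) (hx : x < c.B)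
    (ht : t < c.B) (hy : y < c.B) (hn : s + c.B * 2 < n) : c.apartTable s x t y =
      (shrink (residual c.pattern x t))^[s] (Iio c.patternSize \ {y}) :=
  sep_Iio_eq ((iterate_subset (fun _ => sep_subset _ _) s _).trans
    (sdiff_subset.trans (Iio_subset_Iio c.patternSize_le))) fun z hz =>
      hc (.apart s x t y z) ⟨hs, by simp [Query.args, *]⟩ (.inl (by simp [Query.tag]))
        (by simpa [Query.level, Query.round, Query.tag])

theorem coreTable_hostSize_eq (hc : c.CorrectBelow n) (hB : 0 < c.B) (hn : c.B * 2 ≤ n) :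
    c.coreTable c.hostSize = core c.host := by
  have hlt := hostSize_lt hB
  rw [hc.coreTable_eq hlt (by omega), iterate_peel_eq_core (finite_Iio _) (ncard_Iio_nat _).le]
  exact core_subset_support.trans (graphAt_support _ _)

theorem linked_iff (hc : c.CorrectBelow n) (hB : 0 < c.B) (hn : c.B * 3 ≤ n) {x t y z : ℕ}
    (hx : x < c.B) (ht : t < c.B) (hy : y < c.patternSize) (hz : z < c.patternSize) :
    c.Linked x t y z ↔ (residual c.pattern x t).Reachable y z := by
  have hlt := patternSize_lt hB
  have hsupp : (residual c.pattern x t).support ⊆ Iio c.patternSize := fun u ⟨v, huv⟩ =>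
    graphAt_support _ _ ⟨v, (residual_adj.1 huv).1⟩
  have hmem := congrArg (z ∈ ·) (hc.apartTable_eq hlt hx ht (hy.trans hlt) (by omega))
  rw [iterate_shrink_eq hsupp] at hmem
  have := (hmem.to_iff.symm.trans (and_iff_right (hz.trans hlt))).symm.trans (and_iff_right hz)
  rw [Linked, this, not_not]

theorem tableBranchPairs_eq (hc : c.CorrectBelow n) (hB : 0 < c.B) (hn : c.B * 2 ≤ n) :
    c.tableBranchPairs = branchPairs c.host (core c.host) c.B := by
  rw [tableBranchPairs, hc.coreTable_hostSize_eq hB hn]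

theorem width_eq (hc : c.CorrectBelow n) (hB : 0 < c.B) (hn : c.B * 3 ≤ n) :
    c.width = #(branchPairs c.host (core c.host) c.B) +
      (#(reps c.pattern.Reachable c.patternSize) + 6) := by
  have hlt := patternSize_lt hB
  have hres : residual c.pattern c.patternSize c.patternSize = c.pattern := by
    ext y z
    refine residual_adj.trans (and_iff_left_of_imp fun hyz => ?_)
    have hy : y < c.patternSize := graphAt_support _ _ ⟨z, hyz⟩
    have hz : z < c.patternSize := graphAt_support _ _ ⟨y, hyz.symm⟩
    exact ⟨⟨hy.ne, hz.ne⟩, hy.ne, hz.ne⟩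
  rw [width, hc.tableBranchPairs_eq hB (by omega),
    reps_congr fun y hy z hz => hc.linked_iff hB hn hlt hlt hy hz, hres]

theorem tableKept_eq (hc : c.CorrectBelow n) (hwide : c.IsWide) (hB : 0 < c.B)
    (hn : c.B * 2 ≤ n) {b : ℕ} (hb : b < c.B) : c.tableKept b = c.prunedHost b := by
  rw [tableKept, hc.tableBranchPairs_eq hB hn]
  refine kept_congr fun i hi => ?_
  have hiB := (hi.trans Nat.lt_two_pow_self).trans_le hwide.branchPairs
  exact hc.entry_bit hiB hb (by omega)

theorem aliveTable_eq (hc : c.CorrectBelow n) (hwide : c.IsWide) {s b : ℕ} (hs : s < c.B)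
    (hb : b < c.B) (hn : s + c.B * 3 < n) :
    c.aliveTable s b = alive (c.prunedHost b) c.hostSize s :=
  sep_Iio_eq (alive_subset.trans (Iio_subset_Iio c.hostSize_le)) fun v hv =>
    hc (.alive s b v) ⟨hs, by simp [Query.args, *]⟩ (.inr hwide)
      (by simpa [Query.level, Query.round, Query.tag])

theorem tablePicked_eq (hc : c.CorrectBelow n) (hwide : c.IsWide) {s b : ℕ} (hs : s < c.B)
    (hb : b < c.B) (hn : s + c.B * 3 < n) :
    c.tablePicked s b = picked (c.prunedHost b) c.hostSize s := by
  rw [tablePicked, picked, hc.tableKept_eq hwide (by omega) (by omega) hb,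
    hc.aliveTable_eq hwide hs hb hn]

theorem tableTarget_eq (hc : c.CorrectBelow n) (hwide : c.IsWide) {s b : ℕ} (hs : s < c.B)
    (hb : b < c.B) (hn : s + c.B * 3 < n) :
    c.tableTarget s b = target (c.prunedHost b) c.hostSize s := by
  rw [tableTarget, target, hc.tableKept_eq hwide (by omega) (by omega) hb,
    hc.aliveTable_eq hwide hs hb hn, hc.tablePicked_eq hwide hs hb hn]

theorem tablePiece_eq (hc : c.CorrectBelow n) (hwide : c.IsWide) (hn : c.B * 3 ≤ n)
    {x t a m : ℕ} (hx : x < c.B) (ht : t < c.B) (hm : m < c.B) :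
    c.tablePiece x t a m = c.piece x t a m := by
  refine congrArg (Piece.mk x t a) (decode_congr (fun y hy z hz => ?_) fun i hi => ?_)
  · exact hc.linked_iff (by omega) hn hx ht hy hz
  · have hiB := (hi.trans Nat.lt_two_pow_self).trans_le (hwide.reps x t)
    exact hc.entry_bit hiB hm (by omega)

end CorrectBelow

theorem exists_piece_eq (hwide : c.IsWide) (hB : 0 < c.B) {P : Piece}
    (hP : P.IsValid c.pattern c.patternSize c.hostSize) :
    ∃ x < c.B, ∃ t < c.B, ∃ a < c.B, ∃ m < c.B, c.piece x t a m = P := by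
  obtain ⟨m, hm, hdom⟩ := exists_decode_eq hP.subset hP.isClosed
  have hh := patternSize_lt hB
  have hg := hostSize_lt hB
  exact ⟨P.x, hP.le.1.trans_lt hh, P.t, hP.le.2.1.trans_lt hh, P.a, hP.le.2.2.trans_lt hg, m,
    hm.trans_le (hwide.reps _ _), by rw [piece, hdom]⟩

theorem CorrectBelow.foundTable_eq (hc : c.CorrectBelow n) (hwide : c.IsWide) {s b p : ℕ}
    (hs : s < c.B) (hb : b < c.B) (hp : p < c.B) (hn : s + c.B * 4 < n) : c.foundTable s b p =
      {P | Found c.pattern c.host (c.prunedHost b) c.patternSize c.hostSize s p P} := by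
  have hentry {x t a m : ℕ} (hx : x < c.B) (ht : t < c.B) (ha : a < c.B) (hm : m < c.B) :=
    hc (.found s b p x t a m) ⟨hs, by simp [Query.args, *]⟩ (.inr hwide)
      (by simpa [Query.level, Query.round, Query.tag])
  have hpiece {x t a m : ℕ} (hx : x < c.B) (ht : t < c.B) (hm : m < c.B) :
      c.tablePiece x t a m = c.piece x t a m := hc.tablePiece_eq hwide (by omega) hx ht hm
  refine subset_antisymm ?_ fun P hP => ?_
  · rintro _ ⟨x, hx, t, ht, a, ha, m, hm, hE, rfl⟩
    rw [hpiece hx ht hm]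
    exact (hentry hx ht ha hm).1 hE
  · have hvalid : P.IsValid c.pattern c.patternSize c.hostSize := by
      cases s with
      | zero => exact hP.1
      | succ => exact hP.1
    obtain ⟨x, hx, t, ht, a, ha, m, hm, rfl⟩ := exists_piece_eq hwide (by omega) hvalid
    exact ⟨x, hx, t, ht, a, ha, m, hm, (hentry hx ht ha hm).2 hP, (hpiece hx ht hm).symm⟩

theorem step_bit_iff {s m : ℕ} (hq : (Query.bit s m).Fits c.B)
    (hc : c.CorrectBelow ((Query.bit s m).level c.B)) : c.Step (.bit s m) ↔ c.Holds (.bit s m) := by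
  obtain ⟨hs : s < c.B, hm⟩ := hq
  replace hm : m < c.B := hm m (by simp [Query.args])
  cases s with
  | zero =>
    simp only [Step, Holds, if_pos, Nat.testBit_zero, decide_eq_true_eq]
    exact ⟨fun ⟨k, _, h⟩ => by omega, fun h => ⟨m / 2, by omega, by omega⟩⟩
  | succ s =>
    have hentry {k : ℕ} (hk : k < c.B) : c.Entry (.bit s k) ↔ k.testBit s :=
      hc.entry_bit (by omega) hk (by simp [Query.level, Query.round, Query.tag])
    simp only [Step, Holds, Nat.succ_ne_zero, if_false, Nat.add_sub_cancel, Nat.testBit_succ]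
    constructor
    · rintro ⟨k, hk, hmk, hE⟩
      rw [show m / 2 = k by omega]
      exact (hentry hk).1 hE
    · exact fun h => ⟨m / 2, by omega, by omega, (hentry (by omega)).2 h⟩

theorem step_core_iff {s v : ℕ} (hq : (Query.core s v).Fits c.B)
    (hc : c.CorrectBelow ((Query.core s v).level c.B)) :
    c.Step (.core s v) ↔ c.Holds (.core s v) := by
  obtain ⟨hs : s < c.B, -⟩ := hq
  cases s with
  | zero => rfl
  | succ s =>
    simp only [Step, Holds, Nat.succ_ne_zero, if_false, Nat.add_sub_cancel,
      Function.iterate_succ_apply']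
    rw [hc.coreTable_eq (by omega) (by simp [Query.level, Query.round, Query.tag])]

theorem step_apart_iff {s x t y z : ℕ} (hq : (Query.apart s x t y z).Fits c.B)
    (hc : c.CorrectBelow ((Query.apart s x t y z).level c.B)) :
    c.Step (.apart s x t y z) ↔ c.Holds (.apart s x t y z) := by
  obtain ⟨hs : s < c.B, hargs⟩ := hq
  simp only [Query.args, List.forall_mem_cons] at hargs
  obtain ⟨hx, ht, hy, -⟩ := hargs
  cases s with
  | zero => rfl
  | succ s =>
    simp only [Step, Holds, Nat.succ_ne_zero, if_false, Nat.add_sub_cancel,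
      Function.iterate_succ_apply']
    rw [hc.apartTable_eq (by omega) hx ht hy (by simp [Query.level, Query.round, Query.tag])]

theorem step_alive_iff (hwide : c.IsWide) {s b v : ℕ} (hq : (Query.alive s b v).Fits c.B)
    (hc : c.CorrectBelow ((Query.alive s b v).level c.B)) :
    c.Step (.alive s b v) ↔ c.Holds (.alive s b v) := by
  obtain ⟨hs : s < c.B, hargs⟩ := hq
  have hb : b < c.B := hargs b (by simp [Query.args])
  cases s with
  | zero => rfl
  | succ s =>
    have hn : s + c.B * 3 < (Query.alive (s + 1) b v).level c.B := by
      simp [Query.level, Query.round, Query.tag]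
    simp only [Step, Holds, Nat.succ_ne_zero, if_false, Nat.add_sub_cancel, alive_succ]
    rw [hc.aliveTable_eq hwide (by omega) hb hn, hc.tablePicked_eq hwide (by omega) hb hn]

theorem step_found_iff (hwide : c.IsWide) {s b p x t a m : ℕ}
    (hq : (Query.found s b p x t a m).Fits c.B)
    (hc : c.CorrectBelow ((Query.found s b p x t a m).level c.B)) :
    c.Step (.found s b p x t a m) ↔ c.Holds (.found s b p x t a m) := by
  obtain ⟨hs : s < c.B, hargs⟩ := hq
  simp only [Query.args, List.forall_mem_cons] at hargs
  obtain ⟨hb, hp, hx, ht, -, hm, -⟩ := hargs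
  have hn : s + c.B * 4 ≤ (Query.found s b p x t a m).level c.B := by
    simp [Query.level, Query.round, Query.tag]
  rw [Step, hc.tablePiece_eq hwide (by omega) hx ht hm]
  cases s with
  | zero => rfl
  | succ s =>
    have hs' : s < c.B := by omega
    have hpicked : picked (c.prunedHost b) c.hostSize s < c.B := by
      rcases (eligible (c.prunedHost b) (alive (c.prunedHost b) c.hostSize s)).eq_empty_or_nonempty
        with h | h
      · rw [picked, h, Nat.sInf_empty]
        omega
      · exact (alive_subset (Nat.sInf_mem h).1).trans_le c.hostSize_le
    simp only [Holds, Found, Nat.succ_ne_zero, if_false, Nat.add_sub_cancel, Advances]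
    rw [hc.tablePicked_eq hwide hs' hb (by omega), hc.tableTarget_eq hwide hs' hb (by omega),
      hc.foundTable_eq hwide hs' hb hp (by omega),
      hc.foundTable_eq hwide hs' hb hpicked (by omega)]
    rfl

theorem step_iff {q : Query} (hq : q.Fits c.B) (hwide : q.tag < 3 ∨ c.IsWide)
    (hc : c.CorrectBelow (q.level c.B)) : c.Step q ↔ c.Holds q := by
  cases q with
  | bit => exact step_bit_iff hq hc
  | core => exact step_core_iff hq hc
  | apart => exact step_apart_iff hq hc
  | alive => exact step_alive_iff (hwide.resolve_left (by simp [Query.tag])) hq hc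
  | found => exact step_found_iff (hwide.resolve_left (by simp [Query.tag])) hq hc

/-- The rule for an entry is evaluated on a table of which only the part below that entry has been
filled; this suffices as queries refer to smaller addresses only. -/
theorem correctBelow_of_filled (hB : 5 ≤ c.B) (hfill : Filled Rule (c.B ^ 8) c) (n : ℕ) :
    c.CorrectBelow n := by
  suffices h : ∀ a, ∀ q : Query, q.Fits c.B → (q.tag < 3 ∨ c.IsWide) → q.addr c.B = a →
      (c.Entry q ↔ c.Holds q) from fun q hq hwide _ => h _ q hq hwide rfl
  intro a
  induction a using Nat.strong_induction_on with
  | _ a ih =>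
    rintro q hq hwide rfl
    obtain ⟨T, hT, hrule⟩ := hfill _ (Query.addr_lt hq hB)
    set c' : Ctx := ⟨c.inp, T, c.B⟩
    have hwide_iff : c'.IsWide ↔ c.IsWide := ⟨fun h => ⟨h.1, h.2⟩, fun h => ⟨h.1, h.2⟩⟩
    have hc' : c'.CorrectBelow (q.level c.B) := fun q' hq' hwide' hlt => by
      have haddr := Query.addr_lt_addr hq' hB hlt
      exact (congrArg (· = 1) (hT _ haddr)).to_iff.trans
        (ih _ haddr q' hq' (hwide'.imp_right hwide_iff.1) rfl)
    have hrule_iff : c'.Rule (q.addr c.B) ↔ c.Holds q := by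
      refine Iff.trans ⟨?_, fun h => ⟨q, hq, rfl, h⟩⟩
        (step_iff (c := c') hq (hwide.imp_right hwide_iff.2) hc')
      rintro ⟨q', hq', haddr, hstep⟩
      rwa [(Query.addr_inj hq hq' hB).1 haddr]
    rw [Entry, hrule, ← hrule_iff]
    split_ifs with h <;> simp [h]

theorem tableAccepts_iff (hB : 5 ≤ c.B) (hfill : Filled Rule (c.B ^ 8) c) (hwide : c.IsWide) :
    c.TableAccepts ↔ ∃ b < c.B,
      Accepts c.pattern c.host (c.prunedHost b) c.patternSize c.hostSize := by
  have hlt := hostSize_lt (c := c) (by omega)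
  refine exists_congr fun b => and_congr_right fun hb => ?_
  rw [(correctBelow_of_filled hB hfill _).foundTable_eq hwide hlt hb hlt (Nat.lt_succ_self _)]
  rfl

end RAM.Ctx

namespace SubgraphIso

open Elimination Set
open scoped Finset

theorem getD_flatMap_finRange {n k : ℕ} (f : Fin n → Fin k → ℕ) (u : Fin n) (v : Fin k) :
    ((List.finRange n).flatMap fun i => (List.finRange k).map (f i)).getD (u * k + v) 0 =
      f u v := by
  induction n with
  | zero => exact u.elim0
  | succ n ih =>
    rw [List.finRange_succ, List.flatMap_cons, List.flatMap_map]
    refine Fin.cases ?_ (fun u => ?_) u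
    · rw [List.getD_append _ _ _ _ (by simp)]
      simp
    · have hindex : (u.succ : ℕ) * k + v = k + (u * k + v) := by rw [Fin.val_succ]; ring
      rw [hindex, List.getD_append_right _ _ _ _ (by simp)]
      simpa using ih (fun i => f i.succ) u

theorem length_adjList {n : ℕ} (G : SimpleGraph (Fin n)) : (adjList G).length = n * n := by
  simp [adjList]

theorem getD_adjList {n : ℕ} (G : SimpleGraph (Fin n)) (u v : Fin n) :
    (adjList G).getD (u * n + v) 0 ≠ 0 ↔ G.Adj u v := by
  rw [adjList, getD_flatMap_finRange]
  simp

section Parameters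

variable {V W : Type*} [Fintype V] {G : SimpleGraph V}

theorem exists_card_eq_fvs (G : SimpleGraph V) :
    ∃ S : Finset V, #S = fvs G ∧ (G.induce {v | v ∉ S}).IsAcyclic :=
  Nat.sInf_mem (s := {k | ∃ S : Finset V, #S = k ∧ (G.induce {v | v ∉ S}).IsAcyclic})
    ⟨_, Finset.univ, rfl, fun v => absurd (Finset.mem_univ v.1) v.2⟩

theorem encard_neighborSet_map_le (f : V ↪ W) (w : W) :
    ((G.map f).neighborSet w).encard ≤ maxDeg G := by
  classical
  by_cases hw : w ∈ range f
  · obtain ⟨v, rfl⟩ := hw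
    rw [SimpleGraph.neighborSet_map, f.injective.encard_image, ← G.coe_neighborFinset v,
      encard_coe_eq_coe_finsetCard, G.card_neighborFinset_eq_degree]
    exact_mod_cast (G.degree_le_maxDegree v).trans_eq (by unfold maxDeg; congr!)
  · have hempty : (G.map f).neighborSet w = ∅ := eq_empty_of_forall_notMem fun u hu =>
      let ⟨v, _, _, hv, _⟩ := (SimpleGraph.map_adj f G w u).1 hu
      hw ⟨v, hv⟩
    simp [hempty]

theorem encard_branchEdges_map_le (f : V ↪ W) :
    (branchEdges (G.map f) (core (G.map f))).encard ≤ 6 * (maxDeg G * fvs G) := by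
  obtain ⟨S, hcard, hacyc⟩ := exists_card_eq_fvs G
  have hrange : core (G.map f) ⊆ range f := core_subset_support.trans <| by
    rw [SimpleGraph.support_map]
    exact image_subset_range ..
  have hpre (w : ↥(core (G.map f) \ (S.map f : Finset W))) :
      ∃ v : {v | v ∉ S}, f v = w := by
    obtain ⟨v, hv⟩ := hrange w.2.1
    exact ⟨⟨v, fun hS => w.2.2 (by simp [← hv, hS])⟩, hv⟩
  choose r hr using hpre
  have hadj {w w'} (hww' : (G.map f).Adj w.1 w'.1) : G.Adj (r w) (r w') :=
    SimpleGraph.map_adj_apply.1 ((hr w).symm ▸ (hr w').symm ▸ hww')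
  have hforest : ((G.map f).induce (core (G.map f) \ (S.map f : Finset W))).IsAcyclic :=
    hacyc.comap ⟨r, fun hww' => hadj hww'⟩ fun w w' h => Subtype.ext <|
      (hr w).symm.trans ((congrArg (f ∘ Subtype.val) h).trans (hr w'))
  simpa [hcard] using encard_branchEdges_le ((finite_range f).subset hrange)
    (encard_neighborSet_map_le f) (S.map f) hforest

end Parameters

variable {h g : ℕ} {H : SimpleGraph (Fin h)} {G : SimpleGraph (Fin g)}

theorem support_map_val_subset (G : SimpleGraph (Fin g)) :
    (G.map Fin.valEmbedding).support ⊆ Iio g := by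
  rw [SimpleGraph.support_map]
  rintro _ ⟨v, -, rfl⟩
  exact v.2

theorem exists_hom_of_accepts {A : SimpleGraph ℕ}
    (hacc : Accepts (H.map Fin.valEmbedding) (G.map Fin.valEmbedding) A h g) :
    ∃ η : H →g G, Function.Injective η := by
  obtain ⟨η, hmaps, hinj, hadj⟩ := hacc.exists_embedding
  refine ⟨⟨fun y => ⟨η y, hmaps y.2⟩, fun {y z} hyz => ?_⟩, fun y z hyz => ?_⟩
  · exact SimpleGraph.map_adj_apply.1
      (hadj y y.2 z z.2 ((SimpleGraph.map_adj_apply (f := Fin.valEmbedding)).2 hyz))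
  · exact Fin.ext (hinj y.2 z.2 (congrArg Fin.val hyz))

/-- The branch edges outside the image of an embedding may be deleted, and afterwards the cycles of
the host are disjoint. -/
theorem exists_accepts_kept (hH : maxDeg H ≤ 2) {η : H →g G} (hη : Function.Injective η) {n : ℕ}
    (hn : g ≤ n) :
    let G' := G.map Fin.valEmbedding
    let pairs := branchPairs G' (core G') n
    ∃ b < 2 ^ #pairs, Accepts (H.map Fin.valEmbedding) G' (kept G' pairs (b.testBit ·)) h g := by
  intro G' pairs
  set F : SimpleGraph ℕ := H.map (Function.Embedding.trans ⟨η, hη⟩ Fin.valEmbedding)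
  have hF (v : ℕ) : (F.neighborSet v).encard ≤ 2 :=
    (encard_neighborSet_map_le _ v).trans (by exact_mod_cast hH)
  obtain ⟨b, hb, hkept⟩ := exists_kept_eq ((support_map_val_subset G).trans (Iio_subset_Iio hn))
    (sdiff_subset : branchEdges G' (core G') \ F.edgeSet ⊆ _)
  refine ⟨b, hb, hkept ▸ ?_⟩
  set ζ : ℕ → ℕ := Function.extend Fin.val (fun y => (η y : ℕ)) id
  have hζ (y : Fin h) : ζ y = η y := Fin.val_injective.extend_apply _ _ y
  have hle := G'.deleteEdges_le (branchEdges G' (core G') \ F.edgeSet)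
  refine accepts_of_embedding (η := ζ)
    ((SimpleGraph.support_mono hle).trans (support_map_val_subset G))
    (hasOnlyDisjointCycles_deleteEdges hF) hle (support_map_val_subset H) ?_ ?_ ?_
  · intro y hy z hz hyz
    rw [hζ ⟨y, hy⟩, hζ ⟨z, hz⟩] at hyz
    exact congrArg Fin.val (hη (Fin.ext hyz))
  · intro y z hyz
    obtain ⟨y, z, hadj, rfl, rfl⟩ := (SimpleGraph.map_adj ..).1 hyz
    rw [Fin.valEmbedding_apply, Fin.valEmbedding_apply, hζ, hζ]
    refine SimpleGraph.deleteEdges_adj.2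
      ⟨(SimpleGraph.map_adj_apply (f := Fin.valEmbedding)).2 (η.map_adj hadj), fun he => ?_⟩
    exact he.2 ((SimpleGraph.map_adj ..).2 ⟨y, z, hadj, rfl, rfl⟩)
  · intro y hy
    rw [hζ ⟨y, hy⟩]
    exact (η _).2

end SubgraphIso

namespace RAM.Ctx

open Elimination SubgraphIso Set
open scoped Finset

variable {c : Ctx} {h g : ℕ} {H : SimpleGraph (Fin h)} {G : SimpleGraph (Fin g)}

theorem graphAt_eq_map {o : ℕ}
    (hinp : ∀ i < g * g, c.inp.getD (o + i) 0 = (adjList G).getD i 0) :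
    c.graphAt o g = G.map Fin.valEmbedding := by
  have hentry (u v : Fin g) : c.inp.getD (o + (u * g + v)) 0 ≠ 0 ↔ G.Adj u v := by
    rw [hinp _ (by nlinarith [u.2, v.2]), getD_adjList]
  ext u v
  rw [graphAt, SimpleGraph.fromRel_adj, SimpleGraph.map_adj]
  constructor
  · rintro ⟨-, ⟨⟨hu, hv⟩, huv⟩ | ⟨⟨hv, hu⟩, hvu⟩⟩
    · exact ⟨⟨u, hu⟩, ⟨v, hv⟩, (hentry ⟨u, hu⟩ ⟨v, hv⟩).1 huv, rfl, rfl⟩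
    · exact ⟨⟨u, hu⟩, ⟨v, hv⟩, ((hentry ⟨v, hv⟩ ⟨u, hu⟩).1 hvu).symm, rfl, rfl⟩
  · rintro ⟨u, v, huv, rfl, rfl⟩
    exact ⟨fun h => huv.ne (Fin.ext h), .inl ⟨⟨u.2, v.2⟩, (hentry u v).2 huv⟩⟩

variable (c H G) in
/-- The input is the encoding of `(H, G)`, and the bound is as large as in the algorithm. -/
structure Represents : Prop where
  inp : c.inp = encode H G
  le : h + g + 10 ≤ c.B

namespace Represents

theorem patternSize_eq (hc : c.Represents H G) : c.patternSize = h := by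
  have := hc.le
  rw [patternSize, hc.inp]
  exact min_eq_left (by simp only [encode, List.getD_cons_zero]; omega)

theorem hostSize_eq (hc : c.Represents H G) : c.hostSize = g := by
  have := hc.le
  rw [hostSize, hc.inp]
  exact min_eq_left (by simp only [encode, List.getD_cons_zero, List.getD_cons_succ]; omega)

theorem pattern_eq (hc : c.Represents H G) : c.pattern = H.map Fin.valEmbedding := by
  rw [pattern, hc.patternSize_eq]
  refine graphAt_eq_map fun i hi => ?_
  rw [hc.inp, encode, show 2 + i = i + 1 + 1 by ring, List.getD_cons_succ, List.getD_cons_succ,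
    List.getD_append _ _ _ _ (by rwa [length_adjList])]

theorem host_eq (hc : c.Represents H G) : c.host = G.map Fin.valEmbedding := by
  rw [host, hc.patternSize_eq, hc.hostSize_eq]
  refine graphAt_eq_map fun i _ => ?_
  rw [hc.inp, encode, show 2 + h * h + i = h * h + i + 1 + 1 by ring, List.getD_cons_succ,
    List.getD_cons_succ, List.getD_append_right _ _ _ _ (by rw [length_adjList]; omega),
    length_adjList, Nat.add_sub_cancel_left]

theorem card_branchPairs (hc : c.Represents H G) :
    (#(branchPairs c.host (core c.host) c.B) : ℕ∞) =
      (branchEdges (G.map Fin.valEmbedding) (core (G.map Fin.valEmbedding))).encard := by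
  have := hc.le
  rw [hc.host_eq, card_branchPairs_eq_encard]
  exact (support_map_val_subset G).trans (Iio_subset_Iio (by omega))

theorem width_le (hc : c.Represents H G) (hfill : Filled Rule (c.B ^ 8) c) :
    c.width ≤ 6 * (maxDeg G * fvs G) + (cc H + 6) := by
  have := hc.le
  rw [(correctBelow_of_filled (by omega) hfill _).width_eq (by omega) le_rfl, hc.pattern_eq,
    hc.patternSize_eq]
  gcongr
  · exact_mod_cast hc.card_branchPairs.trans_le (encard_branchEdges_map_le _)
  · exact card_reps_map_le_cc H

theorem isWide {c' : Ctx} (hc : c.Represents H G) (hfill : Filled Rule (c.B ^ 8) c)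
    (hc' : c'.Represents H G) (hle : 2 ^ c.width ≤ c'.B) (hH : maxDeg H ≤ 2) : c'.IsWide := by
  have := hc.le
  have hwidth := (correctBelow_of_filled (by omega) hfill _).width_eq (by omega) le_rfl
  refine ⟨(Nat.pow_le_pow_right two_pos ?_).trans hle,
    fun x t => (Nat.pow_le_pow_right two_pos ?_).trans hle⟩
  · have hcard : #(branchPairs c'.host (core c'.host) c'.B) =
        #(branchPairs c.host (core c.host) c.B) := by
      exact_mod_cast hc'.card_branchPairs.trans hc.card_branchPairs.symm
    omega
  · rw [hwidth, hc.pattern_eq, hc.patternSize_eq, hc'.pattern_eq, hc'.patternSize_eq]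
    have hdeg (v : ℕ) : ((H.map Fin.valEmbedding).neighborSet v).encard ≤ 2 :=
      (encard_neighborSet_map_le _ v).trans (by exact_mod_cast hH)
    exact (card_reps_residual_le hdeg x t).trans (Nat.le_add_left _ _)

theorem tableAccepts_iff_exists_hom (hc : c.Represents H G) (hfill : Filled Rule (c.B ^ 8) c)
    (hwide : c.IsWide) (hH : maxDeg H ≤ 2) :
    c.TableAccepts ↔ ∃ η : H →g G, Function.Injective η := by
  have := hc.le
  have hpow := hwide.branchPairs
  rw [tableAccepts_iff (by omega) hfill hwide]
  simp only [prunedHost, hc.pattern_eq, hc.host_eq, hc.patternSize_eq, hc.hostSize_eq] at hpow ⊢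
  refine ⟨fun ⟨_, _, hacc⟩ => exists_hom_of_accepts hacc, fun ⟨η, hη⟩ => ?_⟩
  obtain ⟨b, hb, hacc⟩ := exists_accepts_kept hH hη (n := c.B) (by omega)
  exact ⟨b, hb.trans_le hpow, hacc⟩

end Represents

end RAM.Ctx

namespace SubgraphIso

/-- The factor in the running time that depends on the parameters. -/
def timeFactor (K D : ℕ) (p : ℕ × ℕ × ℕ) : ℕ :=
  K * (5 * 2 ^ (6 * (p.1 * p.2.1) + (p.2.2 + 6))) ^ D

theorem computable_timeFactor (K D : ℕ) : Computable (timeFactor K D) := by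
  have hpow : Primrec₂ fun a b : ℕ => a ^ b := Primrec₂.unpaired'.1 Nat.Primrec.pow
  have hproduct : Primrec fun p : ℕ × ℕ × ℕ => 6 * (p.1 * p.2.1) :=
    Primrec.nat_mul.comp (.const 6) (Primrec.nat_mul.comp .fst (Primrec.fst.comp .snd))
  have hexponent : Primrec fun p : ℕ × ℕ × ℕ => 6 * (p.1 * p.2.1) + (p.2.2 + 6) :=
    Primrec.nat_add.comp hproduct
      (Primrec.nat_add.comp (Primrec.snd.comp .snd) (.const 6))
  exact (Primrec.nat_mul.comp (.const K) (hpow.comp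
    (Primrec.nat_mul.comp (.const 5) (hpow.comp (.const 2) hexponent)) (.const D))).to_comp

theorem add_add_ten_le_length_encode {h g : ℕ} (H : SimpleGraph (Fin h))
    (G : SimpleGraph (Fin g)) : h + g + 10 ≤ 5 * (encode H G).length := by
  simp only [encode, List.length_cons, List.length_append, length_adjList]
  have hh : h ≤ h * h := Nat.le_mul_self h
  have hg : g ≤ g * g := Nat.le_mul_self g
  omega

end SubgraphIso

open RAM SubgraphIso in
theorem mainTheorem8 :
    ∃ (p : RAM.Program) (f : ℕ × ℕ × ℕ → ℕ) (c : ℕ), Computable f ∧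
      ∀ (h g : ℕ) (H : SimpleGraph (Fin h)) (G : SimpleGraph (Fin g)),
        SubgraphIso.maxDeg H ≤ 2 →
          ∃ t : ℕ,
            t ≤ f (SubgraphIso.maxDeg G, SubgraphIso.fvs G, SubgraphIso.cc H) *
                (SubgraphIso.encode H G).length ^ c ∧
              RAM.Answers p (SubgraphIso.encode H G) t
                (∃ η : H →g G, Function.Injective η) := by
  obtain ⟨p, K, D, hp⟩ := exists_program DefinablePred.rule 8 Definable.width
    DefinablePred.tableAccepts
  refine ⟨p, timeFactor K D, D, computable_timeFactor K D, fun h g H G hH => ?_⟩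
  obtain ⟨c, c', hinp, hB, hfill, hinp', hB', hfill', t, ht, hanswers⟩ := hp (encode H G)
  have hc : c.Represents H G := ⟨hinp, hB.ge⟩
  have hc' : c'.Represents H G :=
    ⟨hinp', hB' ▸ hB.ge.trans (Nat.le_mul_of_pos_right _ (by positivity))⟩
  have hwide := hc.isWide hfill hc' (hB' ▸ Nat.le_mul_of_pos_left _ (by omega)) hH
  rw [hc'.tableAccepts_iff_exists_hom hfill' hwide hH] at hanswers
  refine ⟨t, ht.trans ?_, hanswers⟩
  have hlength : c.B ≤ 5 * (encode H G).length := hB.trans_le (add_add_ten_le_length_encode H G)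
  calc K * c'.B ^ D = K * (c.B * 2 ^ c.width) ^ D := by rw [hB']
    _ ≤ K * (5 * (encode H G).length *
          2 ^ (6 * (maxDeg G * fvs G) + (cc H + 6))) ^ D := by
      gcongr
      exacts [one_le_two, hc.width_le hfill]
    _ = timeFactor K D (maxDeg G, fvs G, cc H) * (encode H G).length ^ D := by
      rw [timeFactor, mul_right_comm, mul_pow, mul_assoc]
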